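/- **Setting.** Let $m\ge 2$ agents be the vertices of a connected undirected graph $G$ with Laplacian $\bar W$. Let $C\in\mathbb R^{n\times n}$ be a cost matrix with $\|C\|_\infty=\max_{i,j}|C_{ij}|$, let $q_1,\dots,q_m$ lie in the standard probability simplex $S_n(1)$, and let $\mu>0$. For $p,q\in S_n(1)$ put $$\mathcal W_{\mu,q}(p)=\min\{\langle C,\pi\rangle+\mu\langle\pi,\ln\pi\rangle:\ \pi\ge 0,\ \pi\mathbf 1=p,\ \pi^T\mathbf 1=q\},$$ with conjugate $\mathcal W^*_{q,\mu}(u)=\mu\sum_j q_j\ln\big(\tfrac1{q_j}\sum_i e^{(-C_{ij}+u_i)/\mu}\big)$. The (regularized) Wasserstein barycenter problem is $\min_{p\in S_n(1)}\sum_{i=1}^m\mathcal W_{\mu,q_i}(p)$. Put $W=\bar W\otimes I_n$; let $\lambda_{\max}(W)$ be its largest and $\lambda^+_{\min}(W)$ its smallest non-zero eigenvalue, and $$\chi=\frac{\lambda_{\max}(W)}{\lambda^+_{\min}(W)},\quad M_F^2=2nm\|C\|_\infty^2,\quad L_\psi=\frac{\lambda_{\max}(W)}{\mu},\quad \sigma_\psi^2=m\lambda_{\max}(W),\quad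 S=\sqrt{\frac{M_F^2}{\mu\varepsilon}\chi}.$$ The dual problem is $\min_{\mathbf y\in\mathbb R^{nm}}\psi(\mathbf y)$, where $\psi(\mathbf y)=\sum_i\mathcal W^*_{q_i,\mu}([\sqrt W\mathbf y]_i)$. **Algorithm.** For one sample $\xi$, node $i$ selects an index $j=\xi_i$ with probability $(q_i)_j$; set $[\mathbf x(\mathbf u,\xi)]_{i,l}=e^{(-C_{lj}+u_{i,l})/\mu}\big/\sum_{l'}e^{(-C_{l'j}+u_{i,l'})/\mu}$, so that $\sqrt W\mathbf x(\sqrt W\mathbf y,\xi)$ is a stochastic gradient of $\psi$ at $\mathbf y$. Let $\mathbf x(\mathbf u,\{\xi_s\}_{s=1}^r)$ be the average over $r$ independent samples. Start from $\zeta^0=\mathbf y^0=0$, $A_0=\alpha_0=0$. For $k=0,\dots,N-1$ let $\alpha_{k+1}>0$ solve $A_{k+1}=A_k+\alpha_{k+1}=2L_\psi\alpha_{k+1}^2$ and set $$\lambda^{k+1}=\tfrac{\alpha_{k+1}\zeta^k+A_k\mathbf y^k}{A_{k+1}},\quad \zeta^{k+1}=\zeta^k-\alpha_{k+1}\sqrt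 W\,\mathbf x\big(\sqrt W\lambda^{k+1},\{\xi^{k+1}_s\}_{s=1}^{r_{k+1}}\big),\quad \mathbf y^{k+1}=\tfrac{\alpha_{k+1}\zeta^{k+1}+A_k\mathbf y^k}{A_{k+1}},$$ with fresh samples in every iteration. The output is $\mathtt p^N=\frac1{A_N}\sum_{k=1}^N\alpha_k\,\mathbf x(\sqrt W\lambda^k,\{\xi^k_s\}_{s=1}^{r_k})$. **Corollary (Wasserstein barycenters).** There are absolute constants $c_N,c_r>0$ such that the following holds for all data as above, all $\varepsilon>0$, $\delta\in(0,\frac14)$, all $N\ge1$ with $N\ge c_N S$, and all batch sizes $$r_k\ \ge\ c_r\max\Big\{1,\ \frac{\sigma_\psi^2\,\alpha_k\ln(N/\delta)}{\varepsilon}\Big\},\qquad k=1,\dots,N.$$ 1. The dual problem has an optimal solution $\mathbf y^*$ with $\|\mathbf y^*\|_2\le M_F/\sqrt{\lambda^+_{\min}(W)}$, and the barycenter problem has a solution $p^*$. For every $R_{\mathbf y}$ with $R_{\mathbf y}\le M_F/\sqrt{\lambda^+_{\min}(W)}$ that bounds the norm of some dual optimal solution, with probability at least $1-4\delta$, $$\sum_{i=1}^m\mathcal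 W_{\mu,q_i}(\mathtt p^N_i)-\sum_{i=1}^m\mathcal W_{\mu,q_i}(p^*)\le\varepsilon\qquad\text{and}\qquad\|\sqrt W\,\mathtt p^N\|_2\le\frac{\varepsilon}{R_{\mathbf y}}$$ (the second inequality being void if $R_{\mathbf y}=0$). 2. If $S\ge 1$ and $N$ and $r_k$ are of these orders, that is, $N\le\kappa S$ and $r_k\le\kappa\max\{1,\sigma_\psi^2\alpha_k\ln(N/\delta)/\varepsilon\}$ for a constant $\kappa$, then the total complexity of every node (arithmetic operations for its stochastic oracle calls and its local updates, where drawing an index costs $n$ operations, in the implementation with one communication round per iteration; the work of the $N$ communication rounds themselves is not included) is at most $$c_T\; n\,\max\Big\{\frac{mM_F^2}{\varepsilon^2}\,\chi\,\ln\Big(\frac1\delta\sqrt{\frac{M_F^2}{\mu\varepsilon}\chi}\Big),\ \sqrt{\frac{M_F^2}{\mu\varepsilon}\chi}\Big\},$$ where $c_T$ depends only on $\kappa$. -/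

import Mathlib

open MeasureTheory ProbabilityTheory

namespace WBary

noncomputable section

open scoped MatrixOrder Kronecker

/-! ## Entropically regularized optimal transport -/

/-- Nonnegative matrices with row sums `p` and column sums `q`. -/
def transportPlans {n : ℕ} (p q : Fin n → ℝ) : Set (Matrix (Fin n) (Fin n) ℝ) :=
  {π | (∀ i j, 0 ≤ π i j) ∧ (∀ i, ∑ j, π i j = p i) ∧ ∀ j, ∑ i, π i j = q j}

/-- `⟨C, π⟩ + μ ⟨π, ln π⟩`, with `0 ln 0 = 0`. -/
def transportCost {n : ℕ} (μ : ℝ) (C π : Matrix (Fin n) (Fin n) ℝ) : ℝ :=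
  ∑ i, ∑ j, C i j * π i j + μ * ∑ i, ∑ j, π i j * Real.log (π i j)

/-- The regularized Wasserstein distance `𝒲_{μ,q}(p)`.  For `p, q` in the simplex the infimum is
a minimum, see `regW_isLeast`. -/
def regW {n : ℕ} (μ : ℝ) (C : Matrix (Fin n) (Fin n) ℝ) (q p : Fin n → ℝ) : ℝ :=
  sInf (transportCost μ C '' transportPlans p q)

lemma regW_isLeast {n : ℕ} (μ : ℝ) (C : Matrix (Fin n) (Fin n) ℝ) {q p : Fin n → ℝ}
    (hq : q ∈ stdSimplex ℝ (Fin n)) (hp : p ∈ stdSimplex ℝ (Fin n)) :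
    IsLeast (transportCost μ C '' transportPlans p q) (regW μ C q p) := by
  have hne : (transportPlans p q).Nonempty := by
    refine ⟨fun i j => p i * q j, fun i j => mul_nonneg (hp.1 i) (hq.1 j), fun i => ?_, fun j => ?_⟩
    · rw [← Finset.mul_sum, hq.2, mul_one]
    · rw [← Finset.sum_mul, hp.2, one_mul]
  have hcl : IsClosed (transportPlans p q) := by
    have h1 : IsClosed {π : Matrix (Fin n) (Fin n) ℝ | ∀ i j, 0 ≤ π i j} := by
      simp only [Set.ofPred_forall]
      exact isClosed_iInter fun i => isClosed_iInter fun j =>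
        isClosed_le continuous_const (by fun_prop)
    have h2 : IsClosed {π : Matrix (Fin n) (Fin n) ℝ | ∀ i, ∑ j, π i j = p i} := by
      simp only [Set.ofPred_forall]
      exact isClosed_iInter fun i => isClosed_eq (by fun_prop) continuous_const
    have h3 : IsClosed {π : Matrix (Fin n) (Fin n) ℝ | ∀ j, ∑ i, π i j = q j} := by
      simp only [Set.ofPred_forall]
      exact isClosed_iInter fun i => isClosed_eq (by fun_prop) continuous_const
    exact h1.inter (h2.inter h3)
  have hsub : transportPlans p q ⊆
      Set.pi Set.univ fun i => Set.pi Set.univ fun _ : Fin n => Set.Icc (0 : ℝ) (p i) := by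
    rintro π ⟨h0, hr, -⟩ i - j -
    exact ⟨h0 i j, (hr i) ▸ Finset.single_le_sum (fun l _ => h0 i l) (Finset.mem_univ j)⟩
  have hcomp : IsCompact (transportPlans p q) :=
    (isCompact_univ_pi fun i => isCompact_univ_pi fun _ => isCompact_Icc).of_isClosed_subset
      hcl hsub
  have hcont : Continuous (transportCost μ C) := by
    unfold transportCost
    have h (i j : Fin n) : Continuous fun π : Matrix (Fin n) (Fin n) ℝ =>
        π i j * Real.log (π i j) :=
      Real.continuous_mul_log.comp (by fun_prop : Continuous fun π : Matrix (Fin n) (Fin n) ℝ =>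
        π i j)
    refine Continuous.add (by fun_prop) (continuous_const.mul ?_)
    exact continuous_finsetSum _ fun i _ => continuous_finsetSum _ fun j _ => h i j
  exact (hcomp.image hcont).isLeast_sInf (hne.image _)

/-- The `j`-th component `u ↦ μ ln ((1/q_j) ∑_i exp((-C_{ij} + u_i)/μ))` of the conjugate. -/
def conjComp {n : ℕ} (μ : ℝ) (C : Matrix (Fin n) (Fin n) ℝ) (q : Fin n → ℝ) (j : Fin n)
    (u : Fin n → ℝ) : ℝ :=
  μ * Real.log (1 / q j * ∑ i, Real.exp ((-C i j + u i) / μ))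

/-- The conjugate `𝒲*_{q,μ}(u) = μ ∑_j q_j ln ((1/q_j) ∑_i exp((-C_{ij} + u_i)/μ))`. -/
def conjW {n : ℕ} (μ : ℝ) (C : Matrix (Fin n) (Fin n) ℝ) (q u : Fin n → ℝ) : ℝ :=
  ∑ j, q j * conjComp μ C q j u

/-- The gradient of `conjComp μ C q j` at `u`, see `conjComp_hasGradientAt`. -/
def compGrad {n : ℕ} (μ : ℝ) (C : Matrix (Fin n) (Fin n) ℝ) (u : Fin n → ℝ) (j : Fin n) :
    Fin n → ℝ :=
  fun i => Real.exp ((-C i j + u i) / μ) / ∑ l, Real.exp ((-C l j + u l) / μ)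

lemma conjComp_hasGradientAt {n : ℕ} {μ : ℝ} (hμ : μ ≠ 0) (C : Matrix (Fin n) (Fin n) ℝ)
    (q : Fin n → ℝ) (j : Fin n) (hq : q j ≠ 0) (u : EuclideanSpace ℝ (Fin n)) :
    HasGradientAt (fun v : EuclideanSpace ℝ (Fin n) => conjComp μ C q j v.ofLp)
      (WithLp.toLp 2 (compGrad μ C u.ofLp j)) u := by
  have hpos : 0 < ∑ i, Real.exp ((-C i j + u i) / μ) :=
    Finset.sum_pos (fun i _ => Real.exp_pos _) ⟨j, Finset.mem_univ j⟩
  have h1 (i : Fin n) : HasFDerivAt (fun v : EuclideanSpace ℝ (Fin n) => (-C i j + v i) / μ)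
      (μ⁻¹ • (EuclideanSpace.proj i : EuclideanSpace ℝ (Fin n) →L[ℝ] ℝ)) u := by
    have := ((EuclideanSpace.proj i : EuclideanSpace ℝ (Fin n) →L[ℝ] ℝ).hasFDerivAt
      (x := u)).const_add (-C i j)
    simpa [div_eq_inv_mul] using this.const_mul μ⁻¹
  have h2 := (((HasFDerivAt.fun_sum (u := Finset.univ) fun i _ => (h1 i).exp).const_mul
    (1 / q j)).log (by positivity)).const_mul μ
  rw [hasGradientAt_iff_hasFDerivAt]
  refine h2.congr_fderiv ?_
  ext v
  simp only [InnerProductSpace.toDual_apply_apply, PiLp.inner_apply, compGrad,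
    smul_apply, sum_apply, smul_eq_mul, PiLp.proj_apply, RCLike.inner_apply, conj_trivial, Finset.mul_sum]
  refine Finset.sum_congr rfl fun i _ => ?_
  rw [← Finset.mul_sum]
  field_simp

/-! ## Networks and the stacked space `ℝ^{nm}` -/

/-- The data: regularization `μ`, cost matrix `C`, measures `q_1, …, q_m` on `n` points,
and the communication graph. -/
structure BaryProblem (m n : ℕ) where
  mu : ℝ
  C : Matrix (Fin n) (Fin n) ℝ
  q : Fin m → Fin n → ℝ
  G : SimpleGraph (Fin m)

/-- The stacked space, with its Euclidean norm. -/
abbrev Stacked (m n : ℕ) : Type := EuclideanSpace ℝ (Fin m × Fin n)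

/-- The `i`-th `n`-dimensional block. -/
def block {m n : ℕ} (x : Stacked m n) (i : Fin m) : Fin n → ℝ := fun j => x (i, j)

namespace BaryProblem

variable {m n : ℕ} (P : BaryProblem m n)

/-- The graph Laplacian `W̄`. -/
def lap : Matrix (Fin m) (Fin m) ℝ := by
  classical exact P.G.lapMatrix ℝ

/-- `W = W̄ ⊗ I_n`. -/
def W : Matrix (Fin m × Fin n) (Fin m × Fin n) ℝ := P.lap ⊗ₖ (1 : Matrix (Fin n) (Fin n) ℝ)

/-- `√W`, the positive semidefinite square root, as an operator on the stacked space. -/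
def sqrtW : Stacked m n →ₗ[ℝ] Stacked m n := Matrix.toEuclideanLin (CFC.sqrt P.W)

/-- `λ_max(W)`. -/
def lamMax : ℝ := sSup (spectrum ℝ P.W)

/-- `λ⁺_min(W)`, the smallest non-zero eigenvalue (`W` is positive semidefinite). -/
def lamMinPos : ℝ := sInf (spectrum ℝ P.W ∩ Set.Ioi 0)

/-- The condition number `χ(W)`. -/
def chi : ℝ := P.lamMax / P.lamMinPos

/-- `‖C‖_∞ = max_{i,j} |C_{ij}|`. -/
def normC : ℝ := ⨆ ij : Fin n × Fin n, |P.C ij.1 ij.2|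

/-- `M_F`, where `M_F² = 2 n m ‖C‖_∞²`. -/
def MF : ℝ := Real.sqrt (2 * n * m * P.normC ^ 2)

/-- `L_ψ = λ_max(W)/μ`. -/
def Lpsi : ℝ := P.lamMax / P.mu

/-- `σ_ψ² = m λ_max(W)`. -/
def sigmaPsiSq : ℝ := m * P.lamMax

/-- The barycenter objective `p ↦ ∑_i 𝒲_{μ,q_i}(p)`. -/
def objective (p : Fin n → ℝ) : ℝ := ∑ i, regW P.mu P.C (P.q i) p

/-- `p*` is a regularized Wasserstein barycenter. -/
def IsBarycenter (p : Fin n → ℝ) : Prop :=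
  p ∈ stdSimplex ℝ (Fin n) ∧ IsMinOn P.objective (stdSimplex ℝ (Fin n)) p

/-- The dual objective `ψ(y) = ∑_i 𝒲*_{q_i,μ}([√W y]_i)`. -/
def psi (y : Stacked m n) : ℝ := ∑ i, conjW P.mu P.C (P.q i) (block (P.sqrtW y) i)

/-- `y*` is an optimal solution of the dual problem. -/
def IsDualSolution (y : Stacked m n) : Prop := IsMinOn P.psi Set.univ y

end BaryProblem

/-! ## The dual stochastic accelerated method -/

/-- The positive root `α` of `A + α = 2 L α²`. -/
def stepRoot (L A : ℝ) : ℝ := (1 + Real.sqrt (1 + 8 * L * A)) / (4 * L)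

/-- `A_k`. -/
def bigA (L : ℝ) : ℕ → ℝ
  | 0 => 0
  | k + 1 => bigA L k + stepRoot L (bigA L k)

/-- `α_k`, with `α_0 = 0`. -/
def alpha (L : ℝ) : ℕ → ℝ
  | 0 => 0
  | k + 1 => stepRoot L (bigA L k)

lemma bigA_nonneg {L : ℝ} (hL : 0 < L) (k : ℕ) : 0 ≤ bigA L k := by
  induction k with
  | zero => exact le_rfl
  | succ k ih => simp only [bigA, stepRoot]; positivity

/-- `A_{k+1} = A_k + α_{k+1} = 2 L α_{k+1}²` with `α_{k+1} > 0`. -/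
lemma alpha_spec {L : ℝ} (hL : 0 < L) (k : ℕ) : 0 < alpha L (k + 1) ∧
    bigA L (k + 1) = bigA L k + alpha L (k + 1) ∧
    bigA L k + alpha L (k + 1) = 2 * L * alpha L (k + 1) ^ 2 := by
  have hA := bigA_nonneg hL k
  refine ⟨by simp only [alpha, stepRoot]; positivity, rfl, ?_⟩
  have hs := Real.sq_sqrt (show 0 ≤ 1 + 8 * L * bigA L k by positivity)
  simp only [alpha, stepRoot]
  set s := Real.sqrt (1 + 8 * L * bigA L k)
  have hA' : bigA L k = (s ^ 2 - 1) / (8 * L) := by rw [hs]; field_simp; ring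
  rw [hA']
  field_simp
  ring

/-- `λ^k, ζ^k, y^k`. -/
structure DualState (m n : ℕ) where
  lam : Stacked m n
  zeta : Stacked m n
  y : Stacked m n

namespace BaryProblem

variable {m n : ℕ} (P : BaryProblem m n)

/-- The batched primal estimate `x(u, {ξ_s}_{s<r}) = (1/r) ∑_s x(u, ξ_s)`, where a realization `ξ`
selects one component for each node: `[x(u, ξ)]_i = ∇(conjComp of q_i, component ξ i)(u_i)`.
Thus `√W x(√W y, ξ) = ∇ψ(y, ξ)`. -/
def batchX (r : ℕ) (ξ : ℕ → Fin m → Fin n) (u : Stacked m n) : Stacked m n :=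
  WithLp.toLp 2 fun ij =>
    (∑ s ∈ Finset.range r, compGrad P.mu P.C (block u ij.1) (ξ s ij.1) ij.2) / r

/-- The iterates; `r k` is the batch size and `ξ k` the samples of iteration `k`. -/
def iterate (r : ℕ → ℕ) (ξ : ℕ → ℕ → Fin m → Fin n) : ℕ → DualState m n
  | 0 => ⟨0, 0, 0⟩
  | k + 1 =>
    let s := iterate r ξ k
    let a := alpha P.Lpsi (k + 1)
    let A := bigA P.Lpsi k
    let A' := bigA P.Lpsi (k + 1)
    let lam := A'⁻¹ • (a • s.zeta + A • s.y)
    let zeta := s.zeta - a • P.sqrtW (P.batchX (r (k + 1)) (ξ (k + 1)) (P.sqrtW lam))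
    ⟨lam, zeta, A'⁻¹ • (a • zeta + A • s.y)⟩

/-- The output `p^N = (1/A_N) ∑_{k=0}^N α_k x(√W λ^k, {ξ^k_s}_{s<r_k})`. -/
def output (r : ℕ → ℕ) (ξ : ℕ → ℕ → Fin m → Fin n) (N : ℕ) : Stacked m n :=
  (bigA P.Lpsi N)⁻¹ • ∑ k ∈ Finset.range (N + 1), alpha P.Lpsi k •
    P.batchX (r k) (ξ k) (P.sqrtW (P.iterate r ξ k).lam)

end BaryProblem

/-- The samples `ξ^k_s` are independent, and node `i` selects component `j` with probability
`q_i(j)`.  (The choices of different nodes within one sample may depend on each other.) -/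
structure IsSampling {m n : ℕ} (q : Fin m → Fin n → ℝ) {Ω : Type*} [MeasurableSpace Ω]
    (Pr : Measure Ω) (ξ : ℕ → ℕ → Ω → Fin m → Fin n) : Prop where
  measurable : ∀ k s, Measurable (ξ k s)
  law : ∀ k s i j, Pr.real {ω | ξ k s ω i = j} = q i j
  indep : iIndepFun (fun ks : ℕ × ℕ => ξ ks.1 ks.2) Pr

/-! ## Operation counts: the method as executed by the nodes of the network -/

/-- A value together with the number of operations spent on computing it. -/
structure Counted (α : Type) where
  val : α
  ops : ℕ

namespace Counted

instance : Monad Counted where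
  pure a := ⟨a, 0⟩
  bind x f := ⟨(f x.val).val, x.ops + (f x.val).ops⟩

/-- Real arithmetic, one operation each. -/
def add (a b : ℝ) : Counted ℝ := ⟨a + b, 1⟩
def sub (a b : ℝ) : Counted ℝ := ⟨a - b, 1⟩
def mul (a b : ℝ) : Counted ℝ := ⟨a * b, 1⟩
def div (a b : ℝ) : Counted ℝ := ⟨a / b, 1⟩
def exp (a : ℝ) : Counted ℝ := ⟨Real.exp a, 1⟩
def sqrt (a : ℝ) : Counted ℝ := ⟨Real.sqrt a, 1⟩

/-- Drawing an index in `{1, …, n}` from a given distribution (the drawn index is supplied):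
`n` operations. -/
def draw {n : ℕ} (j : Fin n) : Counted (Fin n) := ⟨j, n⟩

/-- Computing a vector entry by entry. -/
def vec {n : ℕ} (f : Fin n → Counted ℝ) : Counted (Fin n → ℝ) :=
  ⟨fun i => (f i).val, ∑ i, (f i).ops⟩

/-- Summing the entries of a vector: `n` additions to an accumulator. -/
def sum {n : ℕ} (f : Fin n → ℝ) : Counted ℝ := ⟨∑ i, f i, n⟩

/-- `for s in {0, …, r-1}`. -/
def loop {α : Type} : ℕ → (ℕ → α → Counted α) → α → Counted α
  | 0, _, a => pure a
  | r + 1, f, a => do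
    let b ← loop r f a
    f r b

@[simp] lemma pure_val {α : Type} (a : α) : (pure a : Counted α).val = a := rfl
@[simp] lemma bind_val {α β : Type} (x : Counted α) (f : α → Counted β) :
    (x >>= f).val = (f x.val).val := rfl

end Counted

open Counted

/-- One call of the stochastic oracle of a node: draw a component and evaluate its gradient. -/
def oracleProg {n : ℕ} (μ : ℝ) (C : Matrix (Fin n) (Fin n) ℝ) (u : Fin n → ℝ) (j : Fin n) :
    Counted (Fin n → ℝ) := do
  let l ← draw j
  let e ← vec fun i => do
    let a ← sub (u i) (C i l)
    let b ← div a μ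
    exp b
  let s ← sum e
  vec fun i => div (e i) s

/-- The average of `r` oracle calls. -/
def batchProg {n : ℕ} (μ : ℝ) (C : Matrix (Fin n) (Fin n) ℝ) (r : ℕ) (ξ : ℕ → Fin n)
    (u : Fin n → ℝ) : Counted (Fin n → ℝ) := do
  let s ← loop r (fun t acc => do
    let x ← oracleProg μ C u (ξ t)
    vec fun i => add (acc i) (x i)) 0
  vec fun i => div (s i) r

/-- `(a z + A y)/A'`. -/
def combineProg {n : ℕ} (a A A' : ℝ) (z y : Fin n → ℝ) : Counted (Fin n → ℝ) :=
  vec fun i => do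
    let s ← mul a (z i)
    let t ← mul A (y i)
    let w ← add s t
    div w A'

/-- `α_{k+1}` from `A_k`. -/
def stepProg (L A : ℝ) : Counted ℝ := do
  let b ← mul 8 L
  let c ← mul b A
  let d ← add 1 c
  let e ← sqrt d
  let f ← add 1 e
  let g ← mul 4 L
  div f g

/-- What a node stores: its blocks of `√W ζ^k`, `√W y^k` and `∑_{l ≤ k} α_l x^l`, and `A_k`. -/
structure NodeState (n : ℕ) where
  zetaBar : Fin n → ℝ
  yBar : Fin n → ℝ
  acc : Fin n → ℝ
  A : ℝ

/-- What a node computes before a communication round: `α_{k+1}`, `A_{k+1}` and its block of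
`x^{k+1}`, which it then sends to its neighbours. -/
structure NodeMessage (n : ℕ) where
  a : ℝ
  A' : ℝ
  x : Fin n → ℝ

namespace BaryProblem

variable {m n : ℕ} (P : BaryProblem m n)

/-- Local work of a node before the communication round. -/
def beforeProg (r : ℕ) (ξ : ℕ → Fin n) (s : NodeState n) : Counted (NodeMessage n) := do
  let a ← stepProg P.Lpsi s.A
  let A' ← add s.A a
  let lamBar ← combineProg a s.A A' s.zetaBar s.yBar
  let x ← batchProg P.mu P.C r ξ lamBar
  pure ⟨a, A', x⟩

/-- Local work of a node after the communication round, which delivers `g = ∑_j W̄_{ij} x_j`. -/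
def afterProg (s : NodeState n) (w : NodeMessage n) (g : Fin n → ℝ) : Counted (NodeState n) := do
  let zetaBar ← vec fun j => do
    let b ← mul w.a (g j)
    sub (s.zetaBar j) b
  let yBar ← combineProg w.a s.A w.A' zetaBar s.yBar
  let acc ← vec fun j => do
    let b ← mul w.a (w.x j)
    add (s.acc j) b
  pure ⟨zetaBar, yBar, acc, w.A'⟩

/-- The state of node `i` after `k` iterations (one communication round each), with the number of
operations that node `i` has executed. -/
def nodeRun (r : ℕ → ℕ) (ξ : ℕ → ℕ → Fin m → Fin n) : ℕ → Fin m → Counted (NodeState n)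
  | 0, _ => pure ⟨0, 0, 0, 0⟩
  | k + 1, i => do
    let s ← nodeRun r ξ k i
    let w ← P.beforeProg (r (k + 1)) (fun t => ξ (k + 1) t i) s
    afterProg s w (∑ j, P.lap i j •
      (P.beforeProg (r (k + 1)) (fun t => ξ (k + 1) t j) (nodeRun r ξ k j).val).val.x)

/-- Node `i`'s computation of its block of the output. -/
def nodeOutput (r : ℕ → ℕ) (ξ : ℕ → ℕ → Fin m → Fin n) (N : ℕ) (i : Fin m) :
    Counted (Fin n → ℝ) := do
  let s ← P.nodeRun r ξ N i
  vec fun j => div (s.acc j) s.A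

lemma sqrtW_sqrtW_block (x : Stacked m n) (i : Fin m) :
    block (P.sqrtW (P.sqrtW x)) i = ∑ j, P.lap i j • block x j := by
  have hpsd : P.W.PosSemidef := by
    classical
    have h : P.lap.PosSemidef := by
      unfold lap
      convert SimpleGraph.posSemidef_lapMatrix ℝ P.G
    exact h.kronecker Matrix.PosSemidef.one
  have hs : CFC.sqrt P.W * CFC.sqrt P.W = P.W := CFC.sqrt_mul_sqrt_self _ hpsd.nonneg
  funext k
  simp only [block, sqrtW, Matrix.toLpLin_apply, Matrix.mulVec_mulVec, hs]
  simp [Matrix.mulVec, dotProduct, W, Matrix.kroneckerMap_apply, Fintype.sum_prod_type,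
    Matrix.one_apply, Finset.sum_apply, block]

lemma loop_batch_val (μ : ℝ) (C : Matrix (Fin n) (Fin n) ℝ) (r : ℕ) (ξ : ℕ → Fin n)
    (u : Fin n → ℝ) : (batchProg μ C r ξ u).val =
      fun j => (∑ s ∈ Finset.range r, compGrad μ C u (ξ s) j) / r := by
  have key : ∀ r : ℕ, (loop r (fun t acc => do
      let x ← oracleProg μ C u (ξ t)
      vec fun i => add (acc i) (x i)) (0 : Fin n → ℝ)).val =
      fun j => ∑ s ∈ Finset.range r, compGrad μ C u (ξ s) j := by
    intro r
    induction r with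
    | zero => funext j; simp [loop]
    | succ r ih =>
      funext j
      simp only [loop, bind_val, ih, Finset.sum_range_succ]
      simp [vec, add, oracleProg, draw, sub, div, exp, sum, compGrad, sub_eq_neg_add]
  funext j
  simp only [batchProg, bind_val, key]
  simp [vec, div]

/-- The nodes' programs compute the iterates of the method. -/
lemma nodeRun_val (r : ℕ → ℕ) (ξ : ℕ → ℕ → Fin m → Fin n) (k : ℕ) (i : Fin m) :
    (P.nodeRun r ξ k i).val =
      ⟨block (P.sqrtW (P.iterate r ξ k).zeta) i, block (P.sqrtW (P.iterate r ξ k).y) i,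
        block (∑ l ∈ Finset.range (k + 1), alpha P.Lpsi l •
          P.batchX (r l) (ξ l) (P.sqrtW (P.iterate r ξ l).lam)) i, bigA P.Lpsi k⟩ := by
  induction k generalizing i with
  | zero =>
    simp only [nodeRun, pure_val, iterate, map_zero, bigA, alpha, zero_smul, zero_add,
      Finset.range_one, Finset.sum_singleton]
    rfl
  | succ k ih =>
    have hbefore : ∀ j, (P.beforeProg (r (k + 1)) (fun t => ξ (k + 1) t j)
        (P.nodeRun r ξ k j).val).val = ⟨alpha P.Lpsi (k + 1), bigA P.Lpsi (k + 1),
          block (P.batchX (r (k + 1)) (ξ (k + 1)) (P.sqrtW (P.iterate r ξ (k + 1)).lam)) j⟩ := by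
      intro j
      have hlam : (combineProg (alpha P.Lpsi (k + 1)) (bigA P.Lpsi k) (bigA P.Lpsi (k + 1))
          (block (P.sqrtW (P.iterate r ξ k).zeta) j) (block (P.sqrtW (P.iterate r ξ k).y) j)).val
          = block (P.sqrtW (P.iterate r ξ (k + 1)).lam) j := by
        funext l
        simp [combineProg, vec, add, mul, div, iterate, block, div_eq_inv_mul, mul_add]
      rw [ih j]
      simp only [beforeProg, bind_val, pure_val, loop_batch_val]
      have hstep : (stepProg P.Lpsi (bigA P.Lpsi k)).val = alpha P.Lpsi (k + 1) := rfl
      have hA : (add (bigA P.Lpsi k) (alpha P.Lpsi (k + 1))).val = bigA P.Lpsi (k + 1) := rfl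
      rw [hstep, hA, hlam]
      rfl
    have hb := hbefore i
    simp only [nodeRun, bind_val]
    simp only [hbefore]
    rw [ih i]
    simp only [← P.sqrtW_sqrtW_block]
    have hz : (vec fun j => do
        let b ← mul (alpha P.Lpsi (k + 1)) (block (P.sqrtW (P.sqrtW
          (P.batchX (r (k + 1)) (ξ (k + 1)) (P.sqrtW (P.iterate r ξ (k + 1)).lam)))) i j)
        sub (block (P.sqrtW (P.iterate r ξ k).zeta) i j) b).val =
        block (P.sqrtW (P.iterate r ξ (k + 1)).zeta) i := by
      funext l
      simp [vec, mul, sub, iterate, block]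
    simp only [afterProg, bind_val, pure_val]
    rw [hz]
    congr 1
    · funext l
      simp [combineProg, vec, add, mul, div, iterate, block, div_eq_inv_mul, mul_add]
    · funext l
      rw [Finset.sum_range_succ _ (k + 1)]
      simp [vec, add, mul, block]

lemma nodeOutput_val (r : ℕ → ℕ) (ξ : ℕ → ℕ → Fin m → Fin n) (N : ℕ) (i : Fin m) :
    (P.nodeOutput r ξ N i).val = block (P.output r ξ N) i := by
  simp only [nodeOutput, bind_val, nodeRun_val]
  funext j
  simp [vec, div, output, block, div_eq_inv_mul]

/-- The total complexity of node `i`: the number of operations it executes. -/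
def nodeComplexity (r : ℕ → ℕ) (ξ : ℕ → ℕ → Fin m → Fin n) (N : ℕ) (i : Fin m) : ℕ :=
  (P.nodeOutput r ξ N i).ops

end BaryProblem

end

end WBary

/-!
The dual objective `ψ` is smooth and its gradient at `y` is `√W x(√W y)`, where `x` is an average
of softmax vectors; the batches give an unbiased estimate of it. Testing the accelerated gradient
method against an arbitrary point `z` of the ball of radius `2 R` yields a primal-dual inequality:
`A_N` times the duality gap of `y^N` and `p^N`, plus the consensus penalty `2 R ‖√W p^N‖`, is at
most `2 R²` plus terms which are linear or quadratic in the errors of the batches. The batch errors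
are martingale differences, so the linear terms obey a Freedman-type bound whose variance involves
the distances of the iterates from the dual solution; an induction along the iterations keeps these
distances below `√(A_N ε)`. Since `R² ≤ M_F² / λ⁺_min` and `A_N` grows like `μ N² / λ_max`, `N` of
order `S` makes the total error at most `A_N ε`. That the output is built from the samples and not
from their means costs a further term, controlled by the empirical frequencies of the drawn indices:
the `i`-th block of `p^N` is a mixture of softmax columns, and the plan with these columns has the
empirical frequencies in place of `q_i` as its second marginal.
-/

namespace WBary

open Finset

/-! ### Log-sum-exp and softmax -/

section LogSumExp

variable {ι : Type*} [Fintype ι]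

lemma sum_mul_exp_le_of_abs_le {w x : ι → ℝ} {b : ℝ} (hw : w ∈ stdSimplex ℝ ι)
    (hx : ∀ i, |x i| ≤ b) :
    ∑ i, w i * Real.exp (x i) ≤ Real.exp (∑ i, w i * x i + b ^ 2 / 2) := by
  let _ : MeasurableSpace ι := ⊤
  let ν : PMF ι := PMF.ofFintype (fun i => ENNReal.ofReal (w i)) <| by
    rw [← ENNReal.ofReal_sum_of_nonneg fun i _ => hw.1 i, hw.2, ENNReal.ofReal_one]
  have integral_eq (f : ι → ℝ) : ∫ i, f i ∂ν.toMeasure = ∑ i, w i * f i := by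
    simp [PMF.integral_eq_sum, ν, ENNReal.toReal_ofReal (hw.1 _)]
  have hoeffding := (hasSubgaussianMGF_of_mem_Icc (μ := ν.toMeasure) (X := x) (a := -b) (b := b)
    Measurable.of_discrete.aemeasurable (ae_of_all _ fun i => abs_le.1 (hx i))).mgf_le 1
  have parameter_eq : (((‖b - -b‖₊ / 2) ^ 2 : NNReal) : ℝ) = b ^ 2 := by
    rw [sub_neg_eq_add, ← two_mul]
    simp
  simp only [mgf, integral_eq, one_mul, one_pow, mul_one, parameter_eq, Real.exp_sub,
    ← mul_div_assoc, ← sum_div] at hoeffding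
  rwa [div_le_iff₀' (Real.exp_pos _), ← Real.exp_add] at hoeffding

/-- The smooth maximum `μ ln ∑_i exp(x_i / μ)`. -/
noncomputable def logSumExp (μ : ℝ) (x : ι → ℝ) : ℝ :=
  μ * Real.log (∑ i, Real.exp (x i / μ))

/-- The Gibbs distribution with energies `-x` at temperature `μ`, the gradient of
`logSumExp μ` at `x`. -/
noncomputable def softmax (μ : ℝ) (x : ι → ℝ) (i : ι) : ℝ :=
  Real.exp (x i / μ) / ∑ l, Real.exp (x l / μ)

lemma softmax_const_add (μ c : ℝ) (x : ι → ℝ) :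
    softmax μ (fun i => c + x i) = softmax μ x := by
  ext i
  simp only [softmax, add_div, Real.exp_add, ← mul_sum]
  exact mul_div_mul_left _ _ (Real.exp_pos _).ne'

lemma mul_log_add_sub_le {x c : ℝ} (hx : 0 ≤ x) (hc : 0 < c) :
    x * Real.log c + x - c ≤ x * Real.log x := by
  rcases hx.eq_or_lt with rfl | hx
  · simpa using hc.le
  · have h := mul_le_mul_of_nonneg_left (Real.log_le_sub_one_of_pos (div_pos hc hx)) hx.le
    rw [Real.log_div hc.ne' hx.ne', mul_sub, mul_sub, mul_div_cancel₀ _ hx.ne'] at h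
    linarith

variable [Nonempty ι] {μ : ℝ}

lemma sum_exp_pos (x : ι → ℝ) : 0 < ∑ i, Real.exp (x i) :=
  sum_pos (fun _ _ => Real.exp_pos _) univ_nonempty

lemma softmax_pos (x : ι → ℝ) (i : ι) : 0 < softmax μ x i :=
  div_pos (Real.exp_pos _) (sum_exp_pos fun i => x i / μ)

lemma sum_softmax (x : ι → ℝ) : ∑ i, softmax μ x i = 1 := by
  simp only [softmax, ← sum_div]
  exact div_self (sum_exp_pos _).ne'

lemma softmax_mem_stdSimplex (x : ι → ℝ) : softmax μ x ∈ stdSimplex ℝ ι :=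
  ⟨fun i => (softmax_pos x i).le, sum_softmax x⟩

lemma mul_log_softmax (hμ : μ ≠ 0) (x : ι → ℝ) (i : ι) :
    μ * Real.log (softmax μ x i) = x i - logSumExp μ x := by
  rw [softmax, Real.log_div (Real.exp_pos _).ne' (sum_exp_pos _).ne', Real.log_exp, mul_sub,
    mul_div_cancel₀ _ hμ, logSumExp]

lemma logSumExp_eq_add (x y : ι → ℝ) :
    logSumExp μ y = logSumExp μ x +
      μ * Real.log (∑ i, softmax μ x i * Real.exp ((y i - x i) / μ)) := by
  have hZ := sum_exp_pos fun i => x i / μ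
  have hsum : ∑ i, softmax μ x i * Real.exp ((y i - x i) / μ) =
      (∑ i, Real.exp (y i / μ)) / ∑ i, Real.exp (x i / μ) := by
    rw [sum_div]
    refine sum_congr rfl fun i _ => ?_
    rw [softmax, sub_div, Real.exp_sub]
    field_simp
  rw [hsum, Real.log_div (sum_exp_pos _).ne' hZ.ne', logSumExp, logSumExp]
  ring

lemma logSumExp_ge (hμ : 0 < μ) (x y : ι → ℝ) :
    logSumExp μ x + ∑ i, softmax μ x i * (y i - x i) ≤ logSumExp μ y := by
  have jensen : Real.exp (∑ i, softmax μ x i * ((y i - x i) / μ)) ≤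
      ∑ i, softmax μ x i * Real.exp ((y i - x i) / μ) := by
    simpa using convexOn_exp.map_sum_le (t := univ) (w := softmax μ x)
      (p := fun i => (y i - x i) / μ) (fun i _ => (softmax_pos x i).le) (sum_softmax x)
      fun i _ => Set.mem_univ _
  have h := mul_le_mul_of_nonneg_left (Real.log_le_log (Real.exp_pos _) jensen) hμ.le
  simp only [Real.log_exp, ← mul_div_assoc, ← sum_div] at h
  rw [mul_div_cancel_left₀ _ hμ.ne'] at h
  rw [logSumExp_eq_add x y]
  gcongr

lemma logSumExp_le (hμ : 0 < μ) (x y : ι → ℝ) :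
    logSumExp μ y ≤ logSumExp μ x + ∑ i, softmax μ x i * (y i - x i) +
      (∑ i, (y i - x i) ^ 2) / (2 * μ) := by
  set d : ι → ℝ := fun i => (y i - x i) / μ with hd
  have abs_le (i : ι) : |d i| ≤ √(∑ i, d i ^ 2) := Real.abs_le_sqrt <|
    single_le_sum (f := fun i => d i ^ 2) (fun i _ => sq_nonneg _) (mem_univ i)
  have hsq : √(∑ i, d i ^ 2) ^ 2 = (∑ i, (y i - x i) ^ 2) / μ ^ 2 := by
    rw [Real.sq_sqrt (sum_nonneg fun i _ => sq_nonneg _), sum_div]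
    exact sum_congr rfl fun i _ => div_pow ..
  have hpos : 0 < ∑ i, softmax μ x i * Real.exp (d i) :=
    sum_pos (fun i _ => mul_pos (softmax_pos x i) (Real.exp_pos _)) univ_nonempty
  have h := mul_le_mul_of_nonneg_left (Real.log_le_log hpos
    (sum_mul_exp_le_of_abs_le (softmax_mem_stdSimplex x) abs_le)) hμ.le
  rw [Real.log_exp, hsq] at h
  simp only [hd, ← mul_div_assoc, ← sum_div] at h
  rw [logSumExp_eq_add x y, add_assoc]
  refine add_le_add_right (h.trans_eq ?_) _
  field_simp

lemma sum_logSumExp_le_of_softmax_eq {κ : Type*} [Fintype κ] (hμ : 0 < μ) {g h : κ → ι → ℝ}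
    {σ : ι → ℝ} (hg : ∀ k, softmax μ (g k) = σ) (hsum : ∀ i, ∑ k, g k i = ∑ k, h k i) :
    ∑ k, logSumExp μ (g k) ≤ ∑ k, logSumExp μ (h k) := by
  have tangent := sum_le_sum fun k (_ : k ∈ univ) => logSumExp_ge hμ (g k) (h k)
  have slope : ∑ k, ∑ i, softmax μ (g k) i * (h k i - g k i) = 0 := by
    simp only [hg]
    rw [sum_comm]
    exact sum_eq_zero fun i _ => by
      rw [← mul_sum, sum_sub_distrib, hsum, sub_self, mul_zero]
  rwa [sum_add_distrib, slope, add_zero] at tangent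

lemma logSumExp_le_add (hμ : 0 < μ) {x y : ι → ℝ} {c : ℝ} (h : ∀ i, x i ≤ y i + c) :
    logSumExp μ x ≤ logSumExp μ y + c := by
  have hsum : ∑ i, Real.exp (x i / μ) ≤ (∑ i, Real.exp (y i / μ)) * Real.exp (c / μ) := by
    rw [sum_mul]
    refine sum_le_sum fun i _ => ?_
    rw [← Real.exp_add, ← add_div]
    gcongr
    exact h i
  have hlog := mul_le_mul_of_nonneg_left (Real.log_le_log (sum_exp_pos _) hsum) hμ.le
  rwa [Real.log_mul (sum_exp_pos _).ne' (Real.exp_pos _).ne', Real.log_exp, mul_add,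
    mul_div_cancel₀ _ hμ.ne'] at hlog

/-- Gibbs' variational principle for a measure `θ` of arbitrary total mass. -/
lemma sum_mul_sub_entropy_le (hμ : 0 < μ) {θ : ι → ℝ} (hθ : ∀ i, 0 ≤ θ i) (x : ι → ℝ) :
    ∑ i, θ i * x i - μ * ∑ i, θ i * Real.log (θ i) ≤
      (∑ i, θ i) * (logSumExp μ x - μ * Real.log (∑ i, θ i)) := by
  have hs : 0 ≤ ∑ i, θ i := sum_nonneg fun i _ => hθ i
  rcases hs.eq_or_lt with hs | hs
  · have hz (i : ι) : θ i = 0 :=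
      (sum_eq_zero_iff_of_nonneg fun i _ => hθ i).1 hs.symm i (mem_univ i)
    simp [hz]
  · have hlog (i : ι) : μ * Real.log ((∑ i, θ i) * softmax μ x i) =
        μ * Real.log (∑ i, θ i) + x i - logSumExp μ x := by
      rw [Real.log_mul hs.ne' (softmax_pos x i).ne', mul_add, mul_log_softmax hμ.ne']
      ring
    have h := sum_le_sum fun i (_ : i ∈ univ) => mul_le_mul_of_nonneg_left
      (mul_log_add_sub_le (hθ i) (mul_pos hs (softmax_pos (μ := μ) x i))) hμ.le
    have hentropy : μ * ∑ i, θ i * Real.log (θ i) = ∑ i, θ i * (μ * Real.log (θ i)) := by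
      simp only [mul_sum, mul_left_comm]
    simp only [mul_sub, mul_add, mul_left_comm μ, hlog, sum_sub_distrib, sum_add_distrib,
      ← sum_mul, ← mul_sum, sum_softmax] at h
    rw [hentropy]
    linarith

end LogSumExp

/-! ### Duality and mixtures for transport plans -/

section Transport

variable {n : ℕ} {μ c : ℝ} {C : Matrix (Fin n) (Fin n) ℝ} {p q : Fin n → ℝ}

/-- The reduced profits `u - C_{·j}` of column `j`; `compGrad μ C u j` is their `softmax`. -/
def columnPotential (C : Matrix (Fin n) (Fin n) ℝ) (u : Fin n → ℝ) (j : Fin n) : Fin n → ℝ :=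
  fun i => -C i j + u i

/-- The contribution of a column `θ` in position `j` to `transportCost μ C`. -/
noncomputable def columnCost (μ : ℝ) (C : Matrix (Fin n) (Fin n) ℝ) (j : Fin n)
    (θ : Fin n → ℝ) : ℝ :=
  ∑ i, C i j * θ i + μ * ∑ i, θ i * Real.log (θ i)

lemma compGrad_eq_softmax (u : Fin n → ℝ) (j : Fin n) :
    compGrad μ C u j = softmax μ (columnPotential C u j) := rfl

lemma compGrad_mem_stdSimplex (u : Fin n → ℝ) (j : Fin n) :
    compGrad μ C u j ∈ stdSimplex ℝ (Fin n) :=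
  have : Nonempty (Fin n) := ⟨j⟩
  softmax_mem_stdSimplex _

lemma conjW_eq (q u : Fin n → ℝ) : conjW μ C q u =
    ∑ j, q j * logSumExp μ (columnPotential C u j) - μ * ∑ j, q j * Real.log (q j) := by
  rw [conjW, mul_sum, ← sum_sub_distrib]
  refine sum_congr rfl fun j _ => ?_
  have : Nonempty (Fin n) := ⟨j⟩
  rcases eq_or_ne (q j) 0 with hq | hq
  · simp [hq]
  · rw [conjComp, Real.log_mul (by simpa using hq) (sum_exp_pos _).ne', one_div, Real.log_inv,
      logSumExp]
    simp only [columnPotential]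
    ring

lemma transportCost_eq_sum_columnCost (π : Matrix (Fin n) (Fin n) ℝ) :
    transportCost μ C π = ∑ j, columnCost μ C j fun i => π i j := by
  simp only [transportCost, columnCost, sum_add_distrib, ← mul_sum]
  rw [sum_comm, sum_comm (f := fun i j => π i j * Real.log (π i j))]

lemma sum_mul_columnPotential_sub_entropy (u θ : Fin n → ℝ) (j : Fin n) :
    ∑ i, θ i * columnPotential C u j i - μ * ∑ i, θ i * Real.log (θ i) =
      ∑ i, u i * θ i - columnCost μ C j θ := by
  simp only [columnCost, columnPotential, mul_add, mul_neg, sum_add_distrib, sum_neg_distrib,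
    mul_comm (θ _) (C _ _), mul_comm (θ _) (u _)]
  ring

lemma columnCost_compGrad (hμ : 0 < μ) (u : Fin n → ℝ) (j : Fin n) :
    columnCost μ C j (compGrad μ C u j) =
      ∑ i, u i * compGrad μ C u j i - logSumExp μ (columnPotential C u j) := by
  have : Nonempty (Fin n) := ⟨j⟩
  have hentropy : μ * ∑ i, compGrad μ C u j i * Real.log (compGrad μ C u j i) =
      ∑ i, compGrad μ C u j i * columnPotential C u j i -
        logSumExp μ (columnPotential C u j) := by
    simp only [mul_sum, mul_left_comm μ, compGrad_eq_softmax, mul_log_softmax hμ.ne', mul_sub,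
      sum_sub_distrib, ← sum_mul, sum_softmax, one_mul]
  linarith [sum_mul_columnPotential_sub_entropy (μ := μ) (C := C) u (compGrad μ C u j) j]

lemma sub_conjW_le_transportCost (hμ : 0 < μ) {π : Matrix (Fin n) (Fin n) ℝ}
    (hπ : π ∈ transportPlans p q) (u : Fin n → ℝ) :
    ∑ i, u i * p i - conjW μ C q u ≤ transportCost μ C π := by
  obtain ⟨hnonneg, hrow, hcol⟩ := hπ
  have column_le (j : Fin n) : ∑ i, u i * π i j - columnCost μ C j (fun i => π i j) ≤
      q j * logSumExp μ (columnPotential C u j) - μ * (q j * Real.log (q j)) := by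
    have : Nonempty (Fin n) := ⟨j⟩
    have h := sum_mul_sub_entropy_le hμ (fun i => hnonneg i j) (columnPotential C u j)
    rw [sum_mul_columnPotential_sub_entropy u (fun i => π i j) j, hcol] at h
    linarith
  have hu : ∑ i, u i * p i = ∑ j, ∑ i, u i * π i j := by
    simp only [← hrow, mul_sum]
    exact sum_comm
  have h := sum_le_sum fun j (_ : j ∈ univ) => column_le j
  rw [sum_sub_distrib, sum_sub_distrib, ← mul_sum, ← transportCost_eq_sum_columnCost, ← hu,
    ← conjW_eq] at h
  linarith

lemma sub_conjW_le_regW (hμ : 0 < μ) (hp : p ∈ stdSimplex ℝ (Fin n))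
    (hq : q ∈ stdSimplex ℝ (Fin n)) (u : Fin n → ℝ) :
    ∑ i, u i * p i - conjW μ C q u ≤ regW μ C q p := by
  obtain ⟨π, hπ, hcost⟩ := (regW_isLeast μ C hq hp).1
  exact hcost ▸ sub_conjW_le_transportCost hμ hπ u

lemma regW_le_transportCost (hp : p ∈ stdSimplex ℝ (Fin n)) (hq : q ∈ stdSimplex ℝ (Fin n))
    {π : Matrix (Fin n) (Fin n) ℝ} (hπ : π ∈ transportPlans p q) :
    regW μ C q p ≤ transportCost μ C π :=
  (regW_isLeast μ C hq hp).2 ⟨π, hπ, rfl⟩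

lemma mul_log_sum_le {T : Type*} [Fintype T] {β x : T → ℝ} (hβ : ∀ t, 0 ≤ β t)
    (hx : ∀ t, 0 ≤ x t) :
    (∑ t, β t * x t) * Real.log (∑ t, β t * x t) ≤
      ∑ t, β t * (x t * Real.log (x t)) + (∑ t, β t * x t) * Real.log (∑ t, β t) := by
  rcases (sum_nonneg fun t _ => hβ t : 0 ≤ ∑ t, β t).eq_or_lt with hs | hs
  · have hz (t : T) : β t = 0 :=
      (sum_eq_zero_iff_of_nonneg fun t _ => hβ t).1 hs.symm t (mem_univ t)
    simp [hz]
  · have jensen := Real.convexOn_mul_log.map_sum_le (t := univ) (w := fun t => β t / ∑ t, β t)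
      (p := x) (fun t _ => div_nonneg (hβ t) hs.le) (by rw [← sum_div, div_self hs.ne'])
      fun t _ => hx t
    simp only [smul_eq_mul, div_mul_eq_mul_div, ← sum_div] at jensen
    rw [div_le_div_iff_of_pos_right hs] at jensen
    rcases (sum_nonneg fun t _ => mul_nonneg (hβ t) (hx t) :
      0 ≤ ∑ t, β t * x t).eq_or_lt with h0 | h0
    · simpa [← h0] using jensen
    · rw [Real.log_div h0.ne' hs.ne'] at jensen
      linarith

lemma columnCost_sum_le {T : Type*} [Fintype T] (hμ : 0 < μ) {β : T → ℝ} {θ : T → Fin n → ℝ}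
    (hβ : ∀ t, 0 ≤ β t) (hθ : ∀ t, θ t ∈ stdSimplex ℝ (Fin n)) (j : Fin n) :
    columnCost μ C j (fun l => ∑ t, β t * θ t l) ≤
      ∑ t, β t * columnCost μ C j (θ t) + μ * ((∑ t, β t) * Real.log (∑ t, β t)) := by
  have mass : ∑ l, ∑ t, β t * θ t l = ∑ t, β t := by
    rw [sum_comm]
    simp only [← mul_sum, (hθ _).2, mul_one]
  have hentropy := sum_le_sum fun l (_ : l ∈ univ) =>
    mul_log_sum_le (x := fun t => θ t l) hβ fun t => (hθ t).1 l
  rw [sum_add_distrib, ← sum_mul, mass, sum_comm] at hentropy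
  have hcost : ∑ l, C l j * ∑ t, β t * θ t l = ∑ t, β t * ∑ l, C l j * θ t l := by
    simp only [mul_sum, mul_left_comm]
    exact sum_comm
  have hsplit : ∑ t, β t * columnCost μ C j (θ t) = ∑ t, β t * ∑ l, C l j * θ t l +
      μ * ∑ t, ∑ l, β t * (θ t l * Real.log (θ t l)) := by
    simp only [columnCost, mul_add, sum_add_distrib, mul_left_comm _ μ, ← mul_sum]
  rw [columnCost, hcost, hsplit]
  linarith [mul_le_mul_of_nonneg_left hentropy hμ.le]

lemma regW_le_sum_columnCost {T : Type*} [Fintype T] (hμ : 0 < μ)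
    (hq : q ∈ stdSimplex ℝ (Fin n)) {β θ : T → Fin n → ℝ} (hβ : ∀ t j, 0 ≤ β t j)
    (hβq : ∀ j, ∑ t, β t j = q j) (hθ : ∀ t, θ t ∈ stdSimplex ℝ (Fin n)) :
    regW μ C q (fun l => ∑ t, (∑ j, β t j) * θ t l) ≤
      ∑ t, ∑ j, β t j * columnCost μ C j (θ t) + μ * ∑ j, q j * Real.log (q j) := by
  let π : Matrix (Fin n) (Fin n) ℝ := fun l j => ∑ t, β t j * θ t l
  have plan_mem : π ∈ transportPlans (fun l => ∑ t, (∑ j, β t j) * θ t l) q := by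
    refine ⟨fun l j => sum_nonneg fun t _ => mul_nonneg (hβ t j) ((hθ t).1 l), fun l => ?_,
      fun j => ?_⟩
    · simp only [π, sum_mul]
      exact sum_comm
    · simp only [π]
      rw [sum_comm]
      simp only [← mul_sum, (hθ _).2, mul_one, hβq]
  have mixture_mem : (fun l => ∑ t, (∑ j, β t j) * θ t l) ∈ stdSimplex ℝ (Fin n) := by
    refine ⟨fun l => sum_nonneg fun t _ =>
      mul_nonneg (sum_nonneg fun j _ => hβ t j) ((hθ t).1 l), ?_⟩
    rw [← sum_congr rfl fun l _ => plan_mem.2.1 l, sum_comm,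
      sum_congr rfl fun j _ => plan_mem.2.2 j, hq.2]
  calc regW μ C q (fun l => ∑ t, (∑ j, β t j) * θ t l)
      ≤ ∑ j, columnCost μ C j fun l => ∑ t, β t j * θ t l :=
        (regW_le_transportCost mixture_mem hq plan_mem).trans_eq
          (transportCost_eq_sum_columnCost π)
    _ ≤ ∑ j, (∑ t, β t j * columnCost μ C j (θ t) + μ * (q j * Real.log (q j))) :=
        sum_le_sum fun j _ => by
          simpa only [hβq] using columnCost_sum_le hμ (fun t => hβ t j) hθ j
    _ = _ := by rw [sum_add_distrib, sum_comm, mul_sum]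

lemma exists_mem_transportPlans_min_le_diag (hp : p ∈ stdSimplex ℝ (Fin n))
    (hq : q ∈ stdSimplex ℝ (Fin n)) :
    ∃ π ∈ transportPlans p q, ∀ a, min (p a) (q a) ≤ π a a := by
  set ρ : Fin n → ℝ := fun a => min (p a) (q a)
  set τ := ∑ a, (p a - ρ a) with hτ
  have hp' (a : Fin n) : 0 ≤ p a - ρ a := sub_nonneg.2 (min_le_left _ _)
  have hq' (a : Fin n) : 0 ≤ q a - ρ a := sub_nonneg.2 (min_le_right _ _)
  have hτ0 : 0 ≤ τ := sum_nonneg fun a _ => hp' a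
  have hτq : τ = ∑ a, (q a - ρ a) := by rw [hτ, sum_sub_distrib, sum_sub_distrib, hp.2, hq.2]
  have excess_mul_div {f : Fin n → ℝ} (hf : ∀ a, 0 ≤ f a) (hfτ : τ = ∑ a, f a) (a : Fin n) :
      f a * (τ / τ) = f a := by
    rcases eq_or_ne τ 0 with h | h
    · simp [(sum_eq_zero_iff_of_nonneg fun a _ => hf a).1 (hfτ.symm.trans h) a (mem_univ a)]
    · rw [div_self h, mul_one]
  refine ⟨fun a j => (if a = j then ρ a else 0) + (p a - ρ a) * ((q j - ρ j) / τ),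
    ⟨fun a j => ?_, fun a => ?_, fun j => ?_⟩, fun a => ?_⟩
  · have : 0 ≤ ρ a := le_min (hp.1 a) (hq.1 a)
    have := mul_nonneg (hp' a) (div_nonneg (hq' j) hτ0)
    dsimp only
    split_ifs <;> linarith
  · rw [sum_add_distrib, ← mul_sum, ← sum_div, ← hτq, excess_mul_div hp' hτ]
    simp
  · rw [sum_add_distrib, ← sum_mul, ← hτ, mul_div_left_comm, excess_mul_div hq' hτq]
    simp
  · simpa [ρ] using mul_nonneg (hp' a) (div_nonneg (hq' a) hτ0)

lemma columnCost_le_add (hc : ∀ i j, |C i j| ≤ c) {θ : Fin n → ℝ}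
    (hθ : θ ∈ stdSimplex ℝ (Fin n)) (j j' : Fin n) :
    columnCost μ C j θ ≤ columnCost μ C j' θ + 2 * c := by
  have h : ∑ i, C i j * θ i ≤ ∑ i, (C i j' * θ i + 2 * c * θ i) := sum_le_sum fun i _ => by
    rw [← add_mul]
    refine mul_le_mul_of_nonneg_right ?_ (hθ.1 i)
    linarith [le_abs_self (C i j), neg_le_abs (C i j'), hc i j, hc i j']
  rw [sum_add_distrib, ← mul_sum, hθ.2, mul_one] at h
  simp only [columnCost]
  linarith

lemma sum_mul_le_of_le_add {ι : Type*} [Fintype ι] {κ f : ι → ℝ} {a : ι} {d : ℝ}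
    (hκ : ∀ j, 0 ≤ κ j) (hf : ∀ j, f j ≤ f a + d) :
    ∑ j, κ j * f j ≤ (∑ j, κ j) * f a + d * (∑ j, κ j - κ a) := by
  classical
  rw [← add_sum_erase _ _ (mem_univ a), ← add_sum_erase _ κ (mem_univ a), add_sub_cancel_left,
    add_mul, sum_mul, mul_sum, add_assoc, ← sum_add_distrib]
  refine add_le_add_right (sum_le_sum fun j _ => ?_) _
  linarith [mul_le_mul_of_nonneg_left (hf j) (hκ j)]

lemma sum_abs_sub_of_mem_stdSimplex (hp : p ∈ stdSimplex ℝ (Fin n))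
    (hq : q ∈ stdSimplex ℝ (Fin n)) :
    ∑ j, |p j - q j| = 2 * ∑ j, (p j - min (p j) (q j)) := by
  have h (j : Fin n) : |p j - q j| = p j + q j - 2 * min (p j) (q j) := by
    rw [← max_sub_min_eq_abs']
    linarith [max_add_min (p j) (q j)]
  simp only [h, sum_sub_distrib, sum_add_distrib, ← mul_sum, hp.2, hq.2]
  ring

lemma exists_relabelling {T : Type*} [Fintype T] (hq : q ∈ stdSimplex ℝ (Fin n)) {w : T → ℝ}
    (hw : w ∈ stdSimplex ℝ T) (J : T → Fin n) :
    ∃ β : T → Fin n → ℝ, (∀ t j, 0 ≤ β t j) ∧ (∀ t, ∑ j, β t j = w t) ∧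
      (∀ j, ∑ t, β t j = q j) ∧
      2 * ∑ t, (w t - β t (J t)) ≤ ∑ j, |∑ t, w t * (if J t = j then 1 else 0) - q j| := by
  set p : Fin n → ℝ := fun j => ∑ t, w t * (if J t = j then 1 else 0) with hp
  have sum_labels (f : Fin n → ℝ) : ∑ t, w t * f (J t) = ∑ a, p a * f a := by
    simp only [hp, sum_mul]
    rw [sum_comm]
    simp
  have weight_nonneg (j : Fin n) (t : T) : 0 ≤ w t * (if J t = j then 1 else 0) :=
    mul_nonneg (hw.1 t) (by split_ifs <;> norm_num)
  have hp_mem : p ∈ stdSimplex ℝ (Fin n) :=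
    ⟨fun j => sum_nonneg fun t _ => weight_nonneg j t,
      by simpa [hw.2] using (sum_labels fun _ => 1).symm⟩
  have le_freq (t : T) : w t ≤ p (J t) := by
    have h := single_le_sum (fun s _ => weight_nonneg (J t) s) (mem_univ t)
    rwa [if_pos rfl, mul_one] at h
  obtain ⟨κ, ⟨hκ, hκp, hκq⟩, hdiag⟩ := exists_mem_transportPlans_min_le_diag hp_mem hq
  have freq_mul_div (a j : Fin n) : p a * (κ a j / p a) = κ a j :=
    mul_div_cancel_of_imp' fun h =>
      (sum_eq_zero_iff_of_nonneg fun j _ => hκ a j).1 ((hκp a).trans h) j (mem_univ j)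
  refine ⟨fun t j => w t * (κ (J t) j / p (J t)),
    fun t j => mul_nonneg (hw.1 t) (div_nonneg (hκ _ _) (hp_mem.1 _)), fun t => ?_,
    fun j => ?_, ?_⟩
  · rw [← mul_sum, ← sum_div, hκp, ← mul_div_assoc]
    exact mul_div_cancel_of_imp fun h => (hw.1 t).antisymm' (h ▸ le_freq t)
  · rw [sum_labels fun a => κ a j / p a, sum_congr rfl fun a _ => freq_mul_div a j, hκq]
  · rw [sum_sub_distrib, sum_labels fun a => κ a a / p a,
      sum_congr rfl fun a _ => freq_mul_div a a, sum_abs_sub_of_mem_stdSimplex hp_mem hq, hw.2,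
      sum_sub_distrib, hp_mem.2]
    linarith [sum_le_sum fun a (_ : a ∈ univ) => hdiag a]

/-- Moving mass between labels costs at most `2 c` per unit, and the mass moved is half the `ℓ¹`
distance between the label frequencies and `q`. -/
lemma regW_le_sum_columnCost_add {T : Type*} [Fintype T] (hμ : 0 < μ)
    (hc : ∀ i j, |C i j| ≤ c) (hq : q ∈ stdSimplex ℝ (Fin n)) {w : T → ℝ} (J : T → Fin n)
    {θ : T → Fin n → ℝ} (hw : w ∈ stdSimplex ℝ T) (hθ : ∀ t, θ t ∈ stdSimplex ℝ (Fin n)) :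
    regW μ C q (fun l => ∑ t, w t * θ t l) ≤
      ∑ t, w t * columnCost μ C (J t) (θ t) +
        c * ∑ j, |∑ t, w t * (if J t = j then 1 else 0) - q j| +
        μ * ∑ j, q j * Real.log (q j) := by
  obtain ⟨β, hβ, hβw, hβq, moved_le⟩ := exists_relabelling hq hw J
  have atom_le (t : T) : ∑ j, β t j * columnCost μ C j (θ t) ≤
      w t * columnCost μ C (J t) (θ t) + 2 * c * (w t - β t (J t)) := by
    rw [← hβw t]
    exact sum_mul_le_of_le_add (hβ t) fun j => columnCost_le_add hc (hθ t) j (J t)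
  have hc_moved : c * (2 * ∑ t, (w t - β t (J t))) ≤
      c * ∑ j, |∑ t, w t * (if J t = j then 1 else 0) - q j| := by
    rcases isEmpty_or_nonempty (Fin n) with h | ⟨⟨j⟩⟩
    · simp [stdSimplex] at hq
    · exact mul_le_mul_of_nonneg_left moved_le ((abs_nonneg _).trans (hc j j))
  have mixture_le := regW_le_sum_columnCost (C := C) hμ hq hβ hβq hθ
  have h := sum_le_sum fun t (_ : t ∈ univ) => atom_le t
  rw [sum_add_distrib, ← mul_sum] at h
  simp only [hβw] at mixture_le
  linarith

end Transport

/-! ### Square roots of positive semidefinite matrices and of the network matrix -/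

section SqrtLin

open scoped MatrixOrder

variable {ι : Type*} [Fintype ι] [DecidableEq ι] {A : Matrix ι ι ℝ}

/-- `√A` as an operator on the Euclidean space; `BaryProblem.sqrtW` is the case `A = W`. -/
noncomputable def sqrtLin (A : Matrix ι ι ℝ) : EuclideanSpace ℝ ι →ₗ[ℝ] EuclideanSpace ℝ ι :=
  Matrix.toEuclideanLin (CFC.sqrt A)

lemma sqrtLin_sqrtLin (hA : A.PosSemidef) (x : EuclideanSpace ℝ ι) :
    sqrtLin A (sqrtLin A x) = Matrix.toEuclideanLin A x := by
  have sqrt_mul_sqrt : CFC.sqrt A * CFC.sqrt A = A := CFC.sqrt_mul_sqrt_self _ hA.nonneg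
  simp only [sqrtLin, Matrix.toLpLin_apply, Matrix.mulVec_mulVec, sqrt_mul_sqrt]

lemma inner_sqrtLin_left (A : Matrix ι ι ℝ) (x y : EuclideanSpace ℝ ι) :
    inner ℝ (sqrtLin A x) y = inner ℝ x (sqrtLin A y) :=
  Matrix.isSymmetric_toEuclideanLin_iff.2
    (Matrix.nonneg_iff_posSemidef.1 (CFC.sqrt_nonneg A)).isHermitian x y

lemma sqrtLin_eq_zero_iff (hA : A.PosSemidef) {x : EuclideanSpace ℝ ι} :
    sqrtLin A x = 0 ↔ Matrix.toEuclideanLin A x = 0 := by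
  refine ⟨fun h => by rw [← sqrtLin_sqrtLin hA, h, map_zero], fun h => ?_⟩
  rw [← inner_self_eq_zero (𝕜 := ℝ), inner_sqrtLin_left, sqrtLin_sqrtLin hA, h, inner_zero_right]

lemma toEuclideanLin_eigenvectorBasis (hA : A.IsHermitian) (k : ι) :
    Matrix.toEuclideanLin A (hA.eigenvectorBasis k) =
      hA.eigenvalues k • hA.eigenvectorBasis k := by
  ext i
  exact congrFun (hA.mulVec_eigenvectorBasis k) i

lemma inner_eigenvectorBasis_toEuclideanLin (hA : A.IsHermitian) (k : ι)
    (x : EuclideanSpace ℝ ι) :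
    inner ℝ (hA.eigenvectorBasis k) (Matrix.toEuclideanLin A x) =
      hA.eigenvalues k * inner ℝ (hA.eigenvectorBasis k) x := by
  rw [← Matrix.isSymmetric_toEuclideanLin_iff.2 hA, toEuclideanLin_eigenvectorBasis,
    real_inner_smul_left]

lemma norm_sqrtLin_sq_eq_sum (hA : A.PosSemidef) (x : EuclideanSpace ℝ ι) :
    ‖sqrtLin A x‖ ^ 2 = ∑ k, hA.isHermitian.eigenvalues k *
      inner ℝ (hA.isHermitian.eigenvectorBasis k) x ^ 2 := by
  rw [← real_inner_self_eq_norm_sq, inner_sqrtLin_left, sqrtLin_sqrtLin hA,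
    ← hA.isHermitian.eigenvectorBasis.sum_inner_mul_inner]
  refine sum_congr rfl fun k _ => ?_
  rw [inner_eigenvectorBasis_toEuclideanLin, real_inner_comm]
  ring

lemma eigenvalues_le_sSup_spectrum (hA : A.IsHermitian) (k : ι) :
    hA.eigenvalues k ≤ sSup (spectrum ℝ A) := by
  rw [hA.spectrum_real_eq_range_eigenvalues]
  exact le_csSup (Set.finite_range _).bddAbove ⟨k, rfl⟩

lemma sInf_spectrum_le_eigenvalues (hA : A.IsHermitian) {k : ι} (hk : 0 < hA.eigenvalues k) :
    sInf (spectrum ℝ A ∩ Set.Ioi 0) ≤ hA.eigenvalues k := by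
  rw [hA.spectrum_real_eq_range_eigenvalues]
  exact csInf_le ((Set.finite_range _).inter_of_left _).bddBelow ⟨⟨k, rfl⟩, hk⟩

lemma exists_eigenvalues_pos (hA : A.PosSemidef) (h0 : A ≠ 0) :
    ∃ k, 0 < hA.isHermitian.eigenvalues k := by
  by_contra! h
  exact h0 (hA.isHermitian.eigenvalues_eq_zero_iff.1 <|
    funext fun k => (h k).antisymm (hA.eigenvalues_nonneg k))

lemma sInf_spectrum_pos (hA : A.PosSemidef) (h0 : A ≠ 0) :
    0 < sInf (spectrum ℝ A ∩ Set.Ioi 0) := by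
  obtain ⟨k, hk⟩ := exists_eigenvalues_pos hA h0
  have hne : (Set.range hA.isHermitian.eigenvalues ∩ Set.Ioi 0).Nonempty := ⟨_, ⟨k, rfl⟩, hk⟩
  rw [hA.isHermitian.spectrum_real_eq_range_eigenvalues]
  exact (hne.csInf_mem ((Set.finite_range _).inter_of_left _)).2

lemma sInf_spectrum_le_sSup_spectrum (hA : A.PosSemidef) (h0 : A ≠ 0) :
    sInf (spectrum ℝ A ∩ Set.Ioi 0) ≤ sSup (spectrum ℝ A) := by
  obtain ⟨k, hk⟩ := exists_eigenvalues_pos hA h0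
  exact (sInf_spectrum_le_eigenvalues _ hk).trans (eigenvalues_le_sSup_spectrum _ k)

lemma norm_sqrtLin_sq_le (hA : A.PosSemidef) (x : EuclideanSpace ℝ ι) :
    ‖sqrtLin A x‖ ^ 2 ≤ sSup (spectrum ℝ A) * ‖x‖ ^ 2 := by
  rw [norm_sqrtLin_sq_eq_sum hA, ← hA.isHermitian.eigenvectorBasis.sum_sq_inner_right, mul_sum]
  gcongr with k
  exact eigenvalues_le_sSup_spectrum _ k

lemma exists_sqrtLin_eq (hA : A.PosSemidef) {u : EuclideanSpace ℝ ι}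
    (hu : ∀ x, Matrix.toEuclideanLin A x = 0 → inner ℝ x u = 0) :
    ∃ y, sqrtLin A y = u ∧ sInf (spectrum ℝ A ∩ Set.Ioi 0) * ‖y‖ ^ 2 ≤ ‖u‖ ^ 2 := by
  set b := hA.isHermitian.eigenvectorBasis
  set ev := hA.isHermitian.eigenvalues with hev
  have inner_eq_zero (k : ι) (hk : ev k = 0) : inner ℝ (b k) u = 0 :=
    hu _ (by rw [toEuclideanLin_eigenvectorBasis, ← hev, hk, zero_smul])
  set v : EuclideanSpace ℝ ι := ∑ k, (inner ℝ (b k) u / ev k) • b k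
  have inner_v (k : ι) : inner ℝ (b k) v = inner ℝ (b k) u / ev k :=
    b.orthonormal.inner_right_fintype _ k
  have A_v : Matrix.toEuclideanLin A v = u := by
    refine InnerProductSpace.ext_inner_left_basis b.toBasis fun k => ?_
    rw [b.coe_toBasis, inner_eigenvectorBasis_toEuclideanLin, inner_v]
    exact mul_div_cancel_of_imp' (inner_eq_zero k)
  refine ⟨sqrtLin A v, (sqrtLin_sqrtLin hA v).trans A_v, ?_⟩
  rw [norm_sqrtLin_sq_eq_sum hA, ← b.sum_sq_inner_right u, mul_sum]
  refine sum_le_sum fun k _ => ?_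
  rw [inner_v, ← hev]
  rcases (hA.eigenvalues_nonneg k).eq_or_lt with hk | hk
  · simpa [hev, ← hk] using sq_nonneg _
  · have hk_ne : ev k ≠ 0 := hk.ne'
    calc sInf (spectrum ℝ A ∩ Set.Ioi 0) * (ev k * (inner ℝ (b k) u / ev k) ^ 2)
        ≤ ev k * (ev k * (inner ℝ (b k) u / ev k) ^ 2) :=
          mul_le_mul_of_nonneg_right (sInf_spectrum_le_eigenvalues _ hk) (by positivity)
      _ = inner ℝ (b k) u ^ 2 := by field_simp

end SqrtLin

variable {m n : ℕ}

/-- Orthogonality to the consensus vectors, whose blocks are all equal. -/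
def IsCentered (u : Stacked m n) : Prop := ∀ l, ∑ i, u (i, l) = 0

namespace BaryProblem

variable (P : BaryProblem m n)

lemma posSemidef_W : P.W.PosSemidef := by
  classical
  have posSemidef_lap : P.lap.PosSemidef := by
    unfold lap
    convert SimpleGraph.posSemidef_lapMatrix ℝ P.G
  exact posSemidef_lap.kronecker Matrix.PosSemidef.one

lemma W_mulVec_apply (x : Stacked m n) (i : Fin m) (l : Fin n) :
    Matrix.toEuclideanLin P.W x (i, l) = P.lap.mulVec (fun j => x (j, l)) i := by
  simp [Matrix.mulVec, dotProduct, W, Matrix.kroneckerMap_apply, Fintype.sum_prod_type,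
    Matrix.one_apply, Matrix.toLpLin_apply]

lemma lap_mulVec_const (c : ℝ) : P.lap.mulVec (fun _ => c) = 0 := by
  classical
  have h : P.lap.mulVec (fun _ => (1 : ℝ)) = 0 := by
    unfold lap
    convert SimpleGraph.lapMatrix_mulVec_const_eq_zero (G := P.G) (R := ℝ)
  have hconst : (fun _ : Fin m => c) = c • fun _ => (1 : ℝ) := by ext; simp
  rw [hconst, Matrix.mulVec_smul, h, smul_zero]

lemma apply_eq_of_W_eq_zero (hG : P.G.Connected) {x : Stacked m n}
    (hx : Matrix.toEuclideanLin P.W x = 0) (i j : Fin m) (l : Fin n) : x (i, l) = x (j, l) := by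
  classical
  have hlap : (P.G.lapMatrix ℝ).mulVec (fun i => x (i, l)) = 0 := by
    funext i
    have h : P.lap.mulVec (fun i => x (i, l)) i = 0 := by rw [← W_mulVec_apply, hx]; rfl
    unfold lap at h
    rw [Pi.zero_apply, ← h]
  exact (SimpleGraph.lapMatrix_mulVec_eq_zero_iff_forall_reachable P.G).1 hlap i j (hG i j)

lemma inner_eq_zero_of_W_eq_zero (hG : P.G.Connected) {x u : Stacked m n}
    (hx : Matrix.toEuclideanLin P.W x = 0) (hu : IsCentered u) : inner ℝ x u = 0 := by
  obtain ⟨i₀⟩ := hG.nonempty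
  rw [PiLp.inner_apply, Fintype.sum_prod_type, sum_comm]
  refine sum_eq_zero fun l _ => ?_
  simp only [RCLike.inner_apply, conj_trivial, P.apply_eq_of_W_eq_zero hG hx _ i₀ l]
  rw [← sum_mul, hu, zero_mul]

lemma W_ne_zero (hm : 2 ≤ m) (hG : P.G.Connected) (l : Fin n) : P.W ≠ 0 := by
  intro hW
  have h := P.apply_eq_of_W_eq_zero hG (x := EuclideanSpace.single (⟨0, by omega⟩, l) 1)
    (by rw [hW, map_zero, LinearMap.zero_apply]) ⟨0, by omega⟩ ⟨1, by omega⟩ l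
  simp at h

lemma lamMinPos_pos (hm : 2 ≤ m) (hG : P.G.Connected) (l : Fin n) : 0 < P.lamMinPos :=
  sInf_spectrum_pos P.posSemidef_W (P.W_ne_zero hm hG l)

lemma lamMinPos_le_lamMax (hm : 2 ≤ m) (hG : P.G.Connected) (l : Fin n) :
    P.lamMinPos ≤ P.lamMax :=
  sInf_spectrum_le_sSup_spectrum P.posSemidef_W (P.W_ne_zero hm hG l)

lemma inner_sqrtW_left (x y : Stacked m n) : inner ℝ (P.sqrtW x) y = inner ℝ x (P.sqrtW y) :=
  inner_sqrtLin_left P.W x y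

lemma norm_sqrtW_sq_le (x : Stacked m n) : ‖P.sqrtW x‖ ^ 2 ≤ P.lamMax * ‖x‖ ^ 2 :=
  norm_sqrtLin_sq_le P.posSemidef_W x

lemma isCentered_sqrtW (y : Stacked m n) : IsCentered (P.sqrtW y) := by
  intro l
  set c : Stacked m n := WithLp.toLp 2 fun il => if il.2 = l then 1 else 0 with hc
  have sqrtW_c : P.sqrtW c = 0 := (sqrtLin_eq_zero_iff P.posSemidef_W).2 <| by
    ext ⟨i, l'⟩
    rw [W_mulVec_apply]
    exact congrFun (P.lap_mulVec_const (if l' = l then 1 else 0)) i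
  have inner_c : inner ℝ c (P.sqrtW y) = ∑ i, P.sqrtW y (i, l) := by
    simp [PiLp.inner_apply, hc, Fintype.sum_prod_type]
  rw [← inner_c, ← inner_sqrtW_left, sqrtW_c, inner_zero_left]

lemma exists_sqrtW_eq (hG : P.G.Connected) {u : Stacked m n} (hu : IsCentered u) :
    ∃ y, P.sqrtW y = u ∧ P.lamMinPos * ‖y‖ ^ 2 ≤ ‖u‖ ^ 2 :=
  exists_sqrtLin_eq P.posSemidef_W fun _ hx => P.inner_eq_zero_of_W_eq_zero hG hx hu

end BaryProblem

/-! ### Gradients of the conjugates and Sinkhorn scalings -/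

section GradConjW

variable {n : ℕ} {μ c : ℝ} {C : Matrix (Fin n) (Fin n) ℝ} {q : Fin n → ℝ}

/-- The gradient of `conjW μ C q` at `u`: the mean of the stochastic gradients. -/
noncomputable def gradConjW (μ : ℝ) (C : Matrix (Fin n) (Fin n) ℝ) (q u : Fin n → ℝ) :
    Fin n → ℝ :=
  fun l => ∑ j, q j * compGrad μ C u j l

lemma sum_gradConjW_mul (u d : Fin n → ℝ) :
    ∑ l, gradConjW μ C q u l * d l = ∑ j, q j * ∑ l, compGrad μ C u j l * d l := by
  simp only [gradConjW, sum_mul, mul_sum, mul_assoc]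
  exact sum_comm

lemma gradConjW_mem_stdSimplex (hq : q ∈ stdSimplex ℝ (Fin n)) (u : Fin n → ℝ) :
    gradConjW μ C q u ∈ stdSimplex ℝ (Fin n) := by
  refine ⟨fun l => sum_nonneg fun j _ =>
    mul_nonneg (hq.1 j) ((compGrad_mem_stdSimplex u j).1 l), ?_⟩
  have h := sum_gradConjW_mul (μ := μ) (C := C) (q := q) u 1
  simpa only [Pi.one_apply, mul_one, (compGrad_mem_stdSimplex u _).2, hq.2] using h

lemma gradConjW_pos (hq : q ∈ stdSimplex ℝ (Fin n)) (u : Fin n → ℝ) (l : Fin n) :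
    0 < gradConjW μ C q u l := by
  have : Nonempty (Fin n) := ⟨l⟩
  have hpos (j : Fin n) : 0 < compGrad μ C u j l := softmax_pos (columnPotential C u j) l
  obtain ⟨j, -, hj⟩ := exists_ne_zero_of_sum_ne_zero (hq.2 ▸ one_ne_zero : ∑ j, q j ≠ 0)
  exact sum_pos' (fun j _ => mul_nonneg (hq.1 j) (hpos j).le)
    ⟨j, mem_univ j, mul_pos ((hq.1 j).lt_of_ne' hj) (hpos j)⟩

lemma logSumExp_columnPotential_ge (hμ : 0 < μ) (u v : Fin n → ℝ) (j : Fin n) :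
    logSumExp μ (columnPotential C u j) + ∑ l, compGrad μ C u j l * (v l - u l) ≤
      logSumExp μ (columnPotential C v j) := by
  have : Nonempty (Fin n) := ⟨j⟩
  have h := logSumExp_ge hμ (columnPotential C u j) (columnPotential C v j)
  simpa only [compGrad_eq_softmax, columnPotential, add_sub_add_left_eq_sub] using h

lemma logSumExp_columnPotential_le (hμ : 0 < μ) (u v : Fin n → ℝ) (j : Fin n) :
    logSumExp μ (columnPotential C v j) ≤ logSumExp μ (columnPotential C u j) +
      ∑ l, compGrad μ C u j l * (v l - u l) + (∑ l, (v l - u l) ^ 2) / (2 * μ) := by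
  have : Nonempty (Fin n) := ⟨j⟩
  have h := logSumExp_le hμ (columnPotential C u j) (columnPotential C v j)
  simpa only [compGrad_eq_softmax, columnPotential, add_sub_add_left_eq_sub] using h

/-- Jensen's inequality moves the average over columns inside the logarithm. -/
lemma sum_mul_logSumExp_columnPotential_le (hμ : 0 < μ) (hq : q ∈ stdSimplex ℝ (Fin n))
    (u v : Fin n → ℝ) :
    ∑ j, q j * logSumExp μ (columnPotential C v j) ≤
      ∑ j, q j * logSumExp μ (columnPotential C u j) +
        logSumExp μ (fun l => v l - u l + μ * Real.log (gradConjW μ C q u l)) := by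
  set ρ : Fin n → ℝ := fun j => ∑ l, compGrad μ C u j l * Real.exp ((v l - u l) / μ)
  have ρ_pos (j : Fin n) : 0 < ρ j :=
    have : Nonempty (Fin n) := ⟨j⟩
    sum_pos (fun l _ => mul_pos (softmax_pos (columnPotential C u j) l) (Real.exp_pos _))
      univ_nonempty
  have logSumExp_v (j : Fin n) : logSumExp μ (columnPotential C v j) =
      logSumExp μ (columnPotential C u j) + μ * Real.log (ρ j) := by
    have : Nonempty (Fin n) := ⟨j⟩
    rw [logSumExp_eq_add (columnPotential C u j)]
    simp only [columnPotential, add_sub_add_left_eq_sub, ρ, compGrad_eq_softmax]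
  have sum_ρ : ∑ l, Real.exp ((v l - u l + μ * Real.log (gradConjW μ C q u l)) / μ) =
      ∑ j, q j * ρ j := by
    rw [← sum_gradConjW_mul]
    refine sum_congr rfl fun l _ => ?_
    rw [add_div, mul_div_cancel_left₀ _ hμ.ne', Real.exp_add,
      Real.exp_log (gradConjW_pos hq u l), mul_comm]
  have jensen : ∑ j, q j * Real.log (ρ j) ≤ Real.log (∑ j, q j * ρ j) :=
    strictConcaveOn_log_Ioi.concaveOn.le_map_sum (t := univ) (w := q) (p := ρ)
      (fun j _ => hq.1 j) hq.2 fun j _ => ρ_pos j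
  have h := mul_le_mul_of_nonneg_left jensen hμ.le
  simp only [logSumExp_v, mul_add, sum_add_distrib, mul_left_comm _ μ, ← mul_sum]
  rw [logSumExp.eq_1 μ fun l => _, sum_ρ]
  gcongr

lemma gradConjW_eq (u : Fin n → ℝ) (l : Fin n) :
    gradConjW μ C q u l = Real.exp (u l / μ) * ∑ j,
      q j / (∑ i, Real.exp (columnPotential C u j i / μ)) * Real.exp (-C l j / μ) := by
  rw [gradConjW, mul_sum]
  refine sum_congr rfl fun j _ => ?_
  rw [compGrad_eq_softmax, softmax, columnPotential, add_div, Real.exp_add]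
  ring

lemma abs_log_sum_sub_log_sum_mul_exp_le {ι : Type*} [Fintype ι] {κ x : ι → ℝ} {b : ℝ}
    (hκ : ∀ i, 0 ≤ κ i) (hκ_sum : 0 < ∑ i, κ i) (hx : ∀ i, |x i| ≤ b) :
    |Real.log (∑ i, κ i) - Real.log (∑ i, κ i * Real.exp (x i))| ≤ b := by
  have lower : Real.exp (-b) * ∑ i, κ i ≤ ∑ i, κ i * Real.exp (x i) := by
    rw [mul_sum]
    refine sum_le_sum fun i _ => ?_
    rw [mul_comm]
    exact mul_le_mul_of_nonneg_left (Real.exp_le_exp.2 (abs_le.1 (hx i)).1) (hκ i)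
  have upper : ∑ i, κ i * Real.exp (x i) ≤ Real.exp b * ∑ i, κ i := by
    rw [mul_sum]
    refine sum_le_sum fun i _ => ?_
    rw [mul_comm]
    exact mul_le_mul_of_nonneg_right (Real.exp_le_exp.2 (abs_le.1 (hx i)).2) (hκ i)
  have hpos : 0 < Real.exp (-b) * ∑ i, κ i := by positivity
  have log_lower := Real.log_le_log hpos lower
  have log_upper := Real.log_le_log (hpos.trans_le lower) upper
  rw [Real.log_mul (Real.exp_pos _).ne' hκ_sum.ne', Real.log_exp] at log_lower log_upper
  exact abs_le.2 ⟨by linarith, by linarith⟩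

/-- A Sinkhorn scaling `x / ∇` is, up to a constant factor, an average of the columns of
`exp (-C / μ)`. -/
lemma exists_abs_add_sub_mul_log_gradConjW_le (hμ : 0 < μ) (hc : ∀ i j, |C i j| ≤ c)
    (hq : q ∈ stdSimplex ℝ (Fin n)) (u : Fin n → ℝ) :
    ∃ b, ∀ l, |b + u l - μ * Real.log (gradConjW μ C q u l)| ≤ c := by
  set κ : Fin n → ℝ := fun j => q j / ∑ i, Real.exp (columnPotential C u j i / μ)
  have κ_nonneg (j : Fin n) : 0 ≤ κ j := div_nonneg (hq.1 j) (by positivity)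
  refine ⟨μ * Real.log (∑ j, κ j), fun l => ?_⟩
  have : Nonempty (Fin n) := ⟨l⟩
  have sum_κ_pos : 0 < ∑ j, κ j := by
    obtain ⟨j, -, hj⟩ := exists_ne_zero_of_sum_ne_zero (hq.2 ▸ one_ne_zero : ∑ j, q j ≠ 0)
    exact sum_pos' (fun j _ => κ_nonneg j)
      ⟨j, mem_univ j, div_pos ((hq.1 j).lt_of_ne' hj) (sum_exp_pos _)⟩
  have kernel_ne_zero : ∑ j, κ j * Real.exp (-C l j / μ) ≠ 0 :=
    right_ne_zero_of_mul (gradConjW_eq (q := q) u l ▸ (gradConjW_pos hq u l).ne')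
  have h := abs_log_sum_sub_log_sum_mul_exp_le (x := fun j => -C l j / μ) (b := c / μ) κ_nonneg
    sum_κ_pos fun j => by
      rw [abs_div, abs_neg, abs_of_pos hμ]
      exact div_le_div_of_nonneg_right (hc l j) hμ.le
  rw [gradConjW_eq, Real.log_mul (Real.exp_pos _).ne' kernel_ne_zero, Real.log_exp, mul_add,
    mul_div_cancel₀ _ hμ.ne', add_comm (u l), add_sub_add_right_eq_sub, ← mul_sub, abs_mul,
    abs_of_pos hμ, ← le_div_iff₀' hμ]
  exact h

end GradConjW

/-! ### The dual problem -/

lemma nonempty_of_mem_stdSimplex {ι : Type*} [Fintype ι] {q : ι → ℝ}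
    (hq : q ∈ stdSimplex ℝ ι) : Nonempty ι :=
  not_isEmpty_iff.1 fun _ => by simp [stdSimplex] at hq

section Stacked

variable {m n : ℕ}

lemma inner_stacked (x y : Stacked m n) :
    inner ℝ x y = ∑ i, ∑ l, block x i l * block y i l := by
  simp only [PiLp.inner_apply, Fintype.sum_prod_type, block, RCLike.inner_apply, conj_trivial,
    mul_comm]

lemma norm_sq_stacked (x : Stacked m n) : ‖x‖ ^ 2 = ∑ i, ∑ l, block x i l ^ 2 := by
  rw [← real_inner_self_eq_norm_sq, inner_stacked]
  simp only [sq]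

lemma IsCentered.inner_consensus {u x : Stacked m n} (hu : IsCentered u) {p : Fin n → ℝ}
    (hx : ∀ i, block x i = p) : inner ℝ u x = 0 := by
  rw [inner_stacked, sum_comm]
  refine sum_eq_zero fun l _ => ?_
  simp only [hx, ← sum_mul]
  exact mul_eq_zero_of_left (hu l) _

/-- The orthogonal projection onto the centered vectors. -/
noncomputable def center (x : Stacked m n) : Stacked m n :=
  WithLp.toLp 2 fun il => x il - (∑ i, x (i, il.2)) / m

lemma isCentered_center (hm : m ≠ 0) (x : Stacked m n) : IsCentered (center x) := by
  intro l
  simp only [center, sum_sub_distrib, sum_const, card_univ, Fintype.card_fin, nsmul_eq_mul]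
  rw [mul_div_cancel₀ _ (Nat.cast_ne_zero.2 hm), sub_self]

lemma inner_center (hm : m ≠ 0) (x : Stacked m n) : inner ℝ x (center x) = ‖center x‖ ^ 2 := by
  have hconsensus : inner ℝ (center x) (x - center x) = 0 :=
    (isCentered_center hm x).inner_consensus (p := fun l => (∑ i, x (i, l)) / m) fun i => by
      ext l
      simp [block, center]
  rw [inner_sub_right, real_inner_self_eq_norm_sq, real_inner_comm] at hconsensus
  linarith

lemma norm_center_le (hm : m ≠ 0) (x : Stacked m n) : ‖center x‖ ≤ ‖x‖ := by
  rcases (norm_nonneg (center x)).eq_or_lt with h | h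
  · exact h ▸ norm_nonneg x
  · have := inner_center hm x ▸ real_inner_le_norm x (center x)
    nlinarith

lemma block_eq_of_center_eq_zero {x : Stacked m n} (hx : center x = 0) (i j : Fin m) :
    block x i = block x j := by
  ext l
  have hmean (i : Fin m) : x (i, l) = (∑ i, x (i, l)) / m :=
    sub_eq_zero.1 (congrFun (congrArg WithLp.ofLp hx) (i, l))
  exact (hmean i).trans (hmean j).symm

lemma norm_sq_stacked_le {x : Stacked m n} {c : ℝ} (hx : ∀ i l, |block x i l| ≤ c) :
    ‖x‖ ^ 2 ≤ n * m * c ^ 2 := by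
  have h := sum_le_sum fun i (_ : i ∈ univ (α := Fin m)) =>
    sum_le_sum fun l (_ : l ∈ univ (α := Fin n)) =>
      sq_le_sq' (abs_le.1 (hx i l)).1 (abs_le.1 (hx i l)).2
  simp only [sum_const, card_univ, Fintype.card_fin, nsmul_eq_mul] at h
  rw [norm_sq_stacked]
  linarith

end Stacked

namespace BaryProblem

variable {m n : ℕ} (P : BaryProblem m n)

/-- `ψ` as a function of `u = √W y`, up to the constant `entropyQ`. -/
noncomputable def Psi (u : Stacked m n) : ℝ :=
  ∑ i, ∑ j, P.q i j * logSumExp P.mu (columnPotential P.C (block u i) j)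

/-- The gradient of `Psi`, the mean of the stochastic gradients. -/
noncomputable def meanX (u : Stacked m n) : Stacked m n :=
  WithLp.toLp 2 fun il => gradConjW P.mu P.C (P.q il.1) (block u il.1) il.2

/-- The constant `μ ∑_i ⟨q_i, ln q_i⟩` separating `Psi` from `psi`. -/
noncomputable def entropyQ : ℝ := ∑ i, P.mu * ∑ j, P.q i j * Real.log (P.q i j)

lemma psi_eq (y : Stacked m n) : P.psi y = P.Psi (P.sqrtW y) - P.entropyQ := by
  simp only [psi, conjW_eq, Psi, entropyQ, sum_sub_distrib]

lemma abs_C_le (i j : Fin n) : |P.C i j| ≤ P.normC :=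
  le_ciSup (f := fun ij : Fin n × Fin n => |P.C ij.1 ij.2|) (Set.finite_range _).bddAbove (i, j)

lemma normC_nonneg : 0 ≤ P.normC := Real.iSup_nonneg fun _ => abs_nonneg _

lemma block_meanX (u : Stacked m n) (i : Fin m) :
    block (P.meanX u) i = gradConjW P.mu P.C (P.q i) (block u i) := rfl

lemma continuous_Psi : Continuous P.Psi := by
  refine continuous_finsetSum _ fun i _ => continuous_finsetSum _ fun j _ =>
    continuous_const.mul (continuous_const.mul (Continuous.log ?_ fun u => ?_))
  · unfold columnPotential block
    fun_prop
  · have : Nonempty (Fin n) := ⟨j⟩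
    exact (sum_exp_pos _).ne'

variable {P}

lemma inner_meanX (u d : Stacked m n) : inner ℝ (P.meanX u) d =
    ∑ i, ∑ j, P.q i j * ∑ l, compGrad P.mu P.C (block u i) j l * block d i l := by
  simp only [inner_stacked, block_meanX, sum_gradConjW_mul]

section

variable (hμ : 0 < P.mu) (hq : ∀ i, P.q i ∈ stdSimplex ℝ (Fin n))

include hq

lemma meanX_mem_stdSimplex (u : Stacked m n) (i : Fin m) :
    block (P.meanX u) i ∈ stdSimplex ℝ (Fin n) :=
  gradConjW_mem_stdSimplex (hq i) _

include hμ

lemma Psi_ge (u v : Stacked m n) : P.Psi u + inner ℝ (P.meanX u) (v - u) ≤ P.Psi v := by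
  simp only [inner_meanX, Psi, ← sum_add_distrib, ← mul_add]
  exact sum_le_sum fun i _ => sum_le_sum fun j _ =>
    mul_le_mul_of_nonneg_left (logSumExp_columnPotential_ge hμ _ _ j) ((hq i).1 j)

lemma Psi_le (u v : Stacked m n) :
    P.Psi v ≤ P.Psi u + inner ℝ (P.meanX u) (v - u) + ‖v - u‖ ^ 2 / (2 * P.mu) := by
  have average (i : Fin m) : (∑ l, block (v - u) i l ^ 2) / (2 * P.mu) =
      ∑ j, P.q i j * ((∑ l, block (v - u) i l ^ 2) / (2 * P.mu)) := by
    rw [← sum_mul, (hq i).2, one_mul]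
  rw [inner_meanX, norm_sq_stacked, sum_div, sum_congr rfl fun i _ => average i]
  simp only [Psi, ← sum_add_distrib, ← mul_add]
  exact sum_le_sum fun i _ => sum_le_sum fun j _ =>
    mul_le_mul_of_nonneg_left (logSumExp_columnPotential_le hμ _ _ j) ((hq i).1 j)

lemma Psi_le_add_sum_logSumExp (u v : Stacked m n) :
    P.Psi v ≤ P.Psi u + ∑ i, logSumExp P.mu fun l =>
      block v i l - block u i l + P.mu * Real.log (block (P.meanX u) i l) := by
  rw [Psi, Psi, ← sum_add_distrib]
  exact sum_le_sum fun i _ => sum_mul_logSumExp_columnPotential_le hμ (hq i) _ _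

/-- A Sinkhorn step: the majorant of `Psi` from Jensen's inequality is convex, and over the centered
vectors it is minimal at the centered scaling potentials, where all its softmaxes agree. -/
lemma exists_isCentered_norm_sq_le (hm : m ≠ 0) {u : Stacked m n} (hu : IsCentered u) :
    ∃ v, IsCentered v ∧ ‖v‖ ^ 2 ≤ n * m * P.normC ^ 2 ∧ P.Psi v ≤ P.Psi u := by
  choose b hb using fun i =>
    exists_abs_add_sub_mul_log_gradConjW_le hμ P.abs_C_le (hq i) (block u i)
  set h : Fin m → Fin n → ℝ := fun i l => P.mu * Real.log (block (P.meanX u) i l)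
  set s : Stacked m n := WithLp.toLp 2 fun il => b il.1 + u il - h il.1 il.2
  set v := center s
  have hv : IsCentered v := isCentered_center hm s
  refine ⟨v, hv, ?_, ?_⟩
  · calc ‖v‖ ^ 2 ≤ ‖s‖ ^ 2 := by gcongr; exact norm_center_le hm s
      _ ≤ n * m * P.normC ^ 2 := norm_sq_stacked_le hb
  have hn : Nonempty (Fin n) := nonempty_of_mem_stdSimplex (hq ⟨0, Nat.pos_of_ne_zero hm⟩)
  have h_eq_zero (i : Fin m) : logSumExp P.mu (h i) = 0 := by
    have h_exp (l : Fin n) : Real.exp (h i l / P.mu) = block (P.meanX u) i l := by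
      rw [mul_div_cancel_left₀ _ hμ.ne', block_meanX, Real.exp_log (gradConjW_pos (hq i) _ l)]
    simp only [logSumExp, h_exp, (meanX_mem_stdSimplex hq u i).2, Real.log_one, mul_zero]
  have softmax_eq (i : Fin m) : softmax P.mu (fun l => block v i l - block u i l + h i l) =
      softmax P.mu fun l => -((∑ i, s (i, l)) / m) := by
    refine Eq.trans (congrArg _ ?_) (softmax_const_add P.mu (b i) _)
    ext l
    simp only [v, block, center, s]
    ring
  have majorant_le := sum_logSumExp_le_of_softmax_eq (h := h) hμ softmax_eq fun l => by
    simp only [block, sum_add_distrib, sum_sub_distrib, hu l, hv l, sub_self, zero_add]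
  rw [sum_eq_zero fun i _ => h_eq_zero i] at majorant_le
  linarith [Psi_le_add_sum_logSumExp hμ hq u v]

lemma exists_isMinOn_Psi (hm : m ≠ 0) :
    ∃ u : Stacked m n, IsCentered u ∧ ‖u‖ ^ 2 ≤ n * m * P.normC ^ 2 ∧
      IsMinOn P.Psi {v | IsCentered v} u := by
  set K : Set (Stacked m n) :=
    {u | IsCentered u} ∩ Metric.closedBall 0 √(n * m * P.normC ^ 2)
  have mem_closedBall (u : Stacked m n) : u ∈ Metric.closedBall 0 √(n * m * P.normC ^ 2) ↔
      ‖u‖ ^ 2 ≤ n * m * P.normC ^ 2 := by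
    rw [mem_closedBall_zero_iff, Real.le_sqrt (norm_nonneg u) (by positivity)]
  have isClosed_isCentered : IsClosed {u : Stacked m n | IsCentered u} := by
    simp only [IsCentered, Set.ofPred_forall]
    exact isClosed_iInter fun l => isClosed_eq (by fun_prop) continuous_const
  have K_nonempty : K.Nonempty := ⟨0, fun l => by simp, Metric.mem_closedBall_self (by positivity)⟩
  obtain ⟨u, hu, hmin⟩ := ((isCompact_closedBall _ _).inter_left isClosed_isCentered).exists_isMinOn
    K_nonempty P.continuous_Psi.continuousOn
  refine ⟨u, hu.1, (mem_closedBall u).1 hu.2, fun w hw => ?_⟩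
  obtain ⟨v, hv, v_norm, hvw⟩ := exists_isCentered_norm_sq_le hμ hq hm hw
  exact (hmin ⟨hv, (mem_closedBall v).2 v_norm⟩).trans hvw

lemma block_meanX_eq_of_isMinOn (hm : m ≠ 0) {u : Stacked m n} (hu : IsCentered u)
    (hmin : IsMinOn P.Psi {v | IsCentered v} u) (i j : Fin m) :
    block (P.meanX u) i = block (P.meanX u) j := by
  refine block_eq_of_center_eq_zero ?_ i j
  set e := center (P.meanX u)
  have he : IsCentered e := isCentered_center hm _
  have no_descent : P.Psi u ≤ P.Psi (u - P.mu • e) := hmin fun l => by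
    simp only [PiLp.sub_apply, PiLp.smul_apply, smul_eq_mul, sum_sub_distrib, ← mul_sum, hu l,
      he l, mul_zero, sub_zero]
  have descent := Psi_le hμ hq u (u - P.mu • e)
  rw [sub_sub_cancel_left, norm_neg, norm_smul, inner_neg_right, real_inner_smul_right,
    inner_center hm, mul_pow, Real.norm_eq_abs, sq_abs] at descent
  have quadratic : P.mu ^ 2 * ‖e‖ ^ 2 / (2 * P.mu) = P.mu * ‖e‖ ^ 2 / 2 := by field_simp
  have : P.mu * ‖e‖ ^ 2 ≤ 0 := by linarith
  simpa using nonpos_of_mul_nonpos_right this hμ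

lemma regW_meanX_le (u : Stacked m n) (i : Fin m) :
    regW P.mu P.C (P.q i) (block (P.meanX u) i) ≤
      ∑ l, block u i l * block (P.meanX u) i l - conjW P.mu P.C (P.q i) (block u i) := by
  have h := regW_le_sum_columnCost_add hμ P.abs_C_le (hq i) id (hq i)
    fun j => compGrad_mem_stdSimplex (μ := P.mu) (C := P.C) (block u i) j
  have deviation (j : Fin n) : ∑ t, P.q i t * (if t = j then 1 else 0) - P.q i j = 0 := by simp
  simp only [id, deviation, abs_zero, sum_const_zero, mul_zero, add_zero,
    columnCost_compGrad hμ, mul_sub, sum_sub_distrib] at h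
  have swap := sum_gradConjW_mul (μ := P.mu) (C := P.C) (q := P.q i) (block u i) (block u i)
  simp only [mul_comm _ (block u i _)] at swap
  rw [conjW_eq, block_meanX, swap]
  exact h.trans_eq (by ring)

lemma inner_sub_psi_le (y : Stacked m n) {p : Stacked m n}
    (hp : ∀ i, block p i ∈ stdSimplex ℝ (Fin n)) :
    inner ℝ (P.sqrtW y) p - P.psi y ≤ ∑ i, regW P.mu P.C (P.q i) (block p i) := by
  rw [inner_stacked, psi, ← sum_sub_distrib]
  exact sum_le_sum fun i _ => sub_conjW_le_regW hμ (hp i) (hq i) _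

/-- Weak duality, evaluated at a consensus vector. -/
lemma neg_psi_le_objective (y : Stacked m n) {p : Fin n → ℝ} (hp : p ∈ stdSimplex ℝ (Fin n)) :
    -P.psi y ≤ P.objective p := by
  have h := inner_sub_psi_le hμ hq y (p := WithLp.toLp 2 fun il => p il.2) fun _ => hp
  rwa [(P.isCentered_sqrtW y).inner_consensus (p := p) fun _ => rfl, zero_sub] at h

omit hμ hq in
lemma isDualSolution_of_isMinOn {y : Stacked m n}
    (hmin : IsMinOn P.Psi {v | IsCentered v} (P.sqrtW y)) : P.IsDualSolution y := by
  intro z _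
  simp only [Set.mem_ofPred_eq, psi_eq]
  exact sub_le_sub_right (hmin (P.isCentered_sqrtW z)) _

lemma objective_meanX_le (hm : m ≠ 0) {y : Stacked m n}
    (hmin : IsMinOn P.Psi {v | IsCentered v} (P.sqrtW y)) (i : Fin m) :
    P.objective (block (P.meanX (P.sqrtW y)) i) ≤ -P.psi y := by
  have hcent := P.isCentered_sqrtW y
  have agree (k : Fin m) := block_meanX_eq_of_isMinOn hμ hq hm hcent hmin k i
  have orthogonal := hcent.inner_consensus agree
  have h := sum_le_sum fun k (_ : k ∈ univ) => regW_meanX_le hμ hq (P.sqrtW y) k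
  rw [sum_sub_distrib, ← inner_stacked, orthogonal, zero_sub] at h
  simpa only [agree, objective, psi] using h

theorem exists_isDualSolution_norm_le (hm : 2 ≤ m) (hG : P.G.Connected) :
    ∃ y, P.IsDualSolution y ∧ ‖y‖ ≤ P.MF / √P.lamMinPos := by
  obtain ⟨l⟩ := nonempty_of_mem_stdSimplex (hq ⟨0, by omega⟩)
  have hlam := P.lamMinPos_pos hm hG l
  obtain ⟨u, hu, u_norm, hmin⟩ := exists_isMinOn_Psi hμ hq (by omega)
  obtain ⟨y, rfl, y_norm⟩ := P.exists_sqrtW_eq hG hu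
  refine ⟨y, isDualSolution_of_isMinOn hmin, ?_⟩
  rw [le_div_iff₀ (Real.sqrt_pos.2 hlam), MF]
  refine Real.le_sqrt_of_sq_le ?_
  rw [mul_pow, Real.sq_sqrt hlam.le]
  have : (0 : ℝ) ≤ n * m * P.normC ^ 2 := by positivity
  linarith

theorem exists_isBarycenter_objective_eq (hm : m ≠ 0) (hG : P.G.Connected) :
    ∃ p, P.IsBarycenter p ∧ ∀ y, P.IsDualSolution y → P.objective p = -P.psi y := by
  obtain ⟨u, hu, -, hmin⟩ := exists_isMinOn_Psi hμ hq hm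
  obtain ⟨y, rfl, -⟩ := P.exists_sqrtW_eq hG hu
  set p := block (P.meanX (P.sqrtW y)) ⟨0, Nat.pos_of_ne_zero hm⟩
  have hp : p ∈ stdSimplex ℝ (Fin n) := meanX_mem_stdSimplex hq _ _
  have hle : P.objective p ≤ -P.psi y := objective_meanX_le hμ hq hm hmin _
  refine ⟨p, ⟨hp, fun p' hp' => hle.trans (neg_psi_le_objective hμ hq y hp')⟩, fun z hz => ?_⟩
  have psi_le : P.psi z ≤ P.psi y := hz (Set.mem_univ y)
  exact le_antisymm (by linarith) (neg_psi_le_objective hμ hq z hp)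

end

end BaryProblem

/-! ### The accelerated method with an inexact gradient -/

section StepSizes

variable {L : ℝ}

lemma alpha_pos (hL : 0 < L) (k : ℕ) : 0 < alpha L (k + 1) := (alpha_spec hL k).1

lemma bigA_succ (L : ℝ) (k : ℕ) : bigA L (k + 1) = bigA L k + alpha L (k + 1) := rfl

lemma bigA_eq_sum (L : ℝ) (k : ℕ) : bigA L k = ∑ l ∈ range k, alpha L (l + 1) := by
  induction k with
  | zero => rfl
  | succ k ih => rw [sum_range_succ, ← ih, bigA_succ]

lemma bigA_mono (hL : 0 < L) : Monotone (bigA L) :=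
  monotone_nat_of_le_succ fun k => le_add_of_nonneg_right (alpha_pos hL k).le

lemma sq_div_le_bigA (hL : 0 < L) (k : ℕ) : (k : ℝ) ^ 2 / (8 * L) ≤ bigA L k := by
  induction k with
  | zero => simp [bigA]
  | succ k ih =>
    have le_sqrt : (k : ℝ) ≤ √(1 + 8 * L * bigA L k) := by
      refine Real.le_sqrt_of_sq_le ?_
      rw [div_le_iff₀ (by positivity)] at ih
      linarith
    calc ((k + 1 : ℕ) : ℝ) ^ 2 / (8 * L) ≤ k ^ 2 / (8 * L) + (1 + k) / (4 * L) := by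
          push_cast
          field_simp
          linarith
      _ ≤ bigA L (k + 1) := by
          rw [bigA, stepRoot]
          gcongr

lemma bigA_le_sq_div (hL : 0 < L) (k : ℕ) : bigA L k ≤ (k : ℝ) ^ 2 / (2 * L) := by
  induction k with
  | zero => simp [bigA]
  | succ k ih =>
    have sqrt_le : √(1 + 8 * L * bigA L k) ≤ 1 + 2 * k := by
      refine Real.sqrt_le_iff.2 ⟨by positivity, ?_⟩
      rw [le_div_iff₀ (by positivity)] at ih
      nlinarith [k.cast_nonneg (α := ℝ)]
    calc bigA L (k + 1) ≤ k ^ 2 / (2 * L) + (1 + (1 + 2 * k)) / (4 * L) := by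
          rw [bigA, stepRoot]
          gcongr
      _ ≤ ((k + 1 : ℕ) : ℝ) ^ 2 / (2 * L) := by
          push_cast
          field_simp
          linarith

lemma bigA_pos (hL : 0 < L) {N : ℕ} (hN : 1 ≤ N) : 0 < bigA L N :=
  (div_pos (by positivity) (by positivity)).trans_le (sq_div_le_bigA hL N)

end StepSizes

section AcceleratedStep

variable {E : Type*} [NormedAddCommGroup E] [InnerProductSpace ℝ E] {L a A : ℝ}

/-- The step sizes are tuned so that the quadratic error of the smoothness bound is a quarter of
the squared step in `ζ`. -/
lemma smooth_step_le (ha : a ≠ 0) (hAa : A = 2 * L * a ^ 2) (hA : 0 < A) {fx fy : ℝ} {x y g G : E}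
    (hy : y - x = -(a ^ 2 / A) • g)
    (hsmooth : fy ≤ fx + inner ℝ G (y - x) + L / 2 * ‖y - x‖ ^ 2) :
    A * fy ≤ A * fx - a ^ 2 * inner ℝ G g + a ^ 2 / 4 * ‖g‖ ^ 2 := by
  rw [hy, real_inner_smul_right, norm_smul, mul_pow, Real.norm_eq_abs, sq_abs] at hsmooth
  have hL : L = A / (2 * a ^ 2) := by
    rw [hAa]
    field_simp
  calc A * fy ≤ _ := mul_le_mul_of_nonneg_left hsmooth hA.le
    _ = _ := by
      rw [hL]
      field_simp
      ring

lemma norm_sub_smul_sub_sq (ζ g z : E) :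
    ‖ζ - a • g - z‖ ^ 2 = ‖ζ - z‖ ^ 2 - 2 * a * inner ℝ g (ζ - z) + a ^ 2 * ‖g‖ ^ 2 := by
  rw [sub_right_comm, norm_sub_sq_real, norm_smul, real_inner_smul_right, mul_pow,
    Real.norm_eq_abs, sq_abs, real_inner_comm]
  ring

lemma three_quarters_norm_sq_sub_inner_le (g G : E) :
    3 / 4 * ‖g‖ ^ 2 - inner ℝ G g ≤ ‖g - G‖ ^ 2 := by
  rw [norm_sub_sq_real, real_inner_comm]
  nlinarith [real_inner_le_norm g G, sq_nonneg (‖g‖ / 2 - ‖G‖)]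

lemma accelerated_step {f : E → ℝ} {ζ y lam ζ' y' g G : E} (ha : 0 < a) (hA : 0 ≤ A)
    (hAa : A + a = 2 * L * a ^ 2) (hlam : lam = (A + a)⁻¹ • (a • ζ + A • y))
    (hζ' : ζ' = ζ - a • g) (hy' : y' = (A + a)⁻¹ • (a • ζ' + A • y))
    (hconvex : f lam + inner ℝ G (y - lam) ≤ f y)
    (hsmooth : f y' ≤ f lam + inner ℝ G (y' - lam) + L / 2 * ‖y' - lam‖ ^ 2) (z : E) :
    (A + a) * f y' ≤ A * f y + a * (f lam + inner ℝ g (z - lam)) +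
      ‖ζ - z‖ ^ 2 / 2 - ‖ζ' - z‖ ^ 2 / 2 +
      a * inner ℝ (g - G) (lam - ζ) + a ^ 2 * ‖g - G‖ ^ 2 := by
  have hA' : 0 < A + a := by linarith
  have displacement : y' - lam = -(a ^ 2 / (A + a)) • g := by
    rw [hy', hlam, hζ']
    module
  have coupling : A • (y - lam) = a • (lam - ζ) := by
    have h : (A + a) • lam = a • ζ + A • y := by
      rw [hlam, smul_inv_smul₀ hA'.ne']
    linear_combination (norm := module) -h
  have descent := smooth_step_le ha.ne' hAa hA' displacement hsmooth
  have convexity := mul_le_mul_of_nonneg_left hconvex hA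
  rw [mul_add, ← real_inner_smul_right, coupling, real_inner_smul_right] at convexity
  have split_inner : inner ℝ g (z - lam) = -inner ℝ g (lam - ζ) - inner ℝ g (ζ - z) := by
    rw [← inner_neg_right, ← inner_sub_right]
    congr 1
    abel
  have young := mul_le_mul_of_nonneg_left (three_quarters_norm_sq_sub_inner_le g G) (sq_nonneg a)
  rw [hζ', norm_sub_smul_sub_sq, split_inner, inner_sub_left]
  linarith

end AcceleratedStep

/-! ### The accelerated method driven by batches -/

section BatchMean

variable {S E : Type*}

/-- The average of `f` over the first `r` samples of a sequence. -/
noncomputable def batchMean [AddCommMonoid E] [Module ℝ E] (r : ℕ) (f : S → E) (ξ : ℕ → S) : E :=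
  (r : ℝ)⁻¹ • ∑ s ∈ range r, f (ξ s)

lemma batchMean_const [AddCommMonoid E] [Module ℝ E] {r : ℕ} (hr : r ≠ 0) (v : E) (ξ : ℕ → S) :
    batchMean r (fun _ => v) ξ = v := by
  rw [batchMean, sum_const, card_range, ← Nat.cast_smul_eq_nsmul ℝ,
    inv_smul_smul₀ (Nat.cast_ne_zero.2 hr)]

lemma batchMean_sub [AddCommGroup E] [Module ℝ E] (r : ℕ) (f g : S → E) (ξ : ℕ → S) :
    batchMean r (fun x => f x - g x) ξ = batchMean r f ξ - batchMean r g ξ := by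
  rw [batchMean, sum_sub_distrib, smul_sub, batchMean, batchMean]

lemma map_batchMean {F : Type*} [AddCommMonoid E] [Module ℝ E] [AddCommMonoid F] [Module ℝ F]
    (T : E →ₗ[ℝ] F) (r : ℕ) (f : S → E) (ξ : ℕ → S) :
    T (batchMean r f ξ) = batchMean r (fun x => T (f x)) ξ := by
  simp only [batchMean, map_smul, map_sum]

end BatchMean

namespace BaryProblem

variable {m n : ℕ} {P : BaryProblem m n}

lemma Lpsi_pos (hμ : 0 < P.mu) (hlam : 0 < P.lamMax) : 0 < P.Lpsi := div_pos hlam hμ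

section Smoothness

variable (hμ : 0 < P.mu) (hq : ∀ i, P.q i ∈ stdSimplex ℝ (Fin n))

include hμ hq

lemma psi_ge (x y : Stacked m n) :
    P.psi x + inner ℝ (P.sqrtW (P.meanX (P.sqrtW x))) (y - x) ≤ P.psi y := by
  rw [psi_eq, psi_eq, inner_sqrtW_left, map_sub]
  linarith [Psi_ge hμ hq (P.sqrtW x) (P.sqrtW y)]

lemma psi_le (x y : Stacked m n) :
    P.psi y ≤ P.psi x + inner ℝ (P.sqrtW (P.meanX (P.sqrtW x))) (y - x) +
      P.Lpsi / 2 * ‖y - x‖ ^ 2 := by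
  have h := Psi_le hμ hq (P.sqrtW x) (P.sqrtW y)
  rw [← map_sub, ← inner_sqrtW_left] at h
  have quadratic : ‖P.sqrtW (y - x)‖ ^ 2 / (2 * P.mu) ≤ P.Lpsi / 2 * ‖y - x‖ ^ 2 := by
    rw [Lpsi]
    field_simp
    exact P.norm_sqrtW_sq_le _
  rw [psi_eq, psi_eq]
  linarith

end Smoothness

variable (P)

/-- The stochastic gradient of `Psi` at `u` given by the sample `x`. -/
noncomputable def sampleX (u : Stacked m n) (x : Fin m → Fin n) : Stacked m n :=
  WithLp.toLp 2 fun ij => compGrad P.mu P.C (block u ij.1) (x ij.1) ij.2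

/-- The stochastic value of `Psi` at `u` given by the sample `x`. -/
noncomputable def sampleVal (u : Stacked m n) (x : Fin m → Fin n) : ℝ :=
  ∑ i, logSumExp P.mu (columnPotential P.C (block u i) (x i))

/-- The cost of shipping a unit of mass of each sampled column to its stochastic gradient. -/
noncomputable def sampleCost (u : Stacked m n) (x : Fin m → Fin n) : ℝ :=
  ∑ i, columnCost P.mu P.C (x i) (compGrad P.mu P.C (block u i) (x i))

lemma batchX_eq_batchMean (r : ℕ) (ξ : ℕ → Fin m → Fin n) (u : Stacked m n) :
    P.batchX r ξ u = batchMean r (P.sampleX u) ξ := by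
  ext ij
  simp only [batchX, batchMean, sampleX, PiLp.smul_apply, WithLp.ofLp_sum, Finset.sum_apply,
    smul_eq_mul, inv_mul_eq_div]

variable {P}

lemma sampleCost_eq (hμ : 0 < P.mu) (u : Stacked m n) (x : Fin m → Fin n) :
    P.sampleCost u x = inner ℝ u (P.sampleX u x) - P.sampleVal u x := by
  simp only [inner_stacked, sampleCost, sampleVal, columnCost_compGrad hμ, sum_sub_distrib,
    sampleX, block, mul_comm]

variable (P) (r : ℕ → ℕ) (ξ : ℕ → ℕ → Fin m → Fin n)

/-- The point `√W λ^k` at which the `k`-th batch is drawn. -/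
noncomputable def dualPoint (k : ℕ) : Stacked m n := P.sqrtW (P.iterate r ξ k).lam

/-- The `k`-th primal estimate `x(√W λ^k, {ξ^k_s}_s)`. -/
noncomputable def estimate (k : ℕ) : Stacked m n := P.batchX (r k) (ξ k) (P.dualPoint r ξ k)

/-- The mean cost of the samples of the `k`-th batch. -/
noncomputable def estimateCost (k : ℕ) : ℝ :=
  batchMean (r k) (P.sampleCost (P.dualPoint r ξ k)) (ξ k)

/-- The error of the `k`-th batch as an estimate of the mean. -/
noncomputable def noiseX (k : ℕ) : Stacked m n :=
  P.estimate r ξ k - P.meanX (P.dualPoint r ξ k)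

/-- The error of the `k`-th batch in the value of `Psi`. -/
noncomputable def noiseV (k : ℕ) : ℝ :=
  P.Psi (P.dualPoint r ξ k) - batchMean (r k) (P.sampleVal (P.dualPoint r ξ k)) (ξ k)

variable {P r ξ}

lemma estimateCost_eq (hμ : 0 < P.mu) (k : ℕ) :
    P.estimateCost r ξ k = inner ℝ (P.estimate r ξ k) (P.dualPoint r ξ k) -
      batchMean (r k) (P.sampleVal (P.dualPoint r ξ k)) (ξ k) := by
  rw [estimate, batchX_eq_batchMean, real_inner_comm, ← innerₗ_apply_apply, map_batchMean,
    ← batchMean_sub]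
  simp only [estimateCost, innerₗ_apply_apply, ← sampleCost_eq hμ]

lemma psi_add_inner_estimate_eq (hμ : 0 < P.mu) (k : ℕ) (z : Stacked m n) :
    P.psi (P.iterate r ξ k).lam +
        inner ℝ (P.sqrtW (P.estimate r ξ k)) (z - (P.iterate r ξ k).lam) =
      inner ℝ (P.estimate r ξ k) (P.sqrtW z) + P.noiseV r ξ k -
        (P.estimateCost r ξ k + P.entropyQ) := by
  rw [inner_sqrtW_left, map_sub, inner_sub_right, estimateCost_eq hμ, noiseV, psi_eq]
  simp only [dualPoint]
  ring

section Accelerated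

variable (hμ : 0 < P.mu) (hlam : 0 < P.lamMax) (hq : ∀ i, P.q i ∈ stdSimplex ℝ (Fin n))

include hμ hlam hq

lemma iterate_step (k : ℕ) (z : Stacked m n) :
    bigA P.Lpsi (k + 1) * P.psi (P.iterate r ξ (k + 1)).y ≤
      bigA P.Lpsi k * P.psi (P.iterate r ξ k).y +
      alpha P.Lpsi (k + 1) * (P.psi (P.iterate r ξ (k + 1)).lam +
        inner ℝ (P.sqrtW (P.estimate r ξ (k + 1))) (z - (P.iterate r ξ (k + 1)).lam)) +
      ‖(P.iterate r ξ k).zeta - z‖ ^ 2 / 2 - ‖(P.iterate r ξ (k + 1)).zeta - z‖ ^ 2 / 2 +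
      alpha P.Lpsi (k + 1) * inner ℝ (P.sqrtW (P.noiseX r ξ (k + 1)))
        ((P.iterate r ξ (k + 1)).lam - (P.iterate r ξ k).zeta) +
      alpha P.Lpsi (k + 1) ^ 2 * ‖P.sqrtW (P.noiseX r ξ (k + 1))‖ ^ 2 := by
  have hL := Lpsi_pos hμ hlam
  rw [noiseX, map_sub]
  exact accelerated_step (f := P.psi) (alpha_pos hL k) (bigA_nonneg hL k) (alpha_spec hL k).2.2
    rfl rfl rfl (psi_ge hμ hq _ _) (psi_le hμ hq _ _) z

lemma primal_dual_sum (N : ℕ) (z : Stacked m n) :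
    bigA P.Lpsi N * P.psi (P.iterate r ξ N).y +
      ∑ k ∈ range N, alpha P.Lpsi (k + 1) *
        (P.estimateCost r ξ (k + 1) + P.entropyQ) ≤
      ∑ k ∈ range N, alpha P.Lpsi (k + 1) * inner ℝ (P.estimate r ξ (k + 1)) (P.sqrtW z) +
      ‖z‖ ^ 2 / 2 - ‖(P.iterate r ξ N).zeta - z‖ ^ 2 / 2 +
      ∑ k ∈ range N, alpha P.Lpsi (k + 1) * (P.noiseV r ξ (k + 1) +
        inner ℝ (P.sqrtW (P.noiseX r ξ (k + 1)))
          ((P.iterate r ξ (k + 1)).lam - (P.iterate r ξ k).zeta)) +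
      ∑ k ∈ range N, alpha P.Lpsi (k + 1) ^ 2 * ‖P.sqrtW (P.noiseX r ξ (k + 1))‖ ^ 2 := by
  induction N with
  | zero => simp [bigA, iterate]
  | succ N ih =>
    have h := iterate_step (r := r) (ξ := ξ) hμ hlam hq N z
    rw [psi_add_inner_estimate_eq hμ] at h
    simp only [sum_range_succ]
    linarith

/-- One step towards `z`, with the gradient at `λ^{k+1}` replaced by convexity of `psi`. -/
lemma iterate_step_sub (k : ℕ) (z : Stacked m n) :
    bigA P.Lpsi (k + 1) * (P.psi (P.iterate r ξ (k + 1)).y - P.psi z) +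
        ‖(P.iterate r ξ (k + 1)).zeta - z‖ ^ 2 / 2 ≤
      bigA P.Lpsi k * (P.psi (P.iterate r ξ k).y - P.psi z) +
        ‖(P.iterate r ξ k).zeta - z‖ ^ 2 / 2 +
      alpha P.Lpsi (k + 1) *
        inner ℝ (P.sqrtW (P.noiseX r ξ (k + 1))) (z - (P.iterate r ξ k).zeta) +
      alpha P.Lpsi (k + 1) ^ 2 * ‖P.sqrtW (P.noiseX r ξ (k + 1))‖ ^ 2 := by
  have h := iterate_step (r := r) (ξ := ξ) hμ hlam hq k z
  set lam := (P.iterate r ξ (k + 1)).lam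
  set noise := P.sqrtW (P.noiseX r ξ (k + 1))
  have split_estimate : inner ℝ (P.sqrtW (P.estimate r ξ (k + 1))) (z - lam) =
      inner ℝ (P.sqrtW (P.meanX (P.sqrtW lam))) (z - lam) + inner ℝ noise (z - lam) := by
    rw [← inner_add_left, ← map_add, noiseX, dualPoint, add_sub_cancel]
  have split_inner : inner ℝ noise (z - (P.iterate r ξ k).zeta) =
      inner ℝ noise (z - lam) + inner ℝ noise (lam - (P.iterate r ξ k).zeta) := by
    rw [← inner_add_right, sub_add_sub_cancel]
  have convexity := mul_le_mul_of_nonneg_left (psi_ge hμ hq lam z)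
    (alpha_pos (Lpsi_pos hμ hlam) k).le
  rw [split_estimate, bigA_succ] at h
  rw [split_inner, bigA_succ]
  linarith

lemma norm_zeta_sub_sq_le {z : Stacked m n} (hz : P.IsDualSolution z) (N : ℕ) :
    ‖(P.iterate r ξ N).zeta - z‖ ^ 2 / 2 ≤ ‖z‖ ^ 2 / 2 +
      ∑ k ∈ range N, alpha P.Lpsi (k + 1) * inner ℝ (P.sqrtW (P.noiseX r ξ (k + 1)))
          (z - (P.iterate r ξ k).zeta) +
      ∑ k ∈ range N, alpha P.Lpsi (k + 1) ^ 2 * ‖P.sqrtW (P.noiseX r ξ (k + 1))‖ ^ 2 := by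
  have telescoped : bigA P.Lpsi N * (P.psi (P.iterate r ξ N).y - P.psi z) +
      ‖(P.iterate r ξ N).zeta - z‖ ^ 2 / 2 ≤ ‖z‖ ^ 2 / 2 +
      ∑ k ∈ range N, alpha P.Lpsi (k + 1) * inner ℝ (P.sqrtW (P.noiseX r ξ (k + 1)))
          (z - (P.iterate r ξ k).zeta) +
      ∑ k ∈ range N, alpha P.Lpsi (k + 1) ^ 2 * ‖P.sqrtW (P.noiseX r ξ (k + 1))‖ ^ 2 := by
    induction N with
    | zero => simp [bigA, iterate]
    | succ N ih =>
      simp only [sum_range_succ]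
      linarith [iterate_step_sub (r := r) (ξ := ξ) hμ hlam hq N z]
  have gap_nonneg : 0 ≤ bigA P.Lpsi N * (P.psi (P.iterate r ξ N).y - P.psi z) :=
    mul_nonneg (bigA_nonneg (Lpsi_pos hμ hlam) N) (sub_nonneg.2 (hz (Set.mem_univ _)))
  linarith

end Accelerated

end BaryProblem

/-! ### Concentration for adapted sums over independent samples -/

section

variable {E : Type*} [NormedAddCommGroup E] [InnerProductSpace ℝ E]

lemma sqrt_sq_add_norm_add_sq_le {b : ℝ} (hb : 0 < b) (x y : E) :
    √(b ^ 2 + ‖x + y‖ ^ 2) ≤ √(b ^ 2 + ‖x‖ ^ 2) + inner ℝ x y / √(b ^ 2 + ‖x‖ ^ 2) +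
      ‖y‖ ^ 2 / (2 * b) := by
  set a := √(b ^ 2 + ‖x‖ ^ 2)
  have sq_a : a ^ 2 = b ^ 2 + ‖x‖ ^ 2 := Real.sq_sqrt (by positivity)
  have b_le_a : b ≤ a := Real.le_sqrt_of_sq_le (le_add_of_nonneg_right (sq_nonneg _))
  have ha : 0 < a := hb.trans_le b_le_a
  have sq_eq : b ^ 2 + ‖x + y‖ ^ 2 = a ^ 2 + 2 * inner ℝ x y + ‖y‖ ^ 2 := by
    rw [sq_a, norm_add_sq_real]
    ring
  calc √(b ^ 2 + ‖x + y‖ ^ 2) ≤ (a ^ 2 + (b ^ 2 + ‖x + y‖ ^ 2)) / (2 * a) := by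
        rw [le_div_iff₀ (by positivity)]
        nlinarith [Real.sq_sqrt (show 0 ≤ b ^ 2 + ‖x + y‖ ^ 2 by positivity),
          sq_nonneg (√(b ^ 2 + ‖x + y‖ ^ 2) - a)]
    _ = a + inner ℝ x y / a + ‖y‖ ^ 2 / (2 * a) := by
        rw [sq_eq]
        field_simp
        ring
    _ ≤ a + inner ℝ x y / a + ‖y‖ ^ 2 / (2 * b) := by gcongr

lemma abs_inner_div_sqrt_le {b : ℝ} (hb : 0 < b) (x y : E) :
    |inner ℝ x y / √(b ^ 2 + ‖x‖ ^ 2)| ≤ ‖y‖ := by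
  have hx : ‖x‖ ≤ √(b ^ 2 + ‖x‖ ^ 2) :=
    Real.le_sqrt_of_sq_le (le_add_of_nonneg_left (sq_nonneg _))
  rw [abs_div, abs_of_nonneg (Real.sqrt_nonneg _), div_le_iff₀' (Real.sqrt_pos.2 (by positivity))]
  exact (abs_real_inner_le_norm _ _).trans (mul_le_mul_of_nonneg_right hx (norm_nonneg y))

/-- `√(b² + ‖v‖²)` is a smooth surrogate of the norm whose exponential moments grow like those of
a scalar sum. -/
lemma sum_mul_exp_sqrt_sq_add_norm_sq_le {S : Type*} [Fintype S] {p : S → ℝ}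
    (hp : p ∈ stdSimplex ℝ S) {Y : S → E} (hmean : ∑ x, p x • Y x = 0) {c : ℝ}
    (hY : ∀ x, ‖Y x‖ ^ 2 ≤ c) {b τ : ℝ} (hb : 0 < b) (hτ : 0 ≤ τ) (v : E) :
    ∑ x, p x * Real.exp (τ * √(b ^ 2 + ‖v + Y x‖ ^ 2)) ≤
      Real.exp (τ * √(b ^ 2 + ‖v‖ ^ 2) + (τ / (2 * b) + τ ^ 2 / 2) * c) := by
  obtain ⟨x₀⟩ := nonempty_of_mem_stdSimplex hp
  have hc : 0 ≤ c := (sq_nonneg _).trans (hY x₀)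
  set a := √(b ^ 2 + ‖v‖ ^ 2)
  have exponent_le (x : S) : τ * √(b ^ 2 + ‖v + Y x‖ ^ 2) ≤
      τ * a + τ / (2 * b) * c + τ * (inner ℝ v (Y x) / a) := by
    have h : √(b ^ 2 + ‖v + Y x‖ ^ 2) ≤ a + inner ℝ v (Y x) / a + c / (2 * b) :=
      (sqrt_sq_add_norm_add_sq_le hb v (Y x)).trans (by gcongr; exact hY x)
    exact (mul_le_mul_of_nonneg_left h hτ).trans_eq (by ring)
  have mean_eq : ∑ x, p x * (τ * (inner ℝ v (Y x) / a)) = 0 := by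
    calc ∑ x, p x * (τ * (inner ℝ v (Y x) / a)) = τ / a * inner ℝ v (∑ x, p x • Y x) := by
          rw [inner_sum, mul_sum]
          refine sum_congr rfl fun x _ => ?_
          rw [real_inner_smul_right]
          ring
      _ = 0 := by rw [hmean, inner_zero_right, mul_zero]
  have hoeffding := sum_mul_exp_le_of_abs_le hp (x := fun x => τ * (inner ℝ v (Y x) / a))
    (b := τ * √c) fun x => by
      rw [abs_mul, abs_of_nonneg hτ]
      exact mul_le_mul_of_nonneg_left
        ((abs_inner_div_sqrt_le hb v (Y x)).trans (Real.le_sqrt_of_sq_le (hY x))) hτ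
  rw [mean_eq, zero_add, mul_pow, Real.sq_sqrt hc] at hoeffding
  calc ∑ x, p x * Real.exp (τ * √(b ^ 2 + ‖v + Y x‖ ^ 2))
      ≤ ∑ x, p x * Real.exp (τ * a + τ / (2 * b) * c + τ * (inner ℝ v (Y x) / a)) :=
        sum_le_sum fun x _ =>
          mul_le_mul_of_nonneg_left (Real.exp_le_exp.2 (exponent_le x)) (hp.1 x)
    _ = Real.exp (τ * a + τ / (2 * b) * c) *
          ∑ x, p x * Real.exp (τ * (inner ℝ v (Y x) / a)) := by
        simp only [Real.exp_add (_ + _), mul_sum, mul_left_comm]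
    _ ≤ Real.exp (τ * a + τ / (2 * b) * c) * Real.exp (τ ^ 2 * c / 2) := by gcongr
    _ = Real.exp (τ * a + (τ / (2 * b) + τ ^ 2 / 2) * c) := by
        rw [← Real.exp_add]
        ring_nf

end

lemma dependsOn_sum_of_rank_lt {ι S α E : Type*} [LT α] [AddCommMonoid E]
    {J : Finset ι} {rank : ι → α} {D : ι → (ι → S) → S → E}
    (hD : ∀ i ∈ J, DependsOn (D i) {j ∈ (J : Set ι) | rank j < rank i}) :
    DependsOn (fun ω => ∑ i ∈ J, D i ω (ω i)) (J : Set ι) := fun ω ω' h =>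
  sum_congr rfl fun i hi => by rw [hD i hi fun j hj => h j hj.1, h i hi]

lemma measurable_comp_of_dependsOn {S Ω ι β : Type*} [Finite S] [MeasurableSpace S]
    [DiscreteMeasurableSpace S] [MeasurableSpace Ω] [MeasurableSpace β] [Nonempty β]
    {X : ι → Ω → S} {J : Finset ι} (hX : ∀ i, Measurable (X i)) {V : (ι → S) → β}
    (hV : DependsOn V (J : Set ι)) :
    Measurable fun w => V fun i => X i w := by
  obtain ⟨g, rfl⟩ := dependsOn_iff_exists_comp.1 hV
  have hg : Measurable g := .of_discrete
  exact hg.comp (measurable_pi_lambda _ fun j => hX j)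

section Adapted

variable {S Ω : Type*} [Fintype S] [MeasurableSpace S] [DiscreteMeasurableSpace S]
  [MeasurableSpace Ω] {Pr : Measure Ω} [IsProbabilityMeasure Pr]

lemma lintegral_comp_of_indepFun {T : Type*} [Countable T] [MeasurableSpace T]
    [DiscreteMeasurableSpace T] {Z : Ω → T} {Y : Ω → S} (hZ : Measurable Z) (hY : Measurable Y)
    (hind : IndepFun Z Y Pr) (F : T → S → ENNReal) :
    ∫⁻ w, F (Z w) (Y w) ∂Pr = ∫⁻ w, ∑ x, Pr (Y ⁻¹' {x}) * F (Z w) x ∂Pr := by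
  have hF : Measurable fun p : T × S => F p.1 p.2 := .of_discrete
  have average (z : T) : ∫⁻ x, F z x ∂Pr.map Y = ∑ x, Pr (Y ⁻¹' {x}) * F z x := by
    rw [lintegral_fintype]
    refine sum_congr rfl fun x _ => ?_
    rw [Measure.map_apply hY (measurableSet_singleton x), mul_comm]
  have := Measure.isProbabilityMeasure_map (μ := Pr) hY.aemeasurable
  rw [← lintegral_map (f := fun p : T × S => F p.1 p.2) hF (hZ.prodMk hY),
    (indepFun_iff_map_prod_eq_prod_map_map hZ.aemeasurable hY.aemeasurable).1 hind,
    lintegral_prod _ hF.aemeasurable, lintegral_map .of_discrete hZ]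
  simp only [average]

lemma measureReal_preimage_mem_stdSimplex {Y : Ω → S} (hY : Measurable Y) :
    (fun x => Pr.real (Y ⁻¹' {x})) ∈ stdSimplex ℝ S := by
  refine ⟨fun x => measureReal_nonneg, ?_⟩
  rw [sum_measureReal_preimage_singleton _ fun x _ => hY (measurableSet_singleton x)]
  simp

variable {ι α : Type*} [LinearOrder α] {X : ι → Ω → S} {J : Finset ι} {rank : ι → α}

/-- A potential that does not increase on average with any increment is a supermartingale along
the partial sums, the samples being revealed by increasing rank. -/
lemma lintegral_comp_sum_le {E : Type*} [AddCommMonoid E] (hX : ∀ i, Measurable (X i))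
    (hind : iIndepFun X Pr) {D : ι → (ι → S) → S → E}
    (hD : ∀ i ∈ J, DependsOn (D i) {j ∈ (J : Set ι) | rank j < rank i}) {Φ : E → ENNReal}
    (hΦ : ∀ i ∈ J, ∀ ω v, ∑ x, Pr (X i ⁻¹' {x}) * Φ (v + D i ω x) ≤ Φ v) :
    ∫⁻ w, Φ (∑ i ∈ J, D i (fun j => X j w) (X i w)) ∂Pr ≤ Φ 0 := by
  classical
  induction J using Finset.induction_on_max_value rank with
  | empty => simp
  | insert a s ha hmax ih =>
    have hDs (i : ι) (hi : i ∈ s) : DependsOn (D i) {j ∈ (s : Set ι) | rank j < rank i} :=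
      fun ω ω' h => hD i (mem_insert_of_mem hi) fun j hj => h j
        ⟨(mem_insert.1 hj.1).resolve_left fun hja => (hja ▸ hj.2).not_ge (hmax i hi), hj.2⟩
    have hDa : DependsOn (D a) (s : Set ι) := fun ω ω' h =>
      hD a (mem_insert_self a s) fun j hj => h j
        ((mem_insert.1 hj.1).resolve_left fun hja => (hja ▸ hj.2).false)
    have past : DependsOn (fun ω => (∑ i ∈ s, D i ω (ω i), D a ω)) (s : Set ι) := fun ω ω' h =>
      Prod.ext (dependsOn_sum_of_rank_lt hDs h) (hDa h)
    obtain ⟨g, hg⟩ := dependsOn_iff_exists_comp.1 past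
    let Z : Ω → s → S := fun w j => X j w
    have hgZ (w : Ω) : g (Z w) = (∑ i ∈ s, D i (fun j => X j w) (X i w), D a fun j => X j w) :=
      (congrFun hg fun j => X j w).symm
    have hZX : IndepFun Z (X a) Pr :=
      (hind.indepFun_finset s {a} (disjoint_singleton_right.2 ha) hX).comp measurable_id
        (measurable_pi_apply (⟨a, mem_singleton_self a⟩ : ({a} : Finset ι)))
    calc ∫⁻ w, Φ (∑ i ∈ insert a s, D i (fun j => X j w) (X i w)) ∂Pr
        = ∫⁻ w, Φ ((g (Z w)).1 + (g (Z w)).2 (X a w)) ∂Pr := by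
          simp only [hgZ, sum_insert ha, add_comm]
      _ = ∫⁻ w, ∑ x, Pr (X a ⁻¹' {x}) * Φ ((g (Z w)).1 + (g (Z w)).2 x) ∂Pr :=
          lintegral_comp_of_indepFun (Z := Z) (measurable_pi_lambda _ fun j => hX j) (hX a) hZX
            fun z x => Φ ((g z).1 + (g z).2 x)
      _ ≤ ∫⁻ w, Φ (∑ i ∈ s, D i (fun j => X j w) (X i w)) ∂Pr := by
          simp only [hgZ]
          exact lintegral_mono fun w => hΦ a (mem_insert_self a s) _ _
      _ ≤ Φ 0 := ih hDs fun i hi => hΦ i (mem_insert_of_mem hi)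

lemma measure_le_comp_sum_le {E : Type*} [AddCommMonoid E] (hX : ∀ i, Measurable (X i))
    (hind : iIndepFun X Pr) {D : ι → (ι → S) → S → E}
    (hD : ∀ i ∈ J, DependsOn (D i) {j ∈ (J : Set ι) | rank j < rank i}) {Φ : E → ℝ}
    (hΦ : ∀ i ∈ J, ∀ ω v,
      ∑ x, Pr.real (X i ⁻¹' {x}) * Real.exp (Φ (v + D i ω x)) ≤ Real.exp (Φ v)) (t : ℝ) :
    Pr.real {w | t ≤ Φ (∑ i ∈ J, D i (fun j => X j w) (X i w))} ≤ Real.exp (Φ 0 - t) := by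
  have meas : Measurable fun w =>
      ENNReal.ofReal (Real.exp (Φ (∑ i ∈ J, D i (fun j => X j w) (X i w)))) :=
    measurable_comp_of_dependsOn (J := J) hX
      (V := fun ω => ENNReal.ofReal (Real.exp (Φ (∑ i ∈ J, D i ω (ω i)))))
      fun ω ω' h => congrArg (fun v => ENNReal.ofReal (Real.exp (Φ v)))
        (dependsOn_sum_of_rank_lt hD h)
  have supermartingale := lintegral_comp_sum_le (Φ := fun v => ENNReal.ofReal (Real.exp (Φ v)))
    hX hind hD fun i hi ω v => by
      have term_eq (x : S) : Pr (X i ⁻¹' {x}) * ENNReal.ofReal (Real.exp (Φ (v + D i ω x))) =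
          ENNReal.ofReal (Pr.real (X i ⁻¹' {x}) * Real.exp (Φ (v + D i ω x))) := by
        rw [ENNReal.ofReal_mul measureReal_nonneg, ofReal_measureReal]
      simp only [term_eq]
      rw [← ENNReal.ofReal_sum_of_nonneg fun x _ =>
        mul_nonneg measureReal_nonneg (Real.exp_pos _).le]
      exact ENNReal.ofReal_le_ofReal (hΦ i hi ω v)
  have markov := (mul_meas_ge_le_lintegral (μ := Pr) meas (ENNReal.ofReal (Real.exp t))).trans
    supermartingale
  have le_iff (a : ℝ) : ENNReal.ofReal (Real.exp t) ≤ ENNReal.ofReal (Real.exp a) ↔ t ≤ a := by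
    rw [ENNReal.ofReal_le_ofReal_iff (Real.exp_pos _).le, Real.exp_le_exp]
  simp only [le_iff] at markov
  have h := ENNReal.toReal_mono ENNReal.ofReal_ne_top markov
  rw [ENNReal.toReal_mul, ENNReal.toReal_ofReal (Real.exp_pos _).le,
    ENNReal.toReal_ofReal (Real.exp_pos _).le] at h
  rwa [Real.exp_sub, le_div_iff₀' (Real.exp_pos _)]

/-- Azuma's inequality in self-normalized form: the bounds `c i` may depend on the past. -/
lemma measure_add_mul_sum_lt_sum_le (hX : ∀ i, Measurable (X i)) (hind : iIndepFun X Pr)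
    {φ : ι → (ι → S) → S → ℝ} {c : ι → (ι → S) → ℝ}
    (hφ : ∀ i ∈ J, DependsOn (φ i) {j ∈ (J : Set ι) | rank j < rank i})
    (hc : ∀ i ∈ J, DependsOn (c i) {j ∈ (J : Set ι) | rank j < rank i})
    (hmean : ∀ i ∈ J, ∀ ω, ∑ x, Pr.real (X i ⁻¹' {x}) * φ i ω x = 0)
    (hbound : ∀ i ∈ J, ∀ ω x, φ i ω x ^ 2 ≤ c i ω) {b t : ℝ} (hb : 0 < b) (ht : 0 ≤ t) :
    Pr.real {w | b + t / (2 * b) * ∑ i ∈ J, c i (fun j => X j w) <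
      ∑ i ∈ J, φ i (fun j => X j w) (X i w)} ≤ Real.exp (-t) := by
  set τ := t / b with hτ_def
  have h := measure_le_comp_sum_le (J := J) hX hind (rank := rank)
    (D := fun i ω x => τ * φ i ω x - τ ^ 2 / 2 * c i ω) (Φ := id)
    (fun i hi ω ω' h => by simp only [hφ i hi h, hc i hi h]) (fun i hi ω v => ?_) t
  · simp only [sum_sub_distrib, ← mul_sum, id, zero_sub] at h
    refine (measureReal_mono fun w hw => ?_).trans h
    have scaled := mul_le_mul_of_nonneg_left (le_of_lt hw) (show 0 ≤ τ by positivity)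
    have expand : τ * (b + t / (2 * b) * ∑ i ∈ J, c i (fun j => X j w)) =
        t + τ ^ 2 / 2 * ∑ i ∈ J, c i (fun j => X j w) := by
      rw [hτ_def]
      field_simp
    simp only [Set.mem_ofPred_eq]
    linarith
  obtain ⟨x₀⟩ := nonempty_of_mem_stdSimplex
    (measureReal_preimage_mem_stdSimplex (Pr := Pr) (hX i))
  have hoeffding := sum_mul_exp_le_of_abs_le (measureReal_preimage_mem_stdSimplex (Pr := Pr) (hX i))
    (x := fun x => τ * φ i ω x) (b := |τ| * √(c i ω)) fun x => by
      rw [abs_mul]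
      exact mul_le_mul_of_nonneg_left (Real.abs_le_sqrt (hbound i hi ω x)) (abs_nonneg _)
  simp only [mul_left_comm _ τ, ← mul_sum, hmean i hi, mul_zero, zero_add, mul_pow, sq_abs,
    Real.sq_sqrt ((sq_nonneg _).trans (hbound i hi ω x₀))] at hoeffding
  calc ∑ x, Pr.real (X i ⁻¹' {x}) * Real.exp (v + (τ * φ i ω x - τ ^ 2 / 2 * c i ω))
      = Real.exp (v - τ ^ 2 / 2 * c i ω) *
          ∑ x, Pr.real (X i ⁻¹' {x}) * Real.exp (τ * φ i ω x) := by
        rw [mul_sum]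
        refine sum_congr rfl fun x _ => ?_
        rw [mul_left_comm, ← Real.exp_add]
        ring_nf
    _ ≤ Real.exp (v - τ ^ 2 / 2 * c i ω) * Real.exp (τ ^ 2 * c i ω / 2) := by gcongr
    _ = Real.exp v := by
        rw [← Real.exp_add]
        ring_nf

variable {E : Type*} [NormedAddCommGroup E] [InnerProductSpace ℝ E]

lemma measure_le_mul_sqrt_sq_add_norm_sum_sq_sub_le (hX : ∀ i, Measurable (X i))
    (hind : iIndepFun X Pr) {Y : ι → (ι → S) → S → E} {c : ι → ℝ}
    (hY : ∀ i ∈ J, DependsOn (Y i) {j ∈ (J : Set ι) | rank j < rank i})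
    (hmean : ∀ i ∈ J, ∀ ω, ∑ x, Pr.real (X i ⁻¹' {x}) • Y i ω x = 0)
    (hbound : ∀ i ∈ J, ∀ ω x, ‖Y i ω x‖ ^ 2 ≤ c i) {b τ : ℝ} (hb : 0 < b) (hτ : 0 ≤ τ) (s : ℝ) :
    Pr.real {w | s ≤ τ * √(b ^ 2 + ‖∑ i ∈ J, Y i (fun j => X j w) (X i w)‖ ^ 2) -
      (τ / (2 * b) + τ ^ 2 / 2) * ∑ i ∈ J, c i} ≤ Real.exp (τ * b - s) := by
  have h := measure_le_comp_sum_le (J := J) hX hind (rank := rank)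
    (D := fun i ω x => ((Y i ω x, c i) : E × ℝ))
    (Φ := fun v => τ * √(b ^ 2 + ‖v.1‖ ^ 2) - (τ / (2 * b) + τ ^ 2 / 2) * v.2)
    (fun i hi ω ω' h => by simp only [hY i hi h]) (fun i hi ω v => ?_) s
  · simpa only [Prod.fst_sum, Prod.snd_sum, Prod.fst_zero, Prod.snd_zero, mul_zero, sub_zero,
      norm_zero, zero_pow two_ne_zero, add_zero, Real.sqrt_sq hb.le] using h
  · have moment := sum_mul_exp_sqrt_sq_add_norm_sq_le
      (measureReal_preimage_mem_stdSimplex (Pr := Pr) (hX i)) (hmean i hi ω) (hbound i hi ω) hb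
      hτ v.1
    simp only [Prod.fst_add, Prod.snd_add, Real.exp_sub, ← mul_div_assoc, ← sum_div]
    rw [div_le_div_iff₀ (Real.exp_pos _) (Real.exp_pos _), ← Real.exp_add]
    refine (mul_le_mul_of_nonneg_right moment (Real.exp_pos _).le).trans_eq ?_
    rw [← Real.exp_add]
    congr 1
    ring

lemma measure_le_norm_sum_le (hX : ∀ i, Measurable (X i)) (hind : iIndepFun X Pr)
    {Y : ι → (ι → S) → S → E} {c : ι → ℝ}
    (hY : ∀ i ∈ J, DependsOn (Y i) {j ∈ (J : Set ι) | rank j < rank i})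
    (hmean : ∀ i ∈ J, ∀ ω, ∑ x, Pr.real (X i ⁻¹' {x}) • Y i ω x = 0)
    (hbound : ∀ i ∈ J, ∀ ω x, ‖Y i ω x‖ ^ 2 ≤ c i) {V t : ℝ} (hV : 0 < V)
    (hcV : ∑ i ∈ J, c i ≤ V) (ht : 1 ≤ t) :
    Pr.real {w | 3 * √(V * t) ≤ ‖∑ i ∈ J, Y i (fun j => X j w) (X i w)‖} ≤ Real.exp (-t) := by
  set b := √(V * t)
  have hb : 0 < b := Real.sqrt_pos.2 (by positivity)
  have hb2 : b ^ 2 = V * t := Real.sq_sqrt (by positivity)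
  set τ := t / b with hτ_def
  have hτ : 0 < τ := by positivity
  have hτb : τ * b = t := div_mul_cancel₀ _ hb.ne'
  set κ := τ / (2 * b) + τ ^ 2 / 2
  have variance_le : κ * ∑ i ∈ J, c i ≤ t := by
    calc κ * ∑ i ∈ J, c i ≤ κ * V := by gcongr
      _ = (t + t ^ 2) * V / (2 * b ^ 2) := by
          simp only [κ, hτ_def]
          field_simp
      _ = (1 + t) / 2 := by
          rw [hb2]
          field_simp
      _ ≤ t := by linarith
  have h := measure_le_mul_sqrt_sq_add_norm_sum_sq_sub_le hX hind hY hmean hbound hb hτ.le (2 * t)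
  refine (measureReal_mono fun w (hw : 3 * b ≤ _) => ?_).trans
    (h.trans_eq (by rw [hτb]; ring_nf))
  have far : τ * (3 * b) ≤ τ * √(b ^ 2 + ‖∑ i ∈ J, Y i (fun j => X j w) (X i w)‖ ^ 2) :=
    mul_le_mul_of_nonneg_left
      (hw.trans (Real.le_sqrt_of_sq_le (le_add_of_nonneg_left (sq_nonneg _)))) hτ.le
  change 2 * t ≤ τ * √(b ^ 2 + _) - κ * ∑ i ∈ J, c i
  linarith [show τ * (3 * b) = 3 * t by rw [mul_left_comm, hτb]]

end Adapted

/-! ### Concentration for adapted sums of batch means -/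

section Batches

/-- The pairs `(k, s)` of an iteration `1 ≤ k ≤ K` and a sample `s < r k` of its batch. -/
def batchIndices (r : ℕ → ℕ) (K : ℕ) : Finset (ℕ × ℕ) :=
  ((range K).sigma fun k => range (r (k + 1))).map
    ⟨fun p => (p.1 + 1, p.2), fun p p' h => by
      rw [Prod.mk.injEq, Nat.add_right_cancel_iff] at h
      exact Sigma.ext h.1 (heq_of_eq h.2)⟩

lemma mk_succ_mem_batchIndices {r : ℕ → ℕ} {K k s : ℕ} (hk : k < K) (hs : s < r (k + 1)) :
    (k + 1, s) ∈ batchIndices r K :=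
  mem_map.2 ⟨⟨k, s⟩, mem_sigma.2 ⟨mem_range.2 hk, mem_range.2 hs⟩, rfl⟩

lemma exists_of_mem_batchIndices {r : ℕ → ℕ} {K : ℕ} {p : ℕ × ℕ} (hp : p ∈ batchIndices r K) :
    ∃ k < K, ∃ s < r (k + 1), (k + 1, s) = p := by
  obtain ⟨p, h, rfl⟩ := mem_map.1 hp
  rw [mem_sigma, mem_range, mem_range] at h
  exact ⟨p.1, h.1, p.2, h.2, rfl⟩

lemma sum_batchIndices {E : Type*} [AddCommMonoid E] (r : ℕ → ℕ) (K : ℕ) (f : ℕ × ℕ → E) :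
    ∑ p ∈ batchIndices r K, f p = ∑ k ∈ range K, ∑ s ∈ range (r (k + 1)), f (k + 1, s) := by
  rw [batchIndices, sum_map, sum_sigma]
  rfl

lemma sum_batchIndices_smul_eq_sum_batchMean {S E : Type*} [AddCommMonoid E] [Module ℝ E]
    (r : ℕ → ℕ) (K : ℕ) (a : ℕ → ℝ) (f : ℕ → S → E) (ξ : ℕ → ℕ → S) :
    ∑ p ∈ batchIndices r K, (a (p.1 - 1) / r p.1) • f (p.1 - 1) (ξ p.1 p.2) =
      ∑ k ∈ range K, a k • batchMean (r (k + 1)) (f k) (ξ (k + 1)) := by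
  simp only [sum_batchIndices, batchMean, smul_smul, ← smul_sum, Nat.add_sub_cancel, div_eq_mul_inv]

lemma sum_batchIndices_sq_mul (r : ℕ → ℕ) (K : ℕ) (a c : ℕ → ℝ) :
    ∑ p ∈ batchIndices r K, (a (p.1 - 1) / r p.1) ^ 2 * c (p.1 - 1) =
      ∑ k ∈ range K, a k ^ 2 / r (k + 1) * c k := by
  rw [sum_batchIndices]
  refine sum_congr rfl fun k _ => ?_
  simp only [sum_const, card_range, nsmul_eq_mul, Nat.add_sub_cancel]
  rcases eq_or_ne (r (k + 1)) 0 with h | h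
  · simp only [h, Nat.cast_zero, zero_mul, div_zero]
  · field_simp

/-- `f k` is determined by the batches of the iterations `1, …, k`. -/
def BatchAdapted {S β : Type*} (r : ℕ → ℕ) (f : ℕ → (ℕ → ℕ → S) → β) : Prop :=
  ∀ k, DependsOn (fun ω => f k (Function.curry ω)) (batchIndices r k : Set (ℕ × ℕ))

lemma BatchAdapted.dependsOn {S β : Type*} {r : ℕ → ℕ} {f : ℕ → (ℕ → ℕ → S) → β}
    (hf : BatchAdapted r f) {k K : ℕ} (hk : k < K) (s : ℕ) :
    DependsOn (fun ω => f k (Function.curry ω))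
      {p ∈ (batchIndices r K : Set (ℕ × ℕ)) | p.1 < (k + 1, s).1} := fun ω ω' h => by
  refine hf k fun p hp => h p ?_
  obtain ⟨l, hl, t, ht, rfl⟩ := exists_of_mem_batchIndices hp
  exact ⟨mk_succ_mem_batchIndices (hl.trans hk) ht, Nat.succ_lt_succ hl⟩

lemma BatchAdapted.comp {S β γ : Type*} {r : ℕ → ℕ} {f : ℕ → (ℕ → ℕ → S) → β}
    (hf : BatchAdapted r f) (g : ℕ → β → γ) : BatchAdapted r fun k ω => g k (f k ω) :=
  fun k _ _ h => congrArg (g k) (hf k h)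

variable {S Ω : Type*} [Fintype S] [MeasurableSpace S] [DiscreteMeasurableSpace S]
  [MeasurableSpace Ω] {Pr : Measure Ω} [IsProbabilityMeasure Pr] {ξ : ℕ → ℕ → Ω → S}
  {r : ℕ → ℕ}

lemma measure_add_mul_sum_lt_sum_batchMean_le (hξ : ∀ k s, Measurable (ξ k s))
    (hind : iIndepFun (fun p : ℕ × ℕ => ξ p.1 p.2) Pr) {f : ℕ → (ℕ → ℕ → S) → S → ℝ}
    {c : ℕ → (ℕ → ℕ → S) → ℝ} (hf : BatchAdapted r f) (hc : BatchAdapted r c)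
    (hmean : ∀ k s ω, ∑ x, Pr.real (ξ (k + 1) s ⁻¹' {x}) * f k ω x = 0)
    (hbound : ∀ k ω x, f k ω x ^ 2 ≤ c k ω) (a : ℕ → ℝ) {b t : ℝ} (hb : 0 < b) (ht : 0 ≤ t)
    (K : ℕ) :
    Pr.real {w | b + t / (2 * b) * ∑ k ∈ range K, a k ^ 2 / r (k + 1) * c k (ξ · · w) <
      ∑ k ∈ range K, a k * batchMean (r (k + 1)) (f k (ξ · · w)) (ξ (k + 1) · w)} ≤
      Real.exp (-t) := by
  have h := measure_add_mul_sum_lt_sum_le (J := batchIndices r K) (rank := Prod.fst)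
    (X := fun p : ℕ × ℕ => ξ p.1 p.2) (fun p => hξ p.1 p.2) hind
    (φ := fun p ω x => (a (p.1 - 1) / r p.1) • f (p.1 - 1) (Function.curry ω) x)
    (c := fun p ω => (a (p.1 - 1) / r p.1) ^ 2 * c (p.1 - 1) (Function.curry ω))
    (fun p hp ω ω' h => ?_) (fun p hp ω ω' h => ?_) (fun p hp ω => ?_) (fun p hp ω x => ?_) hb ht
  · have means w := sum_batchIndices_smul_eq_sum_batchMean r K a (fun k => f k (ξ · · w)) (ξ · · w)
    have bounds w := sum_batchIndices_sq_mul r K a fun k => c k (ξ · · w)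
    simp only [smul_eq_mul] at means
    simp only [← means, ← bounds]
    exact h
  all_goals obtain ⟨k, hk, s, -, rfl⟩ := exists_of_mem_batchIndices hp
  · exact congrArg (fun v x => (a k / r (k + 1)) • v x) (hf.dependsOn hk s h)
  · exact congrArg (fun v => (a k / r (k + 1)) ^ 2 * v) (hc.dependsOn hk s h)
  · simp only [smul_eq_mul, mul_left_comm _ (_ / _), ← mul_sum, Nat.add_sub_cancel, hmean, mul_zero]
  · rw [smul_eq_mul, mul_pow]
    exact mul_le_mul_of_nonneg_left (hbound _ _ _) (sq_nonneg _)

lemma measure_le_norm_sum_batchMean_le {E : Type*} [NormedAddCommGroup E] [InnerProductSpace ℝ E]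
    (hξ : ∀ k s, Measurable (ξ k s))
    (hind : iIndepFun (fun p : ℕ × ℕ => ξ p.1 p.2) Pr) {f : ℕ → (ℕ → ℕ → S) → S → E}
    (hf : BatchAdapted r f) (hmean : ∀ k s ω, ∑ x, Pr.real (ξ (k + 1) s ⁻¹' {x}) • f k ω x = 0)
    {c : ℝ} (hbound : ∀ k ω x, ‖f k ω x‖ ^ 2 ≤ c) {a : ℕ → ℝ} {V t : ℝ} (hV : 0 < V) {K : ℕ}
    (hcV : ∑ k ∈ range K, a k ^ 2 / r (k + 1) * c ≤ V) (ht : 1 ≤ t) :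
    Pr.real {w | 3 * √(V * t) ≤
      ‖∑ k ∈ range K, a k • batchMean (r (k + 1)) (f k (ξ · · w)) (ξ (k + 1) · w)‖} ≤
      Real.exp (-t) := by
  have h := measure_le_norm_sum_le (J := batchIndices r K) (rank := Prod.fst)
    (X := fun p : ℕ × ℕ => ξ p.1 p.2) (fun p => hξ p.1 p.2) hind
    (Y := fun p ω x => (a (p.1 - 1) / r p.1) • f (p.1 - 1) (Function.curry ω) x)
    (c := fun p => (a (p.1 - 1) / r p.1) ^ 2 * c)
    (fun p hp ω ω' h => ?_) (fun p hp ω => ?_) (fun p hp ω x => ?_) hV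
    ((sum_batchIndices_sq_mul r K a fun _ => c).trans_le hcV) ht
  · have means w := sum_batchIndices_smul_eq_sum_batchMean r K a (fun k => f k (ξ · · w)) (ξ · · w)
    simp only [← means]
    exact h
  all_goals obtain ⟨k, hk, s, -, rfl⟩ := exists_of_mem_batchIndices hp
  · exact congrArg (fun v x => (a k / r (k + 1)) • v x) (hf.dependsOn hk s h)
  · simp only [smul_comm _ (_ / _), ← smul_sum, Nat.add_sub_cancel, hmean, smul_zero]
  · rw [norm_smul, mul_pow, Real.norm_eq_abs, sq_abs]
    exact mul_le_mul_of_nonneg_left (hbound _ _ _) (sq_nonneg _)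

end Batches

/-! ### Sampling errors -/

lemma norm_sub_sq_le_of_mem_stdSimplex {m n : ℕ} {x y : Stacked m n}
    (hx : ∀ i, block x i ∈ stdSimplex ℝ (Fin n)) (hy : ∀ i, block y i ∈ stdSimplex ℝ (Fin n)) :
    ‖x - y‖ ^ 2 ≤ 2 * m := by
  have sq_sub_le {a b : ℝ} (ha : a ∈ Set.Icc 0 1) (hb : b ∈ Set.Icc 0 1) :
      (a - b) ^ 2 ≤ a + b := by
    nlinarith [mul_nonneg ha.1 (sub_nonneg.2 ha.2), mul_nonneg hb.1 (sub_nonneg.2 hb.2),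
      mul_nonneg ha.1 hb.1]
  calc ‖x - y‖ ^ 2 = ∑ i, ∑ l, (block x i l - block y i l) ^ 2 := norm_sq_stacked _
    _ ≤ ∑ i, ∑ l, (block x i l + block y i l) := by
        gcongr with i _ l _
        exact sq_sub_le (mem_Icc_of_mem_stdSimplex (hx i) l) (mem_Icc_of_mem_stdSimplex (hy i) l)
    _ = 2 * m := by
        simp only [sum_add_distrib, (hx _).2, (hy _).2, sum_const, card_univ, Fintype.card_fin,
          nsmul_eq_mul]
        ring

namespace BaryProblem

variable {m n : ℕ} (P : BaryProblem m n)

/-- The error of a single sample as an estimate of the gradient of `Psi`. -/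
noncomputable def errorX (u : Stacked m n) (x : Fin m → Fin n) : Stacked m n :=
  P.sampleX u x - P.meanX u

/-- The error of a single sample as an estimate of the value of `Psi`. -/
noncomputable def errorV (u : Stacked m n) (x : Fin m → Fin n) : ℝ := P.Psi u - P.sampleVal u x

/-- The deviation of the point masses at the sampled indices from the measures `q_i`. -/
noncomputable def errorQ (x : Fin m → Fin n) : Stacked m n :=
  WithLp.toLp 2 fun ij => (if x ij.1 = ij.2 then 1 else 0) - P.q ij.1 ij.2

variable {P} {r : ℕ → ℕ} {ξ : ℕ → ℕ → Fin m → Fin n}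

lemma noiseX_eq {k : ℕ} (hr : r k ≠ 0) :
    P.noiseX r ξ k = batchMean (r k) (P.errorX (P.dualPoint r ξ k)) (ξ k) := by
  rw [noiseX, estimate, batchX_eq_batchMean]
  exact ((batchMean_sub _ _ _ _).trans (by rw [batchMean_const hr])).symm

lemma noiseV_eq {k : ℕ} (hr : r k ≠ 0) :
    P.noiseV r ξ k = batchMean (r k) (P.errorV (P.dualPoint r ξ k)) (ξ k) :=
  ((batchMean_sub _ _ _ _).trans (by rw [batchMean_const hr, noiseV])).symm

lemma inner_noiseX_eq {k : ℕ} (hr : r k ≠ 0) (d : Stacked m n) :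
    inner ℝ (P.sqrtW (P.noiseX r ξ k)) d =
      batchMean (r k) (fun x => inner ℝ (P.sqrtW (P.errorX (P.dualPoint r ξ k) x)) d) (ξ k) := by
  have h := map_batchMean ((innerₗ (Stacked m n)).flip (P.sqrtW d)) (r k)
    (P.errorX (P.dualPoint r ξ k)) (ξ k)
  simp only [LinearMap.flip_apply, innerₗ_apply_apply] at h
  simp only [noiseX_eq hr, inner_sqrtW_left, h]

section Bounds

variable (hq : ∀ i, P.q i ∈ stdSimplex ℝ (Fin n))

include hq

lemma norm_errorX_sq_le (u : Stacked m n) (x : Fin m → Fin n) : ‖P.errorX u x‖ ^ 2 ≤ 2 * m :=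
  norm_sub_sq_le_of_mem_stdSimplex (fun i => compGrad_mem_stdSimplex (block u i) (x i))
    (meanX_mem_stdSimplex hq u)

lemma norm_errorQ_sq_le (x : Fin m → Fin n) : ‖P.errorQ x‖ ^ 2 ≤ 2 * m :=
  norm_sub_sq_le_of_mem_stdSimplex
    (x := WithLp.toLp 2 fun ij => if x ij.1 = ij.2 then 1 else 0)
    (y := WithLp.toLp 2 fun ij => P.q ij.1 ij.2) (fun i => ite_eq_mem_stdSimplex ℝ (x i)) hq

lemma abs_errorV_le (hμ : 0 < P.mu) (u : Stacked m n) (x : Fin m → Fin n) :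
    |P.errorV u x| ≤ 2 * m * P.normC := by
  have logSumExp_le (i : Fin m) (j j' : Fin n) :
      logSumExp P.mu (columnPotential P.C (block u i) j) -
        logSumExp P.mu (columnPotential P.C (block u i) j') ≤ 2 * P.normC := by
    rw [sub_le_iff_le_add']
    have : Nonempty (Fin n) := ⟨j⟩
    refine logSumExp_le_add hμ fun l => ?_
    simp only [columnPotential]
    linarith [neg_abs_le (P.C l j), le_abs_self (P.C l j'), P.abs_C_le l j, P.abs_C_le l j']
  have errorV_eq : P.errorV u x = ∑ i, ∑ j, P.q i j *
      (logSumExp P.mu (columnPotential P.C (block u i) j) -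
        logSumExp P.mu (columnPotential P.C (block u i) (x i))) := by
    simp only [errorV, Psi, sampleVal, mul_sub, sum_sub_distrib, ← sum_mul, (hq _).2, one_mul]
  calc |P.errorV u x| ≤ ∑ i, ∑ j, P.q i j *
        |logSumExp P.mu (columnPotential P.C (block u i) j) -
          logSumExp P.mu (columnPotential P.C (block u i) (x i))| := by
        rw [errorV_eq]
        refine (abs_sum_le_sum_abs _ _).trans (sum_le_sum fun i _ => ?_)
        refine (abs_sum_le_sum_abs _ _).trans_eq (sum_congr rfl fun j _ => ?_)
        rw [abs_mul, abs_of_nonneg ((hq i).1 j)]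
    _ ≤ ∑ i, ∑ j, P.q i j * (2 * P.normC) := by
        exact sum_le_sum fun i _ => sum_le_sum fun j _ => mul_le_mul_of_nonneg_left
          (abs_sub_le_iff.2 ⟨logSumExp_le i j _, logSumExp_le i _ j⟩) ((hq i).1 j)
    _ = 2 * m * P.normC := by
        simp only [← sum_mul, (hq _).2, one_mul, sum_const, card_univ, Fintype.card_fin,
          nsmul_eq_mul]
        ring

lemma inner_errorX_sq_le (hlam : 0 ≤ P.lamMax) (u : Stacked m n) (x : Fin m → Fin n)
    (d : Stacked m n) :
    inner ℝ (P.sqrtW (P.errorX u x)) d ^ 2 ≤ 2 * m * P.lamMax * ‖d‖ ^ 2 :=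
  calc inner ℝ (P.sqrtW (P.errorX u x)) d ^ 2 ≤ ‖P.sqrtW (P.errorX u x)‖ ^ 2 * ‖d‖ ^ 2 := by
        rw [← mul_pow, ← sq_abs]
        gcongr
        exact abs_real_inner_le_norm _ _
    _ ≤ P.lamMax * (2 * m) * ‖d‖ ^ 2 := by
        gcongr
        refine (P.norm_sqrtW_sq_le _).trans ?_
        gcongr
        exact norm_errorX_sq_le hq u x
    _ = 2 * m * P.lamMax * ‖d‖ ^ 2 := by ring

end Bounds

lemma batchAdapted_iterate (P : BaryProblem m n) (r : ℕ → ℕ) :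
    BatchAdapted r fun k ξ => P.iterate r ξ k := by
  intro k ω ω' h
  induction k with
  | zero => rfl
  | succ k ih =>
    have past : P.iterate r (Function.curry ω) k = P.iterate r (Function.curry ω') k :=
      ih fun p hp => by
        obtain ⟨l, hl, s, hs, rfl⟩ := exists_of_mem_batchIndices hp
        exact h _ (mk_succ_mem_batchIndices (hl.trans (Nat.lt_succ_self k)) hs)
    have batch (u : Stacked m n) : P.batchX (r (k + 1)) (Function.curry ω (k + 1)) u =
        P.batchX (r (k + 1)) (Function.curry ω' (k + 1)) u := by
      simp only [batchX_eq_batchMean, batchMean]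
      congr 1
      refine sum_congr rfl fun s hs => congrArg (P.sampleX u) ?_
      exact h _ (mk_succ_mem_batchIndices (Nat.lt_succ_self k) (mem_range.1 hs))
    simp only [iterate, past, batch]

end BaryProblem

namespace IsSampling

variable {m n : ℕ} {P : BaryProblem m n} {Ω : Type*} [MeasurableSpace Ω] {Pr : Measure Ω}
  [IsProbabilityMeasure Pr] {ξ : ℕ → ℕ → Ω → Fin m → Fin n} (hs : IsSampling P.q Pr ξ)

include hs

lemma sum_measureReal_mul (k s : ℕ) (i : Fin m) (f : Fin n → ℝ) :
    ∑ x, Pr.real (ξ k s ⁻¹' {x}) * f (x i) = ∑ j, P.q i j * f j := by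
  have marginal (j : Fin n) : P.q i j =
      ∑ x : Fin m → Fin n, if x i = j then Pr.real (ξ k s ⁻¹' {x}) else 0 := by
    rw [← hs.law k s i j, ← sum_filter, sum_measureReal_preimage_singleton _
      fun x _ => hs.measurable k s (measurableSet_singleton x)]
    congr 1
    ext w
    simp
  simp only [marginal, sum_mul, ite_mul, zero_mul]
  rw [sum_comm]
  simp only [sum_ite_eq, mem_univ, if_true]

lemma sum_measureReal (k s : ℕ) : ∑ x, Pr.real (ξ k s ⁻¹' {x}) = 1 :=
  (measureReal_preimage_mem_stdSimplex (hs.measurable k s)).2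

lemma sum_smul_errorX (k s : ℕ) (u : Stacked m n) :
    ∑ x, Pr.real (ξ k s ⁻¹' {x}) • P.errorX u x = 0 := by
  simp only [BaryProblem.errorX, smul_sub, sum_sub_distrib, ← sum_smul, hs.sum_measureReal,
    one_smul]
  rw [sub_eq_zero]
  ext il
  simp only [WithLp.ofLp_sum, Finset.sum_apply, PiLp.smul_apply, smul_eq_mul, BaryProblem.sampleX,
    BaryProblem.meanX]
  exact hs.sum_measureReal_mul k s il.1 fun j => compGrad P.mu P.C (block u il.1) j il.2

lemma sum_smul_errorQ (k s : ℕ) : ∑ x, Pr.real (ξ k s ⁻¹' {x}) • P.errorQ x = 0 := by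
  ext il
  simp only [WithLp.ofLp_sum, Finset.sum_apply, PiLp.smul_apply, smul_eq_mul, BaryProblem.errorQ,
    mul_sub, sum_sub_distrib, ← sum_mul, hs.sum_measureReal, one_mul, PiLp.zero_apply]
  rw [hs.sum_measureReal_mul k s il.1 fun j => if j = il.2 then 1 else 0]
  simp

lemma sum_mul_errorV (k s : ℕ) (u : Stacked m n) :
    ∑ x, Pr.real (ξ k s ⁻¹' {x}) * P.errorV u x = 0 := by
  simp only [BaryProblem.errorV, mul_sub, sum_sub_distrib, ← sum_mul, hs.sum_measureReal, one_mul,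
    BaryProblem.sampleVal, mul_sum]
  rw [sub_eq_zero, BaryProblem.Psi]
  refine Eq.trans ?_ sum_comm
  exact sum_congr rfl fun i _ => (hs.sum_measureReal_mul k s i
    fun j => logSumExp P.mu (columnPotential P.C (block u i) j)).symm

lemma sum_mul_inner_errorX (k s : ℕ) (u d : Stacked m n) :
    ∑ x, Pr.real (ξ k s ⁻¹' {x}) * inner ℝ (P.sqrtW (P.errorX u x)) d = 0 := by
  simp only [← real_inner_smul_left, ← sum_inner, ← map_smul, ← map_sum, hs.sum_smul_errorX,
    map_zero, inner_zero_left]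

end IsSampling

/-! ### The output as a mixture of the samples -/

lemma sum_abs_block_le {m n : ℕ} (x : Stacked m n) :
    ∑ i, ∑ j, |block x i j| ≤ √(n * m) * ‖x‖ := by
  rw [← Real.sqrt_sq (norm_nonneg x), ← Real.sqrt_mul (by positivity)]
  refine Real.le_sqrt_of_sq_le ?_
  have h := sq_sum_le_card_mul_sum_sq (s := (univ : Finset (Fin m × Fin n)))
    (f := fun ij => |block x ij.1 ij.2|)
  simp only [sq_abs, Fintype.sum_prod_type, card_univ, Fintype.card_prod, Fintype.card_fin,
    Nat.cast_mul] at h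
  rwa [norm_sq_stacked, mul_comm (n : ℝ)]

namespace BaryProblem

variable {m n : ℕ} (P : BaryProblem m n) (r : ℕ → ℕ) (N : ℕ)

/-- The weight of the sample `ξ^k_s`, indexed by `p = (k, s)`, in the output after `N`
iterations. -/
noncomputable def outputWeight (p : ℕ × ℕ) : ℝ :=
  (bigA P.Lpsi N)⁻¹ * (alpha P.Lpsi p.1 / r p.1)

lemma sum_outputWeight_smul {S E : Type*} [AddCommMonoid E] [Module ℝ E] (f : ℕ → S → E)
    (ξ : ℕ → ℕ → S) :
    ∑ p : batchIndices r N, P.outputWeight r N p • f p.1.1 (ξ p.1.1 p.1.2) =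
      (bigA P.Lpsi N)⁻¹ • ∑ k ∈ range N,
        alpha P.Lpsi (k + 1) • batchMean (r (k + 1)) (f (k + 1)) (ξ (k + 1)) := by
  rw [sum_coe_sort (batchIndices r N) fun p => P.outputWeight r N p • f p.1 (ξ p.1 p.2),
    sum_batchIndices]
  simp only [outputWeight, batchMean, smul_sum, smul_smul, div_eq_mul_inv]

variable {P r N} {ξ : ℕ → ℕ → Fin m → Fin n}

lemma output_eq : P.output r ξ N =
    (bigA P.Lpsi N)⁻¹ • ∑ k ∈ range N, alpha P.Lpsi (k + 1) • P.estimate r ξ (k + 1) := by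
  rw [output, sum_range_succ']
  simp only [alpha, zero_smul, add_zero]
  rfl

lemma block_output_eq (i : Fin m) : block (P.output r ξ N) i = fun l =>
    ∑ p : batchIndices r N, P.outputWeight r N p *
      compGrad P.mu P.C (block (P.dualPoint r ξ p.1.1) i) (ξ p.1.1 p.1.2 i) l := by
  have output_eq_sum : P.output r ξ N = ∑ p : batchIndices r N,
      P.outputWeight r N p • P.sampleX (P.dualPoint r ξ p.1.1) (ξ p.1.1 p.1.2) := by
    rw [P.sum_outputWeight_smul r N fun k => P.sampleX (P.dualPoint r ξ k), output_eq]
    simp only [estimate, batchX_eq_batchMean]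
  ext l
  simp [output_eq_sum, block, sampleX]

section Mixture

variable (hμ : 0 < P.mu) (hlam : 0 < P.lamMax) (hN : 1 ≤ N) (hr : ∀ k < N, r (k + 1) ≠ 0)

include hμ hlam hN hr

lemma outputWeight_mem_stdSimplex :
    (fun p : batchIndices r N => P.outputWeight r N p) ∈ stdSimplex ℝ (batchIndices r N) := by
  have hL := Lpsi_pos hμ hlam
  refine ⟨fun p => ?_, ?_⟩
  · obtain ⟨k, -, s, -, hp⟩ := exists_of_mem_batchIndices p.2
    simp only [← hp]
    exact mul_nonneg (inv_nonneg.2 (bigA_nonneg hL N))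
      (div_nonneg (alpha_pos hL k).le (Nat.cast_nonneg _))
  · have h := P.sum_outputWeight_smul r N (fun _ _ => (1 : ℝ)) fun _ _ => ()
    simp only [smul_eq_mul, mul_one] at h
    rw [h, sum_congr rfl fun k hk => by rw [batchMean_const (hr k (mem_range.1 hk)), mul_one],
      ← bigA_eq_sum, inv_mul_cancel₀ (bigA_pos hL hN).ne']

lemma block_output_mem_stdSimplex (i : Fin m) :
    block (P.output r ξ N) i ∈ stdSimplex ℝ (Fin n) := by
  have hw := outputWeight_mem_stdSimplex hμ hlam hN hr
  rw [block_output_eq]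
  refine ⟨fun l => sum_nonneg fun p _ =>
    mul_nonneg (hw.1 p) ((compGrad_mem_stdSimplex _ _).1 l), ?_⟩
  rw [sum_comm]
  simp only [← mul_sum, (compGrad_mem_stdSimplex _ _).2, mul_one]
  exact hw.2

lemma regW_output_le {i : Fin m} (hq : P.q i ∈ stdSimplex ℝ (Fin n)) :
    regW P.mu P.C (P.q i) (block (P.output r ξ N) i) ≤
      ∑ p : batchIndices r N, P.outputWeight r N p *
        columnCost P.mu P.C (ξ p.1.1 p.1.2 i)
          (compGrad P.mu P.C (block (P.dualPoint r ξ p.1.1) i) (ξ p.1.1 p.1.2 i)) +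
      P.normC * ∑ j, |block (∑ p : batchIndices r N,
        P.outputWeight r N p • P.errorQ (ξ p.1.1 p.1.2)) i j| +
      P.mu * ∑ j, P.q i j * Real.log (P.q i j) := by
  have hw := outputWeight_mem_stdSimplex hμ hlam hN hr
  have deviation (j : Fin n) : block (∑ p : batchIndices r N,
      P.outputWeight r N p • P.errorQ (ξ p.1.1 p.1.2)) i j =
      ∑ p : batchIndices r N, P.outputWeight r N p * (if ξ p.1.1 p.1.2 i = j then 1 else 0) -
        P.q i j := by
    have total : P.q i j = ∑ p : batchIndices r N, P.outputWeight r N p * P.q i j := by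
      rw [← sum_mul, hw.2, one_mul]
    conv_rhs => rw [total, ← sum_sub_distrib]
    simp only [block, errorQ, WithLp.ofLp_sum, Finset.sum_apply, PiLp.smul_apply, smul_eq_mul,
      mul_sub]
  simp only [deviation, block_output_eq]
  exact regW_le_sum_columnCost_add hμ P.abs_C_le hq _ hw fun p => compGrad_mem_stdSimplex _ _

lemma sum_regW_output_le (hq : ∀ i, P.q i ∈ stdSimplex ℝ (Fin n)) :
    bigA P.Lpsi N * ∑ i, regW P.mu P.C (P.q i) (block (P.output r ξ N) i) ≤
      ∑ k ∈ range N, alpha P.Lpsi (k + 1) * (P.estimateCost r ξ (k + 1) + P.entropyQ) +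
      P.normC * (√(n * m) * ‖∑ k ∈ range N,
        alpha P.Lpsi (k + 1) • batchMean (r (k + 1)) P.errorQ (ξ (k + 1))‖) := by
  have hA := bigA_pos (Lpsi_pos hμ hlam) hN
  have costs := P.sum_outputWeight_smul r N (fun k => P.sampleCost (P.dualPoint r ξ k)) ξ
  simp only [smul_eq_mul] at costs
  have deviations := P.sum_outputWeight_smul r N (fun _ => P.errorQ) ξ
  set deviation := ∑ p : batchIndices r N, P.outputWeight r N p • P.errorQ (ξ p.1.1 p.1.2)
  have nodes : ∑ i, regW P.mu P.C (P.q i) (block (P.output r ξ N) i) ≤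
      ∑ p : batchIndices r N, P.outputWeight r N p *
          P.sampleCost (P.dualPoint r ξ p.1.1) (ξ p.1.1 p.1.2) +
        P.normC * (∑ i, ∑ j, |block deviation i j|) + P.entropyQ := by
    refine (sum_le_sum fun i _ => regW_output_le (ξ := ξ) hμ hlam hN hr (hq i)).trans_eq ?_
    simp only [sum_add_distrib, sampleCost, entropyQ, mul_sum]
    rw [sum_comm]
  calc bigA P.Lpsi N * ∑ i, regW P.mu P.C (P.q i) (block (P.output r ξ N) i)
      ≤ bigA P.Lpsi N * (∑ p : batchIndices r N, P.outputWeight r N p *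
          P.sampleCost (P.dualPoint r ξ p.1.1) (ξ p.1.1 p.1.2) +
        P.normC * (√(n * m) * ‖deviation‖) + P.entropyQ) := by
        gcongr
        refine nodes.trans ?_
        gcongr
        · exact P.normC_nonneg
        · exact sum_abs_block_le deviation
    _ = _ := by
        rw [mul_add, mul_add, show ‖deviation‖ = _ from congrArg norm deviations, norm_smul,
          Real.norm_of_nonneg (inv_nonneg.2 hA.le), costs]
        simp only [mul_add, sum_add_distrib, ← sum_mul, ← bigA_eq_sum, estimateCost]
        field_simp
        ring

end Mixture

end BaryProblem

/-! ### Accuracy when the sampling errors are small -/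

section InnerProductSpace

variable {E : Type*} [NormedAddCommGroup E] [InnerProductSpace ℝ E]

lemma exists_norm_le_inner_eq_neg (v : E) {R : ℝ} (hR : 0 ≤ R) :
    ∃ z : E, ‖z‖ ≤ R ∧ inner ℝ v z = -(R * ‖v‖) := by
  rcases eq_or_ne v 0 with rfl | hv
  · exact ⟨0, by simpa, by simp⟩
  · have hv' := norm_ne_zero_iff.2 hv
    refine ⟨-((R / ‖v‖) • v), ?_, ?_⟩
    · rw [norm_neg, norm_smul, Real.norm_of_nonneg (by positivity), div_mul_cancel₀ _ hv']
    · rw [inner_neg_right, real_inner_smul_right, real_inner_self_eq_norm_sq]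
      field_simp

lemma norm_inv_smul_add_sub_le {a A ρ : ℝ} (ha : 0 < a) (hA : 0 ≤ A) {x y z : E}
    (hx : ‖x - z‖ ≤ ρ) (hy : ‖y - z‖ ≤ ρ) : ‖(A + a)⁻¹ • (a • x + A • y) - z‖ ≤ ρ := by
  rw [← mem_closedBall_iff_norm] at hx hy ⊢
  have h := (convex_closedBall z ρ) hx hy (show 0 ≤ (A + a)⁻¹ * a by positivity)
    (show 0 ≤ (A + a)⁻¹ * A by positivity) (by field_simp; ring)
  rwa [mul_smul, mul_smul, ← smul_add] at h

end InnerProductSpace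

namespace BaryProblem

variable {m n : ℕ} {P : BaryProblem m n} {r : ℕ → ℕ} {ξ : ℕ → ℕ → Fin m → Fin n} {N : ℕ}

lemma lam_iterate_succ (k : ℕ) : (P.iterate r ξ (k + 1)).lam =
    (bigA P.Lpsi k + alpha P.Lpsi (k + 1))⁻¹ •
      (alpha P.Lpsi (k + 1) • (P.iterate r ξ k).zeta + bigA P.Lpsi k • (P.iterate r ξ k).y) := by
  rw [iterate, bigA_succ]

lemma y_iterate_succ (k : ℕ) : (P.iterate r ξ (k + 1)).y =
    (bigA P.Lpsi k + alpha P.Lpsi (k + 1))⁻¹ •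
      (alpha P.Lpsi (k + 1) • (P.iterate r ξ (k + 1)).zeta +
        bigA P.Lpsi k • (P.iterate r ξ k).y) := by
  rw [iterate, bigA_succ]

lemma duality_gap_le (hμ : 0 < P.mu) (hlam : 0 < P.lamMax)
    (hq : ∀ i, P.q i ∈ stdSimplex ℝ (Fin n)) (hN : 1 ≤ N) (hr : ∀ k < N, r (k + 1) ≠ 0)
    {R : ℝ} (hR : 0 ≤ R) :
    bigA P.Lpsi N * (∑ i, regW P.mu P.C (P.q i) (block (P.output r ξ N) i) +
      P.psi (P.iterate r ξ N).y + R * ‖P.sqrtW (P.output r ξ N)‖) ≤ R ^ 2 / 2 +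
      ∑ k ∈ range N, alpha P.Lpsi (k + 1) * P.noiseV r ξ (k + 1) +
      ∑ k ∈ range N, alpha P.Lpsi (k + 1) * inner ℝ (P.sqrtW (P.noiseX r ξ (k + 1)))
          ((P.iterate r ξ (k + 1)).lam - (P.iterate r ξ k).zeta) +
      ∑ k ∈ range N, alpha P.Lpsi (k + 1) ^ 2 * ‖P.sqrtW (P.noiseX r ξ (k + 1))‖ ^ 2 +
      P.normC * (√(n * m) * ‖∑ k ∈ range N,
        alpha P.Lpsi (k + 1) • batchMean (r (k + 1)) P.errorQ (ξ (k + 1))‖) := by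
  obtain ⟨z, hz, inner_z⟩ := exists_norm_le_inner_eq_neg (P.sqrtW (P.output r ξ N)) hR
  have primal_dual := primal_dual_sum (r := r) (ξ := ξ) hμ hlam hq N z
  have inner_output : ∑ k ∈ range N, alpha P.Lpsi (k + 1) *
      inner ℝ (P.estimate r ξ (k + 1)) (P.sqrtW z) =
      bigA P.Lpsi N * -(R * ‖P.sqrtW (P.output r ξ N)‖) := by
    rw [← inner_z, inner_sqrtW_left, output_eq, real_inner_smul_left, sum_inner,
      mul_inv_cancel_left₀ (bigA_pos (Lpsi_pos hμ hlam) hN).ne']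
    exact sum_congr rfl fun k _ => (real_inner_smul_left _ _ _).symm
  rw [inner_output] at primal_dual
  simp only [mul_add (alpha _ _) (P.noiseV _ _ _), sum_add_distrib] at primal_dual
  have primal := sum_regW_output_le (ξ := ξ) hμ hlam hN hr hq
  have hz_sq := pow_le_pow_left₀ (norm_nonneg z) hz 2
  linarith [sq_nonneg ‖(P.iterate r ξ N).zeta - z‖]

variable (P) in
/-- The total error `A_N ε` which is tolerated in the accelerated method. -/
noncomputable def budget (N : ℕ) (ε : ℝ) : ℝ := bigA P.Lpsi N * ε

variable (P) in
/-- A bound for the weighted sum of `K` batch means of errors, the squares of the `k`-th of which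
are at most `c k`; it fails with probability at most `exp (-L)`. -/
noncomputable def errorBound (r : ℕ → ℕ) (N : ℕ) (ε L : ℝ) (K : ℕ) (c : ℕ → ℝ) : ℝ :=
  P.budget N ε / 4 + L / (2 * (P.budget N ε / 4)) *
    ∑ k ∈ range K, alpha P.Lpsi (k + 1) ^ 2 / r (k + 1) * c k

/-- The number of iterations and the batch sizes suffice for accuracy `ε` with a failure
probability of order `N exp (-L)`. -/
structure Regime (P : BaryProblem m n) (r : ℕ → ℕ) (N : ℕ) (ε L : ℝ) : Prop where
  mu_pos : 0 < P.mu
  m_pos : 0 < m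
  lamMinPos_pos : 0 < P.lamMinPos
  lamMinPos_le : P.lamMinPos ≤ P.lamMax
  q_mem : ∀ i, P.q i ∈ stdSimplex ℝ (Fin n)
  eps_pos : 0 < ε
  one_le_L : 1 ≤ L
  one_le_N : 1 ≤ N
  radius_le : P.MF ^ 2 / P.lamMinPos ≤ P.budget N ε / 8
  batch_ne_zero : ∀ k < N, r (k + 1) ≠ 0
  batch_ge : ∀ k < N, 3600 * (m * P.lamMax * L * alpha P.Lpsi (k + 1)) ≤ ε * r (k + 1)

/-- All sampling errors of the run are of their typical size, up to the confidence level `L`;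
`ystar` is the point from which the distance of the iterates is controlled. -/
structure SmallErrors (P : BaryProblem m n) (r : ℕ → ℕ) (ξ : ℕ → ℕ → Fin m → Fin n) (N : ℕ)
    (ε L : ℝ) (ystar : Stacked m n) : Prop where
  norm_noiseX_le : ∀ k < N, ‖P.noiseX r ξ (k + 1)‖ ≤ 3 * √(2 * m / r (k + 1) * L)
  sum_inner_zeta_le : ∀ K < N, ∑ k ∈ range K, alpha P.Lpsi (k + 1) *
      inner ℝ (P.sqrtW (P.noiseX r ξ (k + 1))) (ystar - (P.iterate r ξ k).zeta) ≤
    P.errorBound r N ε L K fun k => 2 * m * P.lamMax * ‖ystar - (P.iterate r ξ k).zeta‖ ^ 2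
  sum_inner_lam_le : ∑ k ∈ range N, alpha P.Lpsi (k + 1) *
      inner ℝ (P.sqrtW (P.noiseX r ξ (k + 1)))
        ((P.iterate r ξ (k + 1)).lam - (P.iterate r ξ k).zeta) ≤
    P.errorBound r N ε L N fun k =>
      2 * m * P.lamMax * ‖(P.iterate r ξ (k + 1)).lam - (P.iterate r ξ k).zeta‖ ^ 2
  sum_noiseV_le : ∑ k ∈ range N, alpha P.Lpsi (k + 1) * P.noiseV r ξ (k + 1) ≤
    P.errorBound r N ε L N fun _ => (2 * m * P.normC) ^ 2
  norm_sum_errorQ_le : ‖∑ k ∈ range N, alpha P.Lpsi (k + 1) •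
      batchMean (r (k + 1)) P.errorQ (ξ (k + 1))‖ ≤
    3 * √(P.budget N ε / (1800 * P.lamMax * L) * L)

namespace Regime

variable {ε L : ℝ} {ystar : Stacked m n} (H : Regime P r N ε L)

include H

lemma lamMax_pos : 0 < P.lamMax := H.lamMinPos_pos.trans_le H.lamMinPos_le

lemma Lpsi_pos : 0 < P.Lpsi := BaryProblem.Lpsi_pos H.mu_pos H.lamMax_pos

lemma budget_pos : 0 < P.budget N ε := mul_pos (bigA_pos H.Lpsi_pos H.one_le_N) H.eps_pos

lemma L_pos : 0 < L := one_pos.trans_le H.one_le_L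

lemma sq_le_of_le_div_sqrt {R : ℝ} (hR : 0 ≤ R) (hR' : R ≤ P.MF / √P.lamMinPos) :
    R ^ 2 ≤ P.budget N ε / 8 := by
  refine le_trans ?_ H.radius_le
  rw [← Real.sq_sqrt H.lamMinPos_pos.le, ← div_pow]
  exact pow_le_pow_left₀ hR hR' 2

lemma mul_normC_sq_le : n * m * P.normC ^ 2 ≤ P.lamMax * (P.budget N ε / 16) := by
  have h := H.radius_le
  rw [MF, Real.sq_sqrt (by positivity), div_le_iff₀ H.lamMinPos_pos] at h
  linarith [mul_le_mul_of_nonneg_right H.lamMinPos_le H.budget_pos.le]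

lemma sum_alpha_sq_div_le {K : ℕ} (hK : K ≤ N) :
    m * P.lamMax * ∑ k ∈ range K, alpha P.Lpsi (k + 1) ^ 2 / r (k + 1) ≤
      P.budget N ε / (3600 * L) := by
  have hL := H.L_pos
  calc m * P.lamMax * ∑ k ∈ range K, alpha P.Lpsi (k + 1) ^ 2 / r (k + 1)
      ≤ ∑ k ∈ range K, alpha P.Lpsi (k + 1) * (ε / (3600 * L)) := by
        rw [mul_sum]
        refine sum_le_sum fun k hk => ?_
        have hkN := (mem_range.1 hk).trans_le hK
        have hr : (0 : ℝ) < r (k + 1) := Nat.cast_pos.2 (H.batch_ne_zero k hkN).pos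
        have h := mul_le_mul_of_nonneg_left (H.batch_ge k hkN) (alpha_pos H.Lpsi_pos k).le
        field_simp
        linarith
    _ = bigA P.Lpsi K * (ε / (3600 * L)) := by rw [bigA_eq_sum, sum_mul]
    _ ≤ bigA P.Lpsi N * (ε / (3600 * L)) :=
        mul_le_mul_of_nonneg_right (bigA_mono H.Lpsi_pos hK) (div_pos H.eps_pos (by positivity)).le
    _ = P.budget N ε / (3600 * L) := by rw [budget, mul_div_assoc]

lemma errorBound_le {K : ℕ} (hK : K ≤ N) {c : ℕ → ℝ} {B : ℝ} (hB : 0 ≤ B)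
    (hc : ∀ k < K, c k ≤ m * P.lamMax * B) :
    P.errorBound r N ε L K c ≤ P.budget N ε / 4 + B / 1800 := by
  have hE := H.budget_pos
  have hL := H.L_pos
  rw [errorBound]
  gcongr
  calc L / (2 * (P.budget N ε / 4)) * ∑ k ∈ range K, alpha P.Lpsi (k + 1) ^ 2 / r (k + 1) * c k
      ≤ L / (2 * (P.budget N ε / 4)) * (P.budget N ε / (3600 * L) * B) := by
        gcongr
        calc ∑ k ∈ range K, alpha P.Lpsi (k + 1) ^ 2 / r (k + 1) * c k
            ≤ ∑ k ∈ range K, alpha P.Lpsi (k + 1) ^ 2 / r (k + 1) * (m * P.lamMax * B) := by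
              gcongr with k hk
              exact hc k (mem_range.1 hk)
          _ = (m * P.lamMax * ∑ k ∈ range K, alpha P.Lpsi (k + 1) ^ 2 / r (k + 1)) * B := by
              rw [← sum_mul]
              ring
          _ ≤ P.budget N ε / (3600 * L) * B := by
              gcongr
              exact H.sum_alpha_sq_div_le hK
    _ = B / 1800 := by
        field_simp
        ring

end Regime

namespace SmallErrors

variable {ε L : ℝ} {ystar : Stacked m n} (hS : SmallErrors P r ξ N ε L ystar)
  (H : Regime P r N ε L)

include hS H

lemma sum_norm_noise_sq_le {K : ℕ} (hK : K ≤ N) :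
    ∑ k ∈ range K, alpha P.Lpsi (k + 1) ^ 2 * ‖P.sqrtW (P.noiseX r ξ (k + 1))‖ ^ 2 ≤
      P.budget N ε / 200 := by
  have hL := H.L_pos
  have hlam := H.lamMax_pos
  calc ∑ k ∈ range K, alpha P.Lpsi (k + 1) ^ 2 * ‖P.sqrtW (P.noiseX r ξ (k + 1))‖ ^ 2
      ≤ ∑ k ∈ range K,
          alpha P.Lpsi (k + 1) ^ 2 * (P.lamMax * (3 * √(2 * m / r (k + 1) * L)) ^ 2) := by
        gcongr with k hk
        refine (P.norm_sqrtW_sq_le _).trans ?_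
        gcongr
        exact hS.norm_noiseX_le k ((mem_range.1 hk).trans_le hK)
    _ = 18 * L * (m * P.lamMax * ∑ k ∈ range K, alpha P.Lpsi (k + 1) ^ 2 / r (k + 1)) := by
        simp only [mul_sum]
        refine sum_congr rfl fun k _ => ?_
        rw [mul_pow, Real.sq_sqrt (by positivity)]
        ring
    _ ≤ 18 * L * (P.budget N ε / (3600 * L)) := by
        gcongr
        exact H.sum_alpha_sq_div_le hK
    _ = P.budget N ε / 200 := by
        field_simp
        ring

lemma norm_zeta_sub_le (hy : P.IsDualSolution ystar) (hyn : ‖ystar‖ ≤ P.MF / √P.lamMinPos)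
    {K : ℕ} (hK : K < N) : ‖(P.iterate r ξ K).zeta - ystar‖ ≤ √(P.budget N ε) := by
  induction K using Nat.strong_induction_on with
  | _ K ih =>
    have hE := H.budget_pos
    have distance := norm_zeta_sub_sq_le (r := r) (ξ := ξ) H.mu_pos H.lamMax_pos H.q_mem hy K
    have bound := (hS.sum_inner_zeta_le K hK).trans
      (H.errorBound_le hK.le (B := 2 * P.budget N ε) (by positivity) fun k hk => by
        have h := pow_le_pow_left₀ (norm_nonneg _) (ih k hk (hk.trans hK)) 2
        rw [Real.sq_sqrt hE.le, norm_sub_rev] at h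
        have hml := mul_nonneg (Nat.cast_nonneg (α := ℝ) m) H.lamMax_pos.le
        linarith [mul_le_mul_of_nonneg_left h hml])
    refine Real.le_sqrt_of_sq_le ?_
    linarith [hS.sum_norm_noise_sq_le H hK.le, H.sq_le_of_le_div_sqrt (norm_nonneg _) hyn]

lemma norm_y_sub_le (hy : P.IsDualSolution ystar) (hyn : ‖ystar‖ ≤ P.MF / √P.lamMinPos)
    {K : ℕ} (hK : K < N) : ‖(P.iterate r ξ K).y - ystar‖ ≤ √(P.budget N ε) := by
  induction K with
  | zero => simpa only [iterate] using hS.norm_zeta_sub_le H hy hyn hK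
  | succ K ih =>
    rw [y_iterate_succ]
    exact norm_inv_smul_add_sub_le (alpha_pos H.Lpsi_pos K) (bigA_nonneg H.Lpsi_pos K)
      (hS.norm_zeta_sub_le H hy hyn hK) (ih (K.lt_succ_self.trans hK))

lemma norm_lam_sub_zeta_le (hy : P.IsDualSolution ystar) (hyn : ‖ystar‖ ≤ P.MF / √P.lamMinPos)
    {k : ℕ} (hk : k < N) :
    ‖(P.iterate r ξ (k + 1)).lam - (P.iterate r ξ k).zeta‖ ≤ 2 * √(P.budget N ε) := by
  have hzeta := hS.norm_zeta_sub_le H hy hyn hk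
  have hlam : ‖(P.iterate r ξ (k + 1)).lam - ystar‖ ≤ √(P.budget N ε) := by
    rw [lam_iterate_succ]
    exact norm_inv_smul_add_sub_le (alpha_pos H.Lpsi_pos k) (bigA_nonneg H.Lpsi_pos k) hzeta
      (hS.norm_y_sub_le H hy hyn hk)
  calc ‖(P.iterate r ξ (k + 1)).lam - (P.iterate r ξ k).zeta‖
      ≤ ‖(P.iterate r ξ (k + 1)).lam - ystar‖ + ‖ystar - (P.iterate r ξ k).zeta‖ :=
        norm_sub_le_norm_sub_add_norm_sub _ _ _
    _ ≤ 2 * √(P.budget N ε) := by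
        rw [norm_sub_rev ystar]
        linarith

lemma sum_inner_lam_sub_zeta_le (hy : P.IsDualSolution ystar)
    (hyn : ‖ystar‖ ≤ P.MF / √P.lamMinPos) :
    ∑ k ∈ range N, alpha P.Lpsi (k + 1) * inner ℝ (P.sqrtW (P.noiseX r ξ (k + 1)))
        ((P.iterate r ξ (k + 1)).lam - (P.iterate r ξ k).zeta) ≤ 13 / 50 * P.budget N ε := by
  have hE := H.budget_pos
  have bound := hS.sum_inner_lam_le.trans
    (H.errorBound_le le_rfl (B := 8 * P.budget N ε) (by positivity) fun k hk => by
      have h := pow_le_pow_left₀ (norm_nonneg _) (hS.norm_lam_sub_zeta_le H hy hyn hk) 2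
      rw [mul_pow, Real.sq_sqrt hE.le] at h
      have hml := mul_nonneg (Nat.cast_nonneg (α := ℝ) m) H.lamMax_pos.le
      linarith [mul_le_mul_of_nonneg_left h hml])
  linarith

lemma sum_alpha_mul_noiseV_le :
    ∑ k ∈ range N, alpha P.Lpsi (k + 1) * P.noiseV r ξ (k + 1) ≤ 13 / 50 * P.budget N ε := by
  have hE := H.budget_pos
  have bound := hS.sum_noiseV_le.trans
    (H.errorBound_le le_rfl (B := P.budget N ε / 4) (by positivity) fun _ _ => by
      have hn : (1 : ℝ) ≤ n := by
        have := nonempty_of_mem_stdSimplex (H.q_mem ⟨0, H.m_pos⟩)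
        exact_mod_cast Fin.pos_iff_nonempty.2 this
      have h : (m : ℝ) * P.normC ^ 2 ≤ P.lamMax * (P.budget N ε / 16) := by
        refine le_trans ?_ H.mul_normC_sq_le
        rw [mul_assoc]
        exact le_mul_of_one_le_left (by positivity) hn
      linarith [mul_le_mul_of_nonneg_left h (Nat.cast_nonneg (α := ℝ) m)])
  linarith

lemma normC_mul_norm_sum_errorQ_le :
    P.normC * (√(n * m) * ‖∑ k ∈ range N, alpha P.Lpsi (k + 1) •
      batchMean (r (k + 1)) P.errorQ (ξ (k + 1))‖) ≤ P.budget N ε / 10 := by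
  have hE := H.budget_pos
  have hL := H.L_pos
  have hlam := H.lamMax_pos
  calc P.normC * (√(n * m) * ‖∑ k ∈ range N, alpha P.Lpsi (k + 1) •
        batchMean (r (k + 1)) P.errorQ (ξ (k + 1))‖)
      ≤ P.normC * (√(n * m) * (3 * √(P.budget N ε / (1800 * P.lamMax * L) * L))) := by
        gcongr
        exacts [P.normC_nonneg, hS.norm_sum_errorQ_le]
    _ ≤ P.budget N ε / 10 := by
        refine le_of_sq_le_sq ?_ (by positivity)
        rw [mul_pow, mul_pow, mul_pow, Real.sq_sqrt (by positivity), Real.sq_sqrt (by positivity)]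
        calc _ = n * m * P.normC ^ 2 * (P.budget N ε / (200 * P.lamMax)) := by
              field_simp
              ring
          _ ≤ P.lamMax * (P.budget N ε / 16) * (P.budget N ε / (200 * P.lamMax)) :=
              mul_le_mul_of_nonneg_right H.mul_normC_sq_le (by positivity)
          _ ≤ (P.budget N ε / 10) ^ 2 := by
              field_simp
              norm_num

theorem accuracy (hy : P.IsDualSolution ystar) (hyn : ‖ystar‖ ≤ P.MF / √P.lamMinPos)
    {R : ℝ} (hR : R ≤ P.MF / √P.lamMinPos) {y : Stacked m n} (hyR : P.IsDualSolution y)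
    (hyR' : ‖y‖ ≤ R) :
    ∑ i, regW P.mu P.C (P.q i) (block (P.output r ξ N) i) + P.psi y ≤ ε ∧
      R * ‖P.sqrtW (P.output r ξ N)‖ ≤ ε := by
  have hA := bigA_pos H.Lpsi_pos H.one_le_N
  have hR0 : 0 ≤ R := (norm_nonneg y).trans hyR'
  set v := P.sqrtW (P.output r ξ N)
  have gap : ∑ i, regW P.mu P.C (P.q i) (block (P.output r ξ N) i) +
      P.psi (P.iterate r ξ N).y + 2 * R * ‖v‖ ≤ ε := by
    refine le_of_mul_le_mul_left ?_ hA
    have h := duality_gap_le (ξ := ξ) H.mu_pos H.lamMax_pos H.q_mem H.one_le_N H.batch_ne_zero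
      (mul_nonneg zero_le_two hR0)
    change _ ≤ P.budget N ε
    linarith [hS.sum_alpha_mul_noiseV_le H, hS.sum_inner_lam_sub_zeta_le H hy hyn,
      hS.sum_norm_noise_sq_le H le_rfl, hS.normC_mul_norm_sum_errorQ_le H,
      H.sq_le_of_le_div_sqrt hR0 hR, H.budget_pos]
  have optimal : P.psi y ≤ P.psi (P.iterate r ξ N).y := hyR (Set.mem_univ _)
  have weak_duality := inner_sub_psi_le H.mu_pos H.q_mem y
    fun i => block_output_mem_stdSimplex (ξ := ξ) H.mu_pos H.lamMax_pos H.one_le_N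
      H.batch_ne_zero i
  have inner_ge : -(R * ‖v‖) ≤ inner ℝ (P.sqrtW y) (P.output r ξ N) := by
    rw [inner_sqrtW_left]
    linarith [neg_le_of_abs_le (abs_real_inner_le_norm y v),
      mul_le_mul_of_nonneg_right hyR' (norm_nonneg v)]
  have penalty_nonneg : 0 ≤ R * ‖v‖ := mul_nonneg hR0 (norm_nonneg v)
  constructor <;> linarith

end SmallErrors

end BaryProblem

/-! ### Probability of small errors -/

lemma measureReal_biUnion_le_card_mul {Ω ι : Type*} [MeasurableSpace Ω] {μ : Measure Ω}
    {s : Finset ι} {f : ι → Set Ω} {c : ℝ} (h : ∀ i ∈ s, μ.real (f i) ≤ c) :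
    μ.real (⋃ i ∈ s, f i) ≤ #s * c :=
  (measureReal_biUnion_finset_le s f).trans <|
    (sum_le_card_nsmul _ _ _ h).trans_eq (nsmul_eq_mul _ _)

namespace BaryProblem

variable {m n : ℕ} {P : BaryProblem m n}

lemma batchAdapted_lam (P : BaryProblem m n) (r : ℕ → ℕ) :
    BatchAdapted r fun k ξ => (P.iterate r ξ (k + 1)).lam := by
  simp only [lam_iterate_succ]
  exact (P.batchAdapted_iterate r).comp fun k s => (bigA P.Lpsi k + alpha P.Lpsi (k + 1))⁻¹ •
    (alpha P.Lpsi (k + 1) • s.zeta + bigA P.Lpsi k • s.y)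

lemma batchAdapted_dualPoint (P : BaryProblem m n) (r : ℕ → ℕ) :
    BatchAdapted r fun k ξ => P.dualPoint r ξ (k + 1) :=
  (P.batchAdapted_lam r).comp fun _ => P.sqrtW

variable {Ω : Type*} [MeasurableSpace Ω] {Pr : Measure Ω} [IsProbabilityMeasure Pr]
  {ξ : ℕ → ℕ → Ω → Fin m → Fin n} {r : ℕ → ℕ} {N : ℕ} {ε L : ℝ}

namespace Regime

variable (H : P.Regime r N ε L) (hs : IsSampling P.q Pr ξ)

include H hs

lemma measure_norm_noiseX_gt_le {k : ℕ} (hk : k < N) :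
    Pr.real {w | ¬ ‖P.noiseX r (ξ · · w) (k + 1)‖ ≤ 3 * √(2 * m / r (k + 1) * L)} ≤
      Real.exp (-L) := by
  have hr := H.batch_ne_zero k hk
  have hm : (0 : ℝ) < m := Nat.cast_pos.2 H.m_pos
  have h := measure_le_norm_sum_batchMean_le (r := r) (K := k + 1) (a := Pi.single k 1)
    (V := 2 * m / r (k + 1)) hs.measurable hs.indep
    ((P.batchAdapted_dualPoint r).comp fun _ => P.errorX)
    (fun k s ω => hs.sum_smul_errorX (k + 1) s _)
    (fun _ _ _ => norm_errorX_sq_le H.q_mem _ _) (by positivity)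
    (by simp [Pi.single_apply, ite_div, inv_mul_eq_div]) H.one_le_L
  refine (measureReal_mono fun w hw => ?_).trans h
  simpa [Pi.single_apply, ← noiseX_eq hr] using (not_le.1 hw).le

lemma measure_sum_inner_gt_le {d : ℕ → (ℕ → ℕ → Fin m → Fin n) → Stacked m n}
    (hd : BatchAdapted r d) {K : ℕ} (hK : K ≤ N) :
    Pr.real {w | ¬ ∑ k ∈ range K, alpha P.Lpsi (k + 1) *
        inner ℝ (P.sqrtW (P.noiseX r (ξ · · w) (k + 1))) (d k (ξ · · w)) ≤
      P.errorBound r N ε L K fun k => 2 * m * P.lamMax * ‖d k (ξ · · w)‖ ^ 2} ≤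
      Real.exp (-L) := by
  have hE := H.budget_pos
  have h := measure_add_mul_sum_lt_sum_batchMean_le hs.measurable hs.indep
    (f := fun k ω x => inner ℝ (P.sqrtW (P.errorX (P.dualPoint r ω (k + 1)) x)) (d k ω))
    (c := fun k ω => 2 * m * P.lamMax * ‖d k ω‖ ^ 2)
    (fun k ω ω' h => by simp only [P.batchAdapted_dualPoint r k h, hd k h])
    (hd.comp fun _ v => 2 * m * P.lamMax * ‖v‖ ^ 2)
    (fun k s ω => hs.sum_mul_inner_errorX (k + 1) s _ _)
    (fun k ω x => inner_errorX_sq_le H.q_mem H.lamMax_pos.le _ _ _)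
    (fun k => alpha P.Lpsi (k + 1)) (b := P.budget N ε / 4) (by positivity) H.L_pos.le K
  refine (measureReal_mono fun w hw => ?_).trans h
  refine (not_le.1 hw).trans_eq (sum_congr rfl fun k hk => ?_)
  rw [inner_noiseX_eq (H.batch_ne_zero k ((mem_range.1 hk).trans_le hK))]

lemma measure_sum_noiseV_gt_le :
    Pr.real {w | ¬ ∑ k ∈ range N, alpha P.Lpsi (k + 1) * P.noiseV r (ξ · · w) (k + 1) ≤
      P.errorBound r N ε L N fun _ => (2 * m * P.normC) ^ 2} ≤ Real.exp (-L) := by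
  have hE := H.budget_pos
  have h := measure_add_mul_sum_lt_sum_batchMean_le hs.measurable hs.indep
    (c := fun _ _ => (2 * m * P.normC) ^ 2)
    ((P.batchAdapted_dualPoint r).comp fun _ => P.errorV) (fun _ _ _ _ => rfl)
    (fun k s ω => hs.sum_mul_errorV (k + 1) s _)
    (fun k ω x => sq_le_sq' (neg_le_of_abs_le (abs_errorV_le H.q_mem H.mu_pos _ _))
      (le_of_abs_le (abs_errorV_le H.q_mem H.mu_pos _ _)))
    (fun k => alpha P.Lpsi (k + 1)) (b := P.budget N ε / 4) (by positivity) H.L_pos.le N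
  refine (measureReal_mono fun w hw => ?_).trans h
  refine (not_le.1 hw).trans_eq (sum_congr rfl fun k hk => ?_)
  rw [noiseV_eq (H.batch_ne_zero k (mem_range.1 hk))]

lemma measure_norm_sum_errorQ_gt_le :
    Pr.real {w | ¬ ‖∑ k ∈ range N, alpha P.Lpsi (k + 1) •
        batchMean (r (k + 1)) P.errorQ (ξ (k + 1) · w)‖ ≤
      3 * √(P.budget N ε / (1800 * P.lamMax * L) * L)} ≤ Real.exp (-L) := by
  have hE := H.budget_pos
  have hlam := H.lamMax_pos
  have hL := H.L_pos
  have h := measure_le_norm_sum_batchMean_le (r := r) (K := N)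
    (a := fun k => alpha P.Lpsi (k + 1)) (V := P.budget N ε / (1800 * P.lamMax * L))
    hs.measurable hs.indep (f := fun _ _ => P.errorQ) (fun _ _ _ _ => rfl)
    (fun k s _ => hs.sum_smul_errorQ (k + 1) s) (fun _ _ => norm_errorQ_sq_le H.q_mem)
    (by positivity) ?_ H.one_le_L
  · exact (measureReal_mono fun w hw => (not_le.1 hw).le).trans h
  · have hvar := H.sum_alpha_sq_div_le le_rfl
    rw [le_div_iff₀ (by positivity)] at hvar ⊢
    rw [← sum_mul]
    linarith

lemma measure_not_smallErrors_le (ystar : Stacked m n) :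
    Pr.real {w | ¬ P.SmallErrors r (ξ · · w) N ε L ystar} ≤ (2 * N + 2) * Real.exp (-L) := by
  have hN : (#(Ico 1 N) : ℝ) = N - 1 := by rw [Nat.card_Ico, Nat.cast_sub H.one_le_N, Nat.cast_one]
  have hzeta := (P.batchAdapted_iterate r).comp fun _ s => ystar - s.zeta
  have hlam : BatchAdapted r fun k ξ => (P.iterate r ξ (k + 1)).lam - (P.iterate r ξ k).zeta :=
    fun k ω ω' h => by simp only [P.batchAdapted_lam r k h, P.batchAdapted_iterate r k h]
  have noise := measureReal_biUnion_le_card_mul fun k hk =>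
    H.measure_norm_noiseX_gt_le hs (mem_range.1 hk)
  have zeta := measureReal_biUnion_le_card_mul (s := Ico 1 N) fun K hK =>
    H.measure_sum_inner_gt_le hs hzeta (mem_Ico.1 hK).2.le
  have lam := H.measure_sum_inner_gt_le hs hlam le_rfl
  have value := H.measure_sum_noiseV_gt_le hs
  have frequency := H.measure_norm_sum_errorQ_gt_le hs
  rw [hN] at zeta
  rw [card_range] at noise
  have union_bound := (measureReal_union_le _ _).trans (add_le_add ((measureReal_union_le _ _).trans
    (add_le_add noise zeta)) ((measureReal_union_le _ _).trans (add_le_add lam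
    ((measureReal_union_le _ _).trans (add_le_add value frequency)))))
  refine (measureReal_mono fun w hw => ?_).trans (union_bound.trans_eq (by ring))
  by_contra hgood
  simp only [Set.mem_union, Set.mem_iUnion, not_or, not_exists, Set.mem_ofPred_eq, not_not] at hgood
  obtain ⟨⟨hnoise, hzeta⟩, hlam, hvalue, hfrequency⟩ := hgood
  refine hw ⟨fun k hk => hnoise k (mem_range.2 hk), fun K hK => ?_, hlam, hvalue, hfrequency⟩
  rcases K.eq_zero_or_pos with rfl | hK0
  · have hE := H.budget_pos
    simp only [errorBound, range_zero, sum_empty, mul_zero, add_zero]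
    positivity
  · exact hzeta K (mem_Ico.2 ⟨hK0, hK⟩)

theorem measure_accuracy {ystar : Stacked m n} (hy : P.IsDualSolution ystar)
    (hyn : ‖ystar‖ ≤ P.MF / √P.lamMinPos) {R : ℝ} (hR : R ≤ P.MF / √P.lamMinPos)
    {y : Stacked m n} (hyR : P.IsDualSolution y) (hyR' : ‖y‖ ≤ R) :
    1 - (2 * N + 2) * Real.exp (-L) ≤ Pr.real {w |
      ∑ i, regW P.mu P.C (P.q i) (block (P.output r (ξ · · w) N) i) + P.psi y ≤ ε ∧
      R * ‖P.sqrtW (P.output r (ξ · · w) N)‖ ≤ ε} := by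
  set good := {w | P.SmallErrors r (ξ · · w) N ε L ystar}
  have hbad : Pr.real goodᶜ ≤ (2 * N + 2) * Real.exp (-L) := H.measure_not_smallErrors_le hs ystar
  have total : 1 ≤ Pr.real good + Pr.real goodᶜ := by
    rw [← probReal_univ (μ := Pr), ← Set.union_compl_self good]
    exact measureReal_union_le _ _
  refine (by linarith : _ ≤ Pr.real good).trans (measureReal_mono fun w hw => ?_)
  exact SmallErrors.accuracy hw H hy hyn hR hyR hyR'

end Regime

end BaryProblem

/-! ### Operation counts -/

namespace Counted

lemma pure_ops {α : Type} (a : α) : (pure a : Counted α).ops = 0 := rfl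

lemma bind_ops {α β : Type} (x : Counted α) (f : α → Counted β) :
    (x >>= f).ops = x.ops + (f x.val).ops := rfl

lemma vec_ops {n : ℕ} {f : Fin n → Counted ℝ} {c : ℕ} (h : ∀ i, (f i).ops = c) :
    (vec f).ops = n * c := by
  simp [vec, h]

lemma loop_ops {α : Type} {f : ℕ → α → Counted α} {c : ℕ} (h : ∀ t a, (f t a).ops = c) (r : ℕ)
    (a : α) : (loop r f a).ops = r * c := by
  induction r with
  | zero => rw [loop, pure_ops, Nat.zero_mul]
  | succ r ih => rw [loop, bind_ops, ih, h, Nat.succ_mul]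

end Counted

section Programs

open Counted

variable {n : ℕ}

lemma oracleProg_ops (μ : ℝ) (C : Matrix (Fin n) (Fin n) ℝ) (u : Fin n → ℝ) (j : Fin n) :
    (oracleProg μ C u j).ops = 6 * n := by
  simp only [oracleProg, bind_ops]
  rw [vec_ops (c := 3) fun _ => rfl, vec_ops (c := 1) fun _ => rfl]
  simp only [draw, Counted.sum]
  ring

lemma batchProg_ops (μ : ℝ) (C : Matrix (Fin n) (Fin n) ℝ) (r : ℕ) (ξ : ℕ → Fin n)
    (u : Fin n → ℝ) : (batchProg μ C r ξ u).ops = 7 * n * r + n := by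
  simp only [batchProg, bind_ops]
  rw [loop_ops (c := 7 * n), vec_ops (c := 1) fun _ => rfl]
  · ring
  · intro t a
    rw [bind_ops, oracleProg_ops, vec_ops (c := 1) fun _ => rfl]
    ring

lemma combineProg_ops (a A A' : ℝ) (z y : Fin n → ℝ) : (combineProg a A A' z y).ops = n * 4 :=
  vec_ops fun _ => rfl

lemma afterProg_ops (s : NodeState n) (w : NodeMessage n) (g : Fin n → ℝ) :
    (BaryProblem.afterProg s w g).ops = 8 * n := by
  simp only [BaryProblem.afterProg, bind_ops, pure_ops, combineProg_ops]
  rw [vec_ops (c := 2) fun _ => rfl, vec_ops (c := 2) fun _ => rfl]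
  ring

variable {m : ℕ} (P : BaryProblem m n)

lemma beforeProg_ops (r : ℕ) (ξ : ℕ → Fin n) (s : NodeState n) :
    (P.beforeProg r ξ s).ops = 8 + 5 * n + 7 * n * r := by
  have step_ops : (stepProg P.Lpsi s.A).ops = 7 := rfl
  simp only [BaryProblem.beforeProg, bind_ops, pure_ops, combineProg_ops, batchProg_ops, step_ops,
    Counted.add]
  ring

lemma nodeRun_ops (r : ℕ → ℕ) (ξ : ℕ → ℕ → Fin m → Fin n) (N : ℕ) (i : Fin m) :
    (P.nodeRun r ξ N i).ops = N * (8 + 13 * n) + 7 * n * ∑ k ∈ range N, r (k + 1) := by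
  induction N with
  | zero => simp [BaryProblem.nodeRun, pure_ops]
  | succ N ih =>
    simp only [BaryProblem.nodeRun, bind_ops]
    rw [ih, beforeProg_ops, afterProg_ops, sum_range_succ]
    ring

lemma nodeComplexity_eq (r : ℕ → ℕ) (ξ : ℕ → ℕ → Fin m → Fin n) (N : ℕ) (i : Fin m) :
    P.nodeComplexity r ξ N i = N * (8 + 13 * n) + 7 * n * ∑ k ∈ range N, r (k + 1) + n := by
  simp only [BaryProblem.nodeComplexity, BaryProblem.nodeOutput, bind_ops]
  rw [nodeRun_ops, vec_ops (c := 1) fun _ => rfl, mul_one]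

end Programs

lemma one_le_log_div {a δ : ℝ} (ha : 1 ≤ a) (hδ : 0 < δ) (hδ' : δ < 1 / 4) :
    1 ≤ Real.log (a / δ) := by
  rw [Real.le_log_iff_exp_le (by positivity), le_div_iff₀ hδ]
  nlinarith [Real.exp_one_lt_d9, Real.exp_pos 1]

lemma log_le_mul_log_of_le_mul {κ x y : ℝ} (hκ : 0 < κ) (hx : 0 < x) (hxy : x ≤ κ * y)
    (hy : 1 ≤ Real.log y) : Real.log x ≤ (1 + |Real.log κ|) * Real.log y := by
  have hy0 : y ≠ 0 := by
    rintro rfl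
    norm_num at hy
  calc Real.log x ≤ Real.log κ + Real.log y := by
        rw [← Real.log_mul hκ.ne' hy0]
        exact Real.log_le_log hx hxy
    _ ≤ |Real.log κ| * Real.log y + Real.log y := by
        gcongr
        exact (le_abs_self _).trans (le_mul_of_one_le_right (abs_nonneg _) hy)
    _ = (1 + |Real.log κ|) * Real.log y := by ring

lemma union_bound_log_div_le {N δ : ℝ} (hN : 1 ≤ N) (hδ : 0 < δ) :
    (2 * N + 2) * Real.exp (-Real.log (N / δ)) ≤ 4 * δ := by
  rw [Real.exp_neg, Real.exp_log (by positivity), inv_div, mul_div_assoc',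
    div_le_iff₀ (by positivity)]
  linarith [mul_le_mul_of_nonneg_right hN hδ.le]

namespace BaryProblem

variable {m n : ℕ} (P : BaryProblem m n)

/-- The quantity `S = √(M_F² χ / (μ ε))`, the order of the number of iterations. -/
noncomputable def iterationScale (ε : ℝ) : ℝ := √(P.MF ^ 2 / (P.mu * ε) * P.chi)

/-- The order of the complexity of a node, divided by `n`. -/
noncomputable def complexityScale (ε δ : ℝ) : ℝ :=
  max (m * P.MF ^ 2 / ε ^ 2 * P.chi * Real.log (1 / δ * P.iterationScale ε)) (P.iterationScale ε)

variable {P}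

lemma iterationScale_sq (hlam : 0 < P.lamMax) (hlam' : 0 < P.lamMinPos) (hμ : 0 < P.mu) {ε : ℝ}
    (hε : 0 < ε) : P.iterationScale ε ^ 2 = P.MF ^ 2 / (P.mu * ε) * P.chi := by
  have hchi : 0 < P.chi := div_pos hlam hlam'
  exact Real.sq_sqrt (by positivity)

lemma sum_batch_le (hlam : 0 < P.lamMax) (hμ : 0 < P.mu) {κ ε L : ℝ} (hκ : 0 < κ) (hε : 0 < ε)
    (hL : 0 ≤ L) {N : ℕ} {r : ℕ → ℕ}
    (hr : ∀ k ∈ Icc 1 N, r k ≤ κ * max 1 (P.sigmaPsiSq * alpha P.Lpsi k * L / ε)) :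
    ∑ k ∈ range N, (r (k + 1) : ℝ) ≤ κ * (N + m * P.mu * N ^ 2 * L / (2 * ε)) := by
  have hLpsi := Lpsi_pos hμ hlam
  have hσ : 0 ≤ P.sigmaPsiSq := mul_nonneg (Nat.cast_nonneg _) hlam.le
  calc ∑ k ∈ range N, (r (k + 1) : ℝ)
      ≤ ∑ k ∈ range N, κ * (1 + P.sigmaPsiSq * alpha P.Lpsi (k + 1) * L / ε) := by
        refine sum_le_sum fun k hk => (hr (k + 1) ?_).trans ?_
        · exact mem_Icc.2 ⟨k.succ_pos, mem_range.1 hk⟩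
        · have ha := alpha_pos hLpsi k
          gcongr
          exact max_le (le_add_of_nonneg_right (by positivity)) (le_add_of_nonneg_left zero_le_one)
    _ = κ * (N + P.sigmaPsiSq * bigA P.Lpsi N * L / ε) := by
        rw [← mul_sum, sum_add_distrib, sum_const, card_range, nsmul_one, ← sum_div, ← sum_mul,
          ← mul_sum, ← bigA_eq_sum]
    _ ≤ κ * (N + P.sigmaPsiSq * (N ^ 2 / (2 * P.Lpsi)) * L / ε) := by
        gcongr
        exact bigA_le_sq_div hLpsi N
    _ = κ * (N + m * P.mu * N ^ 2 * L / (2 * ε)) := by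
        rw [Lpsi, sigmaPsiSq]
        field_simp

lemma variance_ops_le (hlam : 0 < P.lamMax) (hlam' : 0 < P.lamMinPos) (hμ : 0 < P.mu)
    {κ ε δ : ℝ} (hκ : 0 < κ) (hε : 0 < ε) (hδ : 0 < δ) (hδ' : δ < 1 / 4) {N : ℕ} (hN : 1 ≤ N)
    (hS : 1 ≤ P.iterationScale ε) (hNS : N ≤ κ * P.iterationScale ε) :
    m * P.mu * N ^ 2 * Real.log (N / δ) / (2 * ε) ≤
      κ ^ 2 / 2 * (1 + |Real.log κ|) * P.complexityScale ε δ := by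
  have hlogS := one_le_log_div hS hδ hδ'
  have hN1 : (1 : ℝ) ≤ N := Nat.one_le_cast.2 hN
  have hlogN := zero_le_one.trans (one_le_log_div hN1 hδ hδ')
  have log_le : Real.log (N / δ) ≤ (1 + |Real.log κ|) * Real.log (P.iterationScale ε / δ) := by
    refine log_le_mul_log_of_le_mul hκ (by positivity) ?_ hlogS
    rw [← mul_div_assoc]
    gcongr
  calc m * P.mu * N ^ 2 * Real.log (N / δ) / (2 * ε)
      ≤ m * P.mu * (κ * P.iterationScale ε) ^ 2 *
          ((1 + |Real.log κ|) * Real.log (P.iterationScale ε / δ)) / (2 * ε) := by gcongr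
    _ = κ ^ 2 / 2 * (1 + |Real.log κ|) *
          (m * P.MF ^ 2 / ε ^ 2 * P.chi * Real.log (1 / δ * P.iterationScale ε)) := by
        rw [mul_pow, iterationScale_sq hlam hlam' hμ hε, one_div_mul_eq_div]
        field_simp
    _ ≤ κ ^ 2 / 2 * (1 + |Real.log κ|) * P.complexityScale ε δ := by
        gcongr
        exact le_max_left _ _

theorem nodeComplexity_le (hlam : 0 < P.lamMax) (hlam' : 0 < P.lamMinPos) (hμ : 0 < P.mu)
    {κ ε δ : ℝ} (hκ : 0 < κ) (hε : 0 < ε) (hδ : 0 < δ) (hδ' : δ < 1 / 4) {N : ℕ} (hN : 1 ≤ N)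
    (hS : 1 ≤ P.iterationScale ε) (hNS : N ≤ κ * P.iterationScale ε) {r : ℕ → ℕ}
    (hr : ∀ k ∈ Icc 1 N,
      r k ≤ κ * max 1 (P.sigmaPsiSq * alpha P.Lpsi k * Real.log (N / δ) / ε))
    (ξ : ℕ → ℕ → Fin m → Fin n) (i : Fin m) :
    (P.nodeComplexity r ξ N i : ℝ) ≤
      (κ * (22 + 7 * κ) + 7 / 2 * κ ^ 3 * (1 + |Real.log κ|)) *
        (n * P.complexityScale ε δ) := by
  have hN1 : (1 : ℝ) ≤ N := Nat.one_le_cast.2 hN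
  have hn1 : (1 : ℝ) ≤ n := by
    refine Nat.one_le_cast.2 (Nat.one_le_iff_ne_zero.2 ?_)
    rintro rfl
    norm_num [iterationScale, MF] at hS
  have samples := (sum_batch_le hlam hμ hκ hε (zero_le_one.trans (one_le_log_div hN1 hδ hδ')) hr)
  have variance := variance_ops_le hlam hlam' hμ hκ hε hδ hδ' hN hS hNS
  have iterations : N ≤ κ * P.complexityScale ε δ :=
    hNS.trans (mul_le_mul_of_nonneg_left (le_max_right _ _) hκ.le)
  rw [nodeComplexity_eq]
  push_cast
  calc (N : ℝ) * (8 + 13 * n) + 7 * n * ∑ k ∈ range N, (r (k + 1) : ℝ) + n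
      ≤ n * (22 * N) + 7 * n * ∑ k ∈ range N, (r (k + 1) : ℝ) := by nlinarith
    _ ≤ n * (22 * (κ * P.complexityScale ε δ)) + 7 * n * (κ * (κ * P.complexityScale ε δ +
          κ ^ 2 / 2 * (1 + |Real.log κ|) * P.complexityScale ε δ)) := by
        gcongr
        exact samples.trans (by gcongr)
    _ = _ := by ring

/-! ### The parameters of the theorem -/

lemma radius_le (hlam : 0 < P.lamMax) (hlam' : 0 < P.lamMinPos) (hμ : 0 < P.mu) {ε : ℝ}
    (hε : 0 < ε) {N : ℕ} (hNS : 8 * P.iterationScale ε ≤ N) :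
    P.MF ^ 2 / P.lamMinPos ≤ P.budget N ε / 8 := by
  have hLpsi := Lpsi_pos hμ hlam
  have hS : 0 ≤ P.iterationScale ε := Real.sqrt_nonneg _
  calc P.MF ^ 2 / P.lamMinPos = (8 * P.iterationScale ε) ^ 2 / (8 * P.Lpsi) * ε / 8 := by
        rw [mul_pow, iterationScale_sq hlam hlam' hμ hε, Lpsi, chi]
        field_simp
    _ ≤ N ^ 2 / (8 * P.Lpsi) * ε / 8 := by gcongr
    _ ≤ P.budget N ε / 8 := by
        rw [budget]
        gcongr
        exact sq_div_le_bigA hLpsi N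

lemma regime_of_le (hm : 2 ≤ m) (hG : P.G.Connected) (hμ : 0 < P.mu)
    (hq : ∀ i, P.q i ∈ stdSimplex ℝ (Fin n)) {ε δ : ℝ} (hε : 0 < ε) (hδ : 0 < δ)
    (hδ' : δ < 1 / 4) {N : ℕ} {r : ℕ → ℕ} (hN : 1 ≤ N) (hNS : 8 * P.iterationScale ε ≤ N)
    (hr : ∀ k ∈ Icc 1 N,
      3600 * max 1 (P.sigmaPsiSq * alpha P.Lpsi k * Real.log (N / δ) / ε) ≤ r k) :
    P.Regime r N ε (Real.log (N / δ)) := by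
  have hm0 : 0 < m := two_pos.trans_le hm
  obtain ⟨l⟩ := nonempty_of_mem_stdSimplex (hq ⟨0, hm0⟩)
  have hlam' := P.lamMinPos_pos hm hG l
  have hle := P.lamMinPos_le_lamMax hm hG l
  have hlam := hlam'.trans_le hle
  have hr' k (hk : k < N) := hr (k + 1) (mem_Icc.2 ⟨k.succ_pos, hk⟩)
  refine ⟨hμ, hm0, hlam', hle, hq, hε, one_le_log_div (Nat.one_le_cast.2 hN) hδ hδ', hN,
    radius_le hlam hlam' hμ hε hNS, fun k hk => ?_, fun k hk => ?_⟩
  · have batch_pos : (0 : ℝ) < r (k + 1) := lt_of_lt_of_le (by positivity) (hr' k hk)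
    exact (Nat.cast_pos.1 batch_pos).ne'
  · calc 3600 * (m * P.lamMax * Real.log (N / δ) * alpha P.Lpsi (k + 1))
        = ε * (3600 * (P.sigmaPsiSq * alpha P.Lpsi (k + 1) * Real.log (N / δ) / ε)) := by
          rw [sigmaPsiSq]
          field_simp
      _ ≤ ε * r (k + 1) := by
          gcongr
          exact (mul_le_mul_of_nonneg_left (le_max_right _ _) (by norm_num)).trans (hr' k hk)

end BaryProblem

end WBary

theorem mainTheorem4 :
    ∃ cN > (0 : ℝ), ∃ cr > (0 : ℝ), ∀ κ > (0 : ℝ), ∃ cT > (0 : ℝ),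
      ∀ (m n : ℕ) (P : WBary.BaryProblem m n),
        2 ≤ m → P.G.Connected → 0 < P.mu → (∀ i, P.q i ∈ stdSimplex ℝ (Fin n)) →
      ∀ ε δ : ℝ, 0 < ε → 0 < δ → δ < 1 / 4 →
      ∀ (N : ℕ) (r : ℕ → ℕ), 1 ≤ N →
        cN * Real.sqrt (P.MF ^ 2 / (P.mu * ε) * P.chi) ≤ N →
        (∀ k ∈ Finset.Icc 1 N,
          cr * max 1 (P.sigmaPsiSq * WBary.alpha P.Lpsi k * Real.log (N / δ) / ε) ≤ r k) →
      -- accuracy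
      (∃ ystar, P.IsDualSolution ystar ∧ ‖ystar‖ ≤ P.MF / Real.sqrt P.lamMinPos) ∧
      (∃ pstar, P.IsBarycenter pstar ∧
        ∀ Ry : ℝ, (∃ ystar, P.IsDualSolution ystar ∧ ‖ystar‖ ≤ Ry) →
          Ry ≤ P.MF / Real.sqrt P.lamMinPos →
        ∀ (Ω : Type*) [MeasurableSpace Ω] (Pr : Measure Ω) [IsProbabilityMeasure Pr]
          (ξ : ℕ → ℕ → Ω → Fin m → Fin n), WBary.IsSampling P.q Pr ξ →
          1 - 4 * δ ≤ Pr.real {ω |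
            ∑ i, WBary.regW P.mu P.C (P.q i)
                (WBary.block (P.output r (fun k s => ξ k s ω) N) i)
              - ∑ i, WBary.regW P.mu P.C (P.q i) pstar ≤ ε ∧
            (0 < Ry → ‖P.sqrtW (P.output r (fun k s => ξ k s ω) N)‖ ≤ ε / Ry)}) ∧
      -- complexity
      (1 ≤ Real.sqrt (P.MF ^ 2 / (P.mu * ε) * P.chi) →
        N ≤ κ * Real.sqrt (P.MF ^ 2 / (P.mu * ε) * P.chi) →
        (∀ k ∈ Finset.Icc 1 N,
          r k ≤ κ * max 1 (P.sigmaPsiSq * WBary.alpha P.Lpsi k * Real.log (N / δ) / ε)) →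
        ∀ (ξ : ℕ → ℕ → Fin m → Fin n) (i : Fin m),
          (P.nodeComplexity r ξ N i : ℝ) ≤ cT * (n * max
            (m * P.MF ^ 2 / ε ^ 2 * P.chi *
              Real.log (1 / δ * Real.sqrt (P.MF ^ 2 / (P.mu * ε) * P.chi)))
            (Real.sqrt (P.MF ^ 2 / (P.mu * ε) * P.chi)))) := by
  refine ⟨8, by norm_num, 3600, by norm_num, fun κ hκ =>
    ⟨κ * (22 + 7 * κ) + 7 / 2 * κ ^ 3 * (1 + |Real.log κ|), by positivity, ?_⟩⟩
  intro m n P hm hG hμ hq ε δ hε hδ hδ' N r hN hNS hr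
  have H := WBary.BaryProblem.regime_of_le hm hG hμ hq hε hδ hδ' hN hNS hr
  obtain ⟨ystar, hystar, norm_ystar⟩ :=
    WBary.BaryProblem.exists_isDualSolution_norm_le hμ hq hm hG
  obtain ⟨pstar, hpstar, objective_eq⟩ :=
    WBary.BaryProblem.exists_isBarycenter_objective_eq hμ hq H.m_pos.ne' hG
  refine ⟨⟨ystar, hystar, norm_ystar⟩, ⟨pstar, hpstar, ?_⟩, fun hS hNκ hrκ =>
    WBary.BaryProblem.nodeComplexity_le H.lamMax_pos H.lamMinPos_pos hμ hκ hε hδ hδ' hN hS hNκ hrκ⟩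
  rintro R ⟨y, hy, hyR⟩ hR Ω _ Pr _ ξ hξ
  have failure := WBary.union_bound_log_div_le (N := N) (Nat.one_le_cast.2 hN) hδ
  refine (sub_le_sub_left failure 1).trans <|
    (H.measure_accuracy hξ hystar norm_ystar hR hy hyR).trans <|
    measureReal_mono fun ω ⟨gap, penalty⟩ => ⟨?_, fun hR0 => ?_⟩
  · have strong_duality : ∑ i, WBary.regW P.mu P.C (P.q i) pstar = -P.psi y := objective_eq y hy
    linarith
  · rwa [le_div_iff₀' hR0]
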